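/- Let $\mathcal{H}$ be intensional Martin-Löf type theory with $\Sigma$-types (dependent eliminator, no judgemental $\eta$), $\Pi$-types (judgemental $\beta$ and $\eta$), identity types $\mathsf{Id}$ (with eliminator $\mathsf{J}$ and its judgemental computation rule), a universe $\mathsf{U}$ à la Russell closed under $\Sigma$, $\Pi$ and $\mathsf{Id}$, and the function extensionality axiom (pointwise paths between $f$ and $g$ yield a path $\mathsf{Id}(f,g)$). In $\mathcal{H}$, a type $X$ is contractible if $\mathsf{iscontr}(X) := (\Sigma x : X)(\Pi y : X)\,\mathsf{Id}_X(x,y)$ is inhabited, a function $f : X \to Y$ is an equivalence if $\mathsf{isequiv}(f) := (\Pi y : Y)\,\mathsf{iscontr}\big((\Sigma x : X)\,\mathsf{Id}_Y(fx,y)\big)$ is inhabited, and $\mathsf{Equiv}(X,Y) := (\Sigma f : X \to Y)\,\mathsf{isequiv}(f)$. The univalence axiom states that for all $X, Y : \mathsf{U}$ the function $\mathsf{Id}_{\mathsf{U}}(X,Y) \to \mathsf{Equiv}(X,Y)$ defined by $\mathsf{Id}$-elimination, sending $\mathsf{refl}(X)$ to the identity equivalence, is an equivalence. Let $A : \mathsf{U}$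 and $B : A \to \mathsf{U}$, and put $PX := (\Sigma x : A)(B(x) \to X)$ for $X : \mathsf{U}$ and, for $f : X \to Y$, let $Pf : PX \to PY$ be the function given by $\Sigma$-elimination with $(Pf)(x,u) = (x, f \circ u)$. The type of $P$-algebras is $\mathsf{Alg} := (\Sigma C : \mathsf{U})(PC \to C)$. For $P$-algebras $C = (C, \sup_C)$ and $D = (D, \sup_D)$, the type of $P$-algebra morphisms is $$\mathsf{Alg}(C,D) := (\Sigma f : C \to D)\ \mathsf{Id}(f \circ \sup\nolimits_C,\ \sup\nolimits_D \circ Pf).$$ The identity morphism $1_C$ has as its path the one given by reflexivity at canonical pairs, and the composite of $(f,\bar f) : C \to D$ and $(g, \bar g) : D \to E$ is $g \circ f$ with the composite path $$g \circ f \circ \sup\nolimits_C \xrightarrow{\ g \circ \bar f\ } g \circ \sup\nolimits_D \circ Pf \xrightarrow{\ \bar g \circ Pf\ } \sup\nolimits_E \circ Pg \circ Pf \longrightarrow \sup\nolimits_E \circ P(g \circ f),$$ the last path coming from the path $\mathsf{Id}(P(g \circ f), Pg \circ Pf)$ that is given by reflexivity at canonical pairs. For $f : \mathsf{Alg}(C,D)$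 let $$\mathsf{isalgequiv}(f) := (\Sigma g : \mathsf{Alg}(D,C))\,\mathsf{Id}_{\mathsf{Alg}(C,C)}(g f, 1_C) \times (\Sigma h : \mathsf{Alg}(D,C))\,\mathsf{Id}_{\mathsf{Alg}(D,D)}(f h, 1_D),$$ and let $\mathsf{AlgEquiv}(C,D) := (\Sigma f : \mathsf{Alg}(C,D))\,\mathsf{isalgequiv}(f)$ be the type of $P$-algebra equivalences. **Theorem.** In $\mathcal{H}$ identity morphisms are algebra equivalences: the type $(\Pi C : \mathsf{Alg})\,\mathsf{isalgequiv}(1_C)$ is inhabited, for all $A : \mathsf{U}$ and $B : A \to \mathsf{U}$. For $\iota : (\Pi C : \mathsf{Alg})\,\mathsf{isalgequiv}(1_C)$ let $$\mathsf{ext}^{\mathsf{Alg}}_{C,D} : \mathsf{Id}_{\mathsf{Alg}}(C,D) \to \mathsf{AlgEquiv}(C,D)$$ be the canonical function, defined by $\mathsf{Id}$-elimination and sending $\mathsf{refl}(C)$ to $(1_C, \iota(C))$. Assuming the univalence axiom, for all $A : \mathsf{U}$, $B : A \to \mathsf{U}$ and every such $\iota$, the function $\mathsf{ext}^{\mathsf{Alg}}_{C,D}$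 is an equivalence for every pair of $P$-algebras $C$ and $D$. That is, the type $$(\Pi A : \mathsf{U})(\Pi B : A \to \mathsf{U})\big(\Pi \iota : (\Pi C : \mathsf{Alg})\,\mathsf{isalgequiv}(1_C)\big)(\Pi C : \mathsf{Alg})(\Pi D : \mathsf{Alg})\ \mathsf{isequiv}\big(\mathsf{ext}^{\mathsf{Alg}}_{C,D}\big)$$ is inhabited in $\mathcal{H}$ extended by the univalence axiom. -/

import Mathlib

/-! The dependent type theory `H`: raw syntax with de Bruijn indices, the four forms of judgement
(and well-formedness of contexts), the derivation rules, and then, as type expressions of `H`,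
the notions of equivalence, univalence, polynomial functor, algebra, algebra morphism and
algebra equivalence. -/

namespace TTH

/-- Raw types and terms; types are not separated from terms since the universe is à la Russell.
Number of variables bound in each argument: `pi A B`, `lam A b`, `sigma A B` bind one variable in
the second argument; `pair B a b` is the pair `(a, b)`, annotated by the family `B` that binds one
variable; `split E e c` is the eliminator of `Σ`-types, the motive `E` binds one variable and the
branch `e` binds two; `J E e a b p` is the eliminator of identity types, the motive `E` binds three
variables and the branch `e` binds one; in `funext f g α` the family of paths `α` binds one. -/
inductive Tm : Type
  | var (n : ℕ)
  | univ
  | pi (A B : Tm)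
  | lam (A b : Tm)
  | app (f a : Tm)
  | sigma (A B : Tm)
  | pair (B a b : Tm)
  | split (E e c : Tm)
  | id (A a b : Tm)
  | refl (a : Tm)
  | J (E e a b p : Tm)
  | funext (f g α : Tm)

namespace Tm

/-- Lifting of a renaming under a binder. -/
def upr (ρ : ℕ → ℕ) : ℕ → ℕ
  | 0 => 0
  | n + 1 => ρ n + 1

/-- Renaming of variables. -/
def rename : (ℕ → ℕ) → Tm → Tm
  | ρ, var n => var (ρ n)
  | _, univ => univ
  | ρ, pi A B => pi (rename ρ A) (rename (upr ρ) B)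
  | ρ, lam A b => lam (rename ρ A) (rename (upr ρ) b)
  | ρ, app f a => app (rename ρ f) (rename ρ a)
  | ρ, sigma A B => sigma (rename ρ A) (rename (upr ρ) B)
  | ρ, pair B a b => pair (rename (upr ρ) B) (rename ρ a) (rename ρ b)
  | ρ, split E e c => split (rename (upr ρ) E) (rename (upr (upr ρ)) e) (rename ρ c)
  | ρ, id A a b => id (rename ρ A) (rename ρ a) (rename ρ b)
  | ρ, refl a => refl (rename ρ a)
  | ρ, J E e a b p =>
      J (rename (upr (upr (upr ρ))) E) (rename (upr ρ) e) (rename ρ a) (rename ρ b) (rename ρ p)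
  | ρ, funext f g α => funext (rename ρ f) (rename ρ g) (rename (upr ρ) α)

/-- Weakening by `k` variables. -/
def wk (k : ℕ) (t : Tm) : Tm := t.rename (fun n => n + k)

/-- The substitution sending variable `0` to `a` and variable `n + 1` to `σ n`. -/
def scons (a : Tm) (σ : ℕ → Tm) : ℕ → Tm
  | 0 => a
  | n + 1 => σ n

/-- Lifting of a substitution under a binder. -/
def up (σ : ℕ → Tm) : ℕ → Tm := scons (var 0) (fun n => (σ n).wk 1)

/-- Simultaneous substitution. -/
def subst : (ℕ → Tm) → Tm → Tm
  | σ, var n => σ n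
  | _, univ => univ
  | σ, pi A B => pi (subst σ A) (subst (up σ) B)
  | σ, lam A b => lam (subst σ A) (subst (up σ) b)
  | σ, app f a => app (subst σ f) (subst σ a)
  | σ, sigma A B => sigma (subst σ A) (subst (up σ) B)
  | σ, pair B a b => pair (subst (up σ) B) (subst σ a) (subst σ b)
  | σ, split E e c => split (subst (up σ) E) (subst (up (up σ)) e) (subst σ c)
  | σ, id A a b => id (subst σ A) (subst σ a) (subst σ b)
  | σ, refl a => refl (subst σ a)
  | σ, J E e a b p =>
      J (subst (up (up (up σ))) E) (subst (up σ) e) (subst σ a) (subst σ b) (subst σ p)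
  | σ, funext f g α => funext (subst σ f) (subst σ g) (subst (up σ) α)

/-- `B(a)`, for `B` with one free variable more. -/
def inst (B a : Tm) : Tm := B.subst (scons a var)

/-- `e(a, b)`, for `e` with two free variables more; `a` is for the outer one. -/
def inst₂ (e a b : Tm) : Tm := e.subst (scons b (scons a var))

/-- `E(a, b, p)`, for `E` with three free variables more; `a` is for the outermost one. -/
def inst₃ (E a b p : Tm) : Tm := E.subst (scons p (scons b (scons a var)))

/-- For a motive `E(z)` over `z : (Σ x : A) B(x)`, the type `E(pair(x, y))` in the context extended
by `x : A` and `y : B(x)`. -/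
def atPair (E B : Tm) : Tm :=
  E.subst (scons (pair (B.rename (upr (fun n => n + 2))) (var 1) (var 0)) (fun n => var (n + 2)))

/-- For a motive `E(x, y, u)`, the type `E(x, x, refl(x))` in the context extended by `x : A`. -/
def atRefl (E : Tm) : Tm :=
  E.subst (scons (refl (var 0)) (scons (var 0) (scons (var 0) (fun n => var (n + 1)))))

end Tm

open Tm

/-- Contexts; the most recent variable, of index `0`, comes first. The type of the variable `n` is
an expression over the variables declared before it. -/
abbrev Ctx := List Tm

/-- Forms of judgement: well-formedness of the context, `A : type`, `A = B : type`, `a : A` and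
`a = b : A`. -/
inductive Jdg : Type
  | ctx
  | type (A : Tm)
  | typeEq (A B : Tm)
  | term (a A : Tm)
  | termEq (a b A : Tm)

/-- Substitution in a judgement. -/
def Jdg.subst (σ : ℕ → Tm) : Jdg → Jdg
  | .ctx => .ctx
  | .type A => .type (A.subst σ)
  | .typeEq A B => .typeEq (A.subst σ) (B.subst σ)
  | .term a A => .term (a.subst σ) (A.subst σ)
  | .termEq a b A => .termEq (a.subst σ) (b.subst σ) (A.subst σ)

open Jdg

/-- Derivability of a hypothetical judgement in `H`. -/
inductive Derivable : Ctx → Jdg → Prop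
  /- Contexts and variables. -/
  | nil : Derivable [] ctx
  | cons {Γ A} : Derivable Γ (type A) → Derivable (A :: Γ) ctx
  | var {Γ A} {n : ℕ} : Derivable Γ ctx → Γ[n]? = some A →
      Derivable Γ (term (var n) (A.wk (n + 1)))
  /- Substitution (which includes weakening), and substitution of judgementally equal terms. -/
  | subst {Γ Δ : Ctx} {𝒥 : Jdg} {σ : ℕ → Tm} : Derivable Γ 𝒥 → Derivable Δ ctx →
      (∀ n A, Γ[n]? = some A → Derivable Δ (term (σ n) ((A.wk (n + 1)).subst σ))) →
      Derivable Δ (𝒥.subst σ)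
  | subst_typeEq {Γ Δ : Ctx} {B : Tm} {σ τ : ℕ → Tm} : Derivable Γ (type B) → Derivable Δ ctx →
      (∀ n A, Γ[n]? = some A → Derivable Δ (termEq (σ n) (τ n) ((A.wk (n + 1)).subst σ))) →
      Derivable Δ (typeEq (B.subst σ) (B.subst τ))
  | subst_termEq {Γ Δ : Ctx} {b B : Tm} {σ τ : ℕ → Tm} : Derivable Γ (term b B) →
      Derivable Δ ctx →
      (∀ n A, Γ[n]? = some A → Derivable Δ (termEq (σ n) (τ n) ((A.wk (n + 1)).subst σ))) →
      Derivable Δ (termEq (b.subst σ) (b.subst τ) (B.subst σ))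
  /- Judgemental equality is an equivalence relation, and typing respects it. -/
  | typeEq_refl {Γ A} : Derivable Γ (type A) → Derivable Γ (typeEq A A)
  | typeEq_symm {Γ A B} : Derivable Γ (typeEq A B) → Derivable Γ (typeEq B A)
  | typeEq_trans {Γ A B C} : Derivable Γ (typeEq A B) → Derivable Γ (typeEq B C) →
      Derivable Γ (typeEq A C)
  | termEq_refl {Γ a A} : Derivable Γ (term a A) → Derivable Γ (termEq a a A)
  | termEq_symm {Γ a b A} : Derivable Γ (termEq a b A) → Derivable Γ (termEq b a A)
  | termEq_trans {Γ a b c A} : Derivable Γ (termEq a b A) → Derivable Γ (termEq b c A) →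
      Derivable Γ (termEq a c A)
  | conv {Γ a A B} : Derivable Γ (term a A) → Derivable Γ (typeEq A B) → Derivable Γ (term a B)
  | conv_eq {Γ a b A B} : Derivable Γ (termEq a b A) → Derivable Γ (typeEq A B) →
      Derivable Γ (termEq a b B)
  /- The universe `U`, à la Russell, closed under `Π`, `Σ` and `Id`. -/
  | univ {Γ} : Derivable Γ ctx → Derivable Γ (type univ)
  | el {Γ A} : Derivable Γ (term A univ) → Derivable Γ (type A)
  | el_eq {Γ A B} : Derivable Γ (termEq A B univ) → Derivable Γ (typeEq A B)
  | pi_univ {Γ A B} : Derivable Γ (term A univ) → Derivable (A :: Γ) (term B univ) →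
      Derivable Γ (term (pi A B) univ)
  | pi_univ_eq {Γ A A' B B'} : Derivable Γ (termEq A A' univ) →
      Derivable (A :: Γ) (termEq B B' univ) → Derivable Γ (termEq (pi A B) (pi A' B') univ)
  | sigma_univ {Γ A B} : Derivable Γ (term A univ) → Derivable (A :: Γ) (term B univ) →
      Derivable Γ (term (sigma A B) univ)
  | sigma_univ_eq {Γ A A' B B'} : Derivable Γ (termEq A A' univ) →
      Derivable (A :: Γ) (termEq B B' univ) → Derivable Γ (termEq (sigma A B) (sigma A' B') univ)
  | id_univ {Γ A a b} : Derivable Γ (term A univ) → Derivable Γ (term a A) →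
      Derivable Γ (term b A) → Derivable Γ (term (id A a b) univ)
  | id_univ_eq {Γ A A' a a' b b'} : Derivable Γ (termEq A A' univ) →
      Derivable Γ (termEq a a' A) → Derivable Γ (termEq b b' A) →
      Derivable Γ (termEq (id A a b) (id A' a' b') univ)
  /- `Π`-types, with judgemental `β` and `η`. -/
  | pi {Γ A B} : Derivable Γ (type A) → Derivable (A :: Γ) (type B) → Derivable Γ (type (pi A B))
  | pi_eq {Γ A A' B B'} : Derivable Γ (typeEq A A') → Derivable (A :: Γ) (typeEq B B') →
      Derivable Γ (typeEq (pi A B) (pi A' B'))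
  | lam {Γ A b B} : Derivable Γ (type A) → Derivable (A :: Γ) (term b B) →
      Derivable Γ (term (lam A b) (pi A B))
  | lam_eq {Γ A A' b b' B} : Derivable Γ (typeEq A A') → Derivable (A :: Γ) (termEq b b' B) →
      Derivable Γ (termEq (lam A b) (lam A' b') (pi A B))
  | app {Γ A B f a} : Derivable Γ (term f (pi A B)) → Derivable Γ (term a A) →
      Derivable Γ (term (app f a) (B.inst a))
  | app_eq {Γ A B f f' a a'} : Derivable Γ (termEq f f' (pi A B)) → Derivable Γ (termEq a a' A) →
      Derivable Γ (termEq (app f a) (app f' a') (B.inst a))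
  | pi_beta {Γ A b B a} : Derivable (A :: Γ) (term b B) → Derivable Γ (term a A) →
      Derivable Γ (termEq (app (lam A b) a) (b.inst a) (B.inst a))
  | pi_eta {Γ A B f} : Derivable Γ (term f (pi A B)) →
      Derivable Γ (termEq f (lam A (app (f.wk 1) (var 0))) (pi A B))
  /- `Σ`-types, with the dependent eliminator `split` and no judgemental `η`. -/
  | sigma {Γ A B} : Derivable Γ (type A) → Derivable (A :: Γ) (type B) →
      Derivable Γ (type (sigma A B))
  | sigma_eq {Γ A A' B B'} : Derivable Γ (typeEq A A') → Derivable (A :: Γ) (typeEq B B') →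
      Derivable Γ (typeEq (sigma A B) (sigma A' B'))
  | pair {Γ A B a b} : Derivable (A :: Γ) (type B) → Derivable Γ (term a A) →
      Derivable Γ (term b (B.inst a)) → Derivable Γ (term (pair B a b) (sigma A B))
  | pair_eq {Γ A B B' a a' b b'} : Derivable (A :: Γ) (typeEq B B') →
      Derivable Γ (termEq a a' A) → Derivable Γ (termEq b b' (B.inst a)) →
      Derivable Γ (termEq (pair B a b) (pair B' a' b') (sigma A B))
  | split {Γ A B E e c} : Derivable (sigma A B :: Γ) (type E) →
      Derivable (B :: A :: Γ) (term e (E.atPair B)) → Derivable Γ (term c (sigma A B)) →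
      Derivable Γ (term (split E e c) (E.inst c))
  | split_eq {Γ A B E E' e e' c c'} : Derivable (sigma A B :: Γ) (typeEq E E') →
      Derivable (B :: A :: Γ) (termEq e e' (E.atPair B)) →
      Derivable Γ (termEq c c' (sigma A B)) →
      Derivable Γ (termEq (split E e c) (split E' e' c') (E.inst c))
  | sigma_beta {Γ A B E e a b} : Derivable (sigma A B :: Γ) (type E) →
      Derivable (B :: A :: Γ) (term e (E.atPair B)) → Derivable Γ (term a A) →
      Derivable Γ (term b (B.inst a)) →
      Derivable Γ (termEq (split E e (pair B a b)) (e.inst₂ a b) (E.inst (pair B a b)))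
  /- Identity types. -/
  | id {Γ A a b} : Derivable Γ (type A) → Derivable Γ (term a A) → Derivable Γ (term b A) →
      Derivable Γ (type (id A a b))
  | id_eq {Γ A A' a a' b b'} : Derivable Γ (typeEq A A') → Derivable Γ (termEq a a' A) →
      Derivable Γ (termEq b b' A) → Derivable Γ (typeEq (id A a b) (id A' a' b'))
  | refl {Γ A a} : Derivable Γ (term a A) → Derivable Γ (term (refl a) (id A a a))
  | refl_eq {Γ A a a'} : Derivable Γ (termEq a a' A) →
      Derivable Γ (termEq (refl a) (refl a') (id A a a))
  | J {Γ A E e a b p} :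
      Derivable (id (A.wk 2) (var 1) (var 0) :: A.wk 1 :: A :: Γ) (type E) →
      Derivable (A :: Γ) (term e E.atRefl) →
      Derivable Γ (term a A) → Derivable Γ (term b A) → Derivable Γ (term p (id A a b)) →
      Derivable Γ (term (J E e a b p) (E.inst₃ a b p))
  | J_eq {Γ A E E' e e' a a' b b' p p'} :
      Derivable (id (A.wk 2) (var 1) (var 0) :: A.wk 1 :: A :: Γ) (typeEq E E') →
      Derivable (A :: Γ) (termEq e e' E.atRefl) →
      Derivable Γ (termEq a a' A) → Derivable Γ (termEq b b' A) →
      Derivable Γ (termEq p p' (id A a b)) →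
      Derivable Γ (termEq (J E e a b p) (J E' e' a' b' p') (E.inst₃ a b p))
  | id_beta {Γ A E e a} :
      Derivable (id (A.wk 2) (var 1) (var 0) :: A.wk 1 :: A :: Γ) (type E) →
      Derivable (A :: Γ) (term e E.atRefl) → Derivable Γ (term a A) →
      Derivable Γ (termEq (J E e a a (refl a)) (e.inst a) (E.inst₃ a a (refl a)))
  /- Function extensionality. -/
  | funext {Γ A B f g α} : Derivable Γ (term f (pi A B)) → Derivable Γ (term g (pi A B)) →
      Derivable (A :: Γ) (term α (id B (app (f.wk 1) (var 0)) (app (g.wk 1) (var 0)))) →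
      Derivable Γ (term (funext f g α) (id (pi A B) f g))
  | funext_eq {Γ A B f f' g g' α α'} : Derivable Γ (termEq f f' (pi A B)) →
      Derivable Γ (termEq g g' (pi A B)) →
      Derivable (A :: Γ) (termEq α α' (id B (app (f.wk 1) (var 0)) (app (g.wk 1) (var 0)))) →
      Derivable Γ (termEq (funext f g α) (funext f' g' α') (id (pi A B) f g))

/-- In the context `Γ` the type `A` is inhabited. -/
def IsInhabited (Γ : Ctx) (A : Tm) : Prop := ∃ t : Tm, Derivable Γ (term t A)

/-! From here on: types and terms of `H`. All arguments are expressions over one and the same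
context, unless the comment says otherwise. -/

/-- `X → Y`. -/
def arrow (X Y : Tm) : Tm := pi X (Y.wk 1)

/-- `X × Y`. -/
def prod (X Y : Tm) : Tm := sigma X (Y.wk 1)

/-- `1_X : X → X`. -/
def idFun (X : Tm) : Tm := lam X (var 0)

/-- `g ∘ f`, where `X` is the domain of `f`. -/
def comp (X g f : Tm) : Tm := lam X (app (g.wk 1) (app (f.wk 1) (var 0)))

/-- `π₁(c) : A` for `c : (Σ x : A) B(x)`. -/
def fst (A c : Tm) : Tm := split (A.wk 1) (var 1) c

/-- `π₂(c) : B(π₁(c))` for `c : (Σ x : A) B(x)`. -/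
def snd (A B c : Tm) : Tm :=
  split (B.subst (scons (fst (A.wk 1) (var 0)) (fun n => var (n + 1)))) (var 0) c

/-- `iscontr(X) = (Σ x : X) (Π y : X) Id(x, y)`. -/
def isContr (X : Tm) : Tm := sigma X (pi (X.wk 1) (id (X.wk 2) (var 1) (var 0)))

/-- `hfiber(f, y) = (Σ x : X) Id(f x, y)` for `f : X → Y` and `y : Y`. -/
def hfiber (X Y f y : Tm) : Tm := sigma X (id (Y.wk 1) (app (f.wk 1) (var 0)) (y.wk 1))

/-- `isequiv(f) = (Π y : Y) iscontr(hfiber(f, y))` for `f : X → Y`. -/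
def isEquiv (X Y f : Tm) : Tm :=
  pi Y (isContr (hfiber (X.wk 1) (Y.wk 1) (f.wk 1) (var 0)))

/-- `Equiv(X, Y) = (Σ f : X → Y) isequiv(f)`. -/
def equiv (X Y : Tm) : Tm := sigma (arrow X Y) (isEquiv (X.wk 1) (Y.wk 1) (var 0))

/-- The element `(x, q)` of `hfiber(1_X, y)`, for `q : Id(x, y)`. -/
def fiberPt (X x y q : Tm) : Tm :=
  pair (id (X.wk 1) (app (idFun (X.wk 1)) (var 0)) (y.wk 1)) x q

/-- The proof of `isequiv(1_X)`: the fiber over `y` has the centre `(y, refl(y))`, and a path from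
`(y, refl(y))` to `(x, q)` is found by `Id`-elimination on `q`. -/
def idIsEquiv (X : Tm) : Tm :=
  lam X
    (pair
      (pi (hfiber (X.wk 2) (X.wk 2) (idFun (X.wk 2)) (var 1))
        (id (hfiber (X.wk 3) (X.wk 3) (idFun (X.wk 3)) (var 2)) (var 1) (var 0)))
      (fiberPt (X.wk 1) (var 0) (var 0) (refl (var 0)))
      (lam (hfiber (X.wk 1) (X.wk 1) (idFun (X.wk 1)) (var 0))
        (split
          (id (hfiber (X.wk 3) (X.wk 3) (idFun (X.wk 3)) (var 2))
            (fiberPt (X.wk 3) (var 2) (var 2) (refl (var 2))) (var 0))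
          (J
            (id (hfiber (X.wk 7) (X.wk 7) (idFun (X.wk 7)) (var 1))
              (fiberPt (X.wk 7) (var 1) (var 1) (refl (var 1)))
              (fiberPt (X.wk 7) (var 2) (var 1) (var 0)))
            (refl (fiberPt (X.wk 5) (var 0) (var 0) (refl (var 0))))
            (var 1) (var 3) (var 0))
          (var 0))))

/-- The extension function `Id_U(X, Y) → Equiv(X, Y)` of the universe, defined by `Id`-elimination
and sending `refl(X)` to the identity equivalence. -/
def extU (X Y : Tm) : Tm :=
  lam (id univ X Y)
    (J (equiv (var 2) (var 1))
      (pair (isEquiv (var 1) (var 1) (var 0)) (idFun (var 0)) (idIsEquiv (var 0)))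
      (X.wk 1) (Y.wk 1) (var 0))

/-- The univalence axiom, a closed type: for all `X, Y : U` the extension function
`Id_U(X, Y) → Equiv(X, Y)` is an equivalence. -/
def univalence : Tm :=
  pi univ (pi univ
    (isEquiv (id univ (var 1) (var 0)) (equiv (var 1) (var 0)) (extU (var 1) (var 0))))

/-- `p⁻¹ : Id(b, a)` for `p : Id_X(a, b)`. -/
def pathInv (X a b p : Tm) : Tm := J (id (X.wk 3) (var 1) (var 2)) (refl (var 0)) a b p

/-- `q · p : Id(a, c)` for `p : Id_X(a, b)` and `q : Id_X(b, c)`. -/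
def pathComp (X a b c q p : Tm) : Tm :=
  app
    (J (arrow (id (X.wk 3) (var 1) (c.wk 3)) (id (X.wk 3) (var 2) (c.wk 3)))
      (lam (id (X.wk 1) (var 0) (c.wk 1)) (var 0)) a b p)
    q

/-- `g ∘ p : Id(g ∘ u, g ∘ v)` for `g : Y → Z`, `u, v : X → Y` and `p : Id(u, v)`. -/
def whiskerL (X Z g u v p : Tm) : Tm :=
  J (id (arrow (X.wk 3) (Z.wk 3)) (comp (X.wk 3) (g.wk 3) (var 2)) (comp (X.wk 3) (g.wk 3) (var 1)))
    (refl (comp (X.wk 1) (g.wk 1) (var 0))) u v p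

/-- `p ∘ f : Id(u ∘ f, v ∘ f)` for `f : X → Y`, `u, v : Y → Z` and `p : Id(u, v)`. -/
def whiskerR (X Z f u v p : Tm) : Tm :=
  J (id (arrow (X.wk 3) (Z.wk 3)) (comp (X.wk 3) (var 2) (f.wk 3)) (comp (X.wk 3) (var 1) (f.wk 3)))
    (refl (comp (X.wk 1) (var 0) (f.wk 1))) u v p

/-- The path `∫ α : Id(f, g)` of a homotopy `α_x : Id(f x, g x)`, where `f, g : X → Y` and `α` is an
expression in the context extended by `x : X`. The composition with `funext(f, f, refl)⁻¹` is the
usual normalization: it makes `∫` send the constant homotopy to `refl(f)` up to a path, and so makes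
`∫` inverse to the extension function `Id(f, g) → (Π x : X) Id(f x, g x)`. -/
def integral (X Y f g α : Tm) : Tm :=
  pathComp (arrow X Y) f f g (funext f g α)
    (pathInv (arrow X Y) f f (funext f f (refl (app (f.wk 1) (var 0)))))

/-! In the following `A : U` and `B : A → U`. -/

/-- The family `B(x) → X`, in the context extended by `x : A`. -/
def polyFam (B X : Tm) : Tm := arrow (app (B.wk 1) (var 0)) (X.wk 1)

/-- `P X = (Σ x : A) (B(x) → X)`. -/
def poly (A B X : Tm) : Tm := sigma A (polyFam B X)

/-- `P f : P X → P Y` for `f : X → Y`, defined by `Σ`-elimination: `(x, u) ↦ (x, f ∘ u)`. -/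
def polyMap (A B X Y f : Tm) : Tm :=
  lam (poly A B X)
    (split (poly (A.wk 2) (B.wk 2) (Y.wk 2))
      (pair (polyFam (B.wk 3) (Y.wk 3)) (var 1) (comp (app (B.wk 3) (var 1)) (f.wk 3) (var 0)))
      (var 0))

/-- The path `φ : Id(P(g ∘ f), P g ∘ P f)` for `f : X → Y` and `g : Y → Z`, given by reflexivity at
canonical pairs. -/
def polyPhi (A B X Y Z f g : Tm) : Tm :=
  integral (poly A B X) (poly A B Z)
    (polyMap A B X Z (comp X g f))
    (comp (poly A B X) (polyMap A B Y Z g) (polyMap A B X Y f))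
    (split
      (id (poly (A.wk 2) (B.wk 2) (Z.wk 2))
        (app ((polyMap A B X Z (comp X g f)).wk 2) (var 0))
        (app ((comp (poly A B X) (polyMap A B Y Z g) (polyMap A B X Y f)).wk 2) (var 0)))
      (refl (pair (polyFam (B.wk 3) (Z.wk 3)) (var 1)
        (comp (app (B.wk 3) (var 1)) ((comp X g f).wk 3) (var 0))))
      (var 0))

/-- The family `P X → X`, in the context extended by `X : U`. -/
def strFam (A B : Tm) : Tm := arrow (poly (A.wk 1) (B.wk 1) (var 0)) (var 0)

/-- `Alg = (Σ X : U) (P X → X)`. -/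
def alg (A B : Tm) : Tm := sigma univ (strFam A B)

/-- The carrier of an algebra. -/
def carrier (C : Tm) : Tm := fst univ C

/-- The structure map `sup_C : P C → C` of an algebra `C`. -/
def str (A B C : Tm) : Tm := snd univ (strFam A B) C

/-- `isalghom(f) = Id(f ∘ sup_C, sup_D ∘ P f)` for a function `f : C → D` of carriers. -/
def isAlgHom (A B C D f : Tm) : Tm :=
  id (arrow (poly A B (carrier C)) (carrier D))
    (comp (poly A B (carrier C)) f (str A B C))
    (comp (poly A B (carrier C)) (str A B D) (polyMap A B (carrier C) (carrier D) f))

/-- The family `isalghom(f)`, in the context extended by `f : C → D`. -/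
def algHomFam (A B C D : Tm) : Tm := isAlgHom (A.wk 1) (B.wk 1) (C.wk 1) (D.wk 1) (var 0)

/-- `Alg(C, D) = (Σ f : C → D) isalghom(f)`. -/
def algHom (A B C D : Tm) : Tm := sigma (arrow (carrier C) (carrier D)) (algHomFam A B C D)

/-- The function underlying an algebra morphism from `C` to `D`. -/
def homFun (C D f : Tm) : Tm := fst (arrow (carrier C) (carrier D)) f

/-- The path that is part of an algebra morphism from `C` to `D`. -/
def homPath (A B C D f : Tm) : Tm :=
  snd (arrow (carrier C) (carrier D)) (algHomFam A B C D) f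

/-- The path `Id(1_C ∘ sup_C, sup_C ∘ P(1_C))`, given by reflexivity at canonical pairs. -/
def algIdPath (A B C : Tm) : Tm :=
  integral (poly A B (carrier C)) (carrier C)
    (comp (poly A B (carrier C)) (idFun (carrier C)) (str A B C))
    (comp (poly A B (carrier C)) (str A B C)
      (polyMap A B (carrier C) (carrier C) (idFun (carrier C))))
    (split
      (id ((carrier C).wk 2)
        (app ((comp (poly A B (carrier C)) (idFun (carrier C)) (str A B C)).wk 2) (var 0))
        (app ((comp (poly A B (carrier C)) (str A B C)
          (polyMap A B (carrier C) (carrier C) (idFun (carrier C)))).wk 2) (var 0)))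
      (refl (app ((str A B C).wk 3)
        (pair (polyFam (B.wk 3) ((carrier C).wk 3)) (var 1) (var 0))))
      (var 0))

/-- The identity morphism of the algebra `C`. -/
def algId (A B C : Tm) : Tm :=
  pair (algHomFam A B C C) (idFun (carrier C)) (algIdPath A B C)

/-- For `f : Alg(C, D)` and `g : Alg(D, E)`, the composite of the paths
`g ∘ f ∘ sup_C ⟶ g ∘ sup_D ∘ P f ⟶ sup_E ∘ P g ∘ P f ⟶ sup_E ∘ P(g ∘ f)`. -/
def algCompPath (A B C D E g f : Tm) : Tm :=
  let PC := poly A B (carrier C)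
  let PD := poly A B (carrier D)
  let PE := poly A B (carrier E)
  let f₀ := homFun C D f
  let g₀ := homFun D E g
  let Pf := polyMap A B (carrier C) (carrier D) f₀
  let Pg := polyMap A B (carrier D) (carrier E) g₀
  let gf := comp (carrier C) g₀ f₀
  let Pgf := polyMap A B (carrier C) (carrier E) gf
  let s₀ := comp PC g₀ (comp PC f₀ (str A B C))
  let s₁ := comp PC g₀ (comp PC (str A B D) Pf)
  let s₂ := comp PC (str A B E) (comp PC Pg Pf)
  let s₃ := comp PC (str A B E) Pgf
  let p₁ := whiskerL PC (carrier E) g₀ (comp PC f₀ (str A B C)) (comp PC (str A B D) Pf)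
    (homPath A B C D f)
  let p₂ := whiskerR PC (carrier E) Pf (comp PD g₀ (str A B D)) (comp PD (str A B E) Pg)
    (homPath A B D E g)
  let p₃ := whiskerL PC (carrier E) (str A B E) (comp PC Pg Pf) Pgf
    (pathInv (arrow PC PE) Pgf (comp PC Pg Pf)
      (polyPhi A B (carrier C) (carrier D) (carrier E) f₀ g₀))
  pathComp (arrow PC (carrier E)) s₀ s₂ s₃ p₃
    (pathComp (arrow PC (carrier E)) s₀ s₁ s₂ p₂ p₁)

/-- The composite `g f : Alg(C, E)` of `f : Alg(C, D)` and `g : Alg(D, E)`. -/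
def algComp (A B C D E g f : Tm) : Tm :=
  pair (algHomFam A B C E) (comp (carrier C) (homFun D E g) (homFun C D f))
    (algCompPath A B C D E g f)

/-- For `f : Alg(C, D)`,
`isalgequiv(f) = (Σ g : Alg(D, C)) Id(g f, 1_C) × (Σ h : Alg(D, C)) Id(f h, 1_D)`. -/
def isAlgEquiv (A B C D f : Tm) : Tm :=
  prod
    (sigma (algHom A B D C)
      (id ((algHom A B C C).wk 1)
        (algComp (A.wk 1) (B.wk 1) (C.wk 1) (D.wk 1) (C.wk 1) (var 0) (f.wk 1))
        ((algId A B C).wk 1)))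
    (sigma (algHom A B D C)
      (id ((algHom A B D D).wk 1)
        (algComp (A.wk 1) (B.wk 1) (D.wk 1) (C.wk 1) (D.wk 1) (f.wk 1) (var 0))
        ((algId A B D).wk 1)))

/-- The family `isalgequiv(f)`, in the context extended by `f : Alg(C, D)`. -/
def algEquivFam (A B C D : Tm) : Tm :=
  isAlgEquiv (A.wk 1) (B.wk 1) (C.wk 1) (D.wk 1) (var 0)

/-- `AlgEquiv(C, D) = (Σ f : Alg(C, D)) isalgequiv(f)`. -/
def algEquiv (A B C D : Tm) : Tm := sigma (algHom A B C D) (algEquivFam A B C D)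

/-- The type `(Π C : Alg) isalgequiv(1_C)` of proofs that the identity morphisms are algebra
equivalences. -/
def idIsAlgEquiv (A B : Tm) : Tm :=
  pi (alg A B) (isAlgEquiv (A.wk 1) (B.wk 1) (var 0) (var 0) (algId (A.wk 1) (B.wk 1) (var 0)))

/-- The canonical function `Id_Alg(C, D) → AlgEquiv(C, D)`, defined by `Id`-elimination and sending
`refl(C)` to the identity equivalence `(1_C, ι(C))`, where `ι` is a proof that the identity morphisms
are algebra equivalences. -/
def extAlg (A B ι C D : Tm) : Tm :=
  lam (id (alg A B) C D)
    (J (algEquiv (A.wk 4) (B.wk 4) (var 2) (var 1))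
      (pair (algEquivFam (A.wk 2) (B.wk 2) (var 0) (var 0)) (algId (A.wk 2) (B.wk 2) (var 0))
        (app (ι.wk 2) (var 0)))
      (C.wk 1) (D.wk 1) (var 0))

/-- The closed type `(Π A : U) (Π B : A → U) (Π C : Alg) isalgequiv(1_C)`. -/
def idEquivType : Tm :=
  pi univ (pi (arrow (var 0) univ) (idIsAlgEquiv (var 1) (var 0)))

/-- The closed type
`(Π A : U) (Π B : A → U) (Π ι : (Π C : Alg) isalgequiv(1_C)) (Π C : Alg) (Π D : Alg) isequiv(ext)`,
where `ext : Id_Alg(C, D) → AlgEquiv(C, D)` is the canonical function. -/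
def algUnivalence : Tm :=
  pi univ (pi (arrow (var 0) univ)
    (pi (idIsAlgEquiv (var 1) (var 0))
      (pi (alg (var 2) (var 1))
        (pi (alg (var 3) (var 2))
          (isEquiv
            (id (alg (var 4) (var 3)) (var 1) (var 0))
            (algEquiv (var 4) (var 3) (var 1) (var 0))
            (extAlg (var 4) (var 3) (var 2) (var 1) (var 0)))))))

end TTH

/-!
The theorem says that certain closed types of `H` have inhabitants. The inhabitants are terms of
considerable size, so they are written with defined constants, and that they have the right types is
found by a type checker for `H` that is proved correct and evaluated in the kernel.

**The argument inside `H`.** The unit laws `f ∘ 1_C = f` and `1_C ∘ f = f` for algebra morphisms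
(`unitREntry`, `unitLEntry`) hold because the paths in the composites come from homotopies that are
constant at canonical pairs; by induction on homotopies (`htpyIndEntry`, a consequence of function
extensionality) all of these may be taken to be constant. So `1_C` is its own left and right inverse,
and identity morphisms are equivalences (`idAlgEquivEntry`). Moreover, left inverses and right
inverses of `1_C` are fibers of functions that are homotopic to the identity, so `isalgequiv(1_C)` is
a proposition (`idAlgEquivPropEntry`).

Assume univalence. The map `ext` from paths to equivalences of algebras is shown to be surjective in
the strong sense that every algebra equivalence `r` has a chosen preimage (`algPreimageEntry`). The
function underlying `r` has a left and a right inverse, hence is an equivalence (`algEquivFunEntry`),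
hence comes from a path between the carriers, and by `Id`-elimination it may be taken to be an
identity function (`equivPreimagesEntry`). The structure maps `t` for which the identity of `X` is a
morphism from `s` to `t`, paired with a proof of this, form a contractible type (`idHomContrEntry`), so
`r` may be taken to be `1_C` with some proof of `isalgequiv(1_C)`, which is equal to `ι(C)`; hence
`refl(C)` is a preimage (`idPreimageEntry`). The preimages give a right inverse `s` of `ext`, and
`r ↦ s(r) · s(ext(refl))⁻¹` is a left inverse, by `Id`-elimination (`extAlgEquivEntry`). A function
with a left and a right inverse is an equivalence (`biinvEquivVal`).

**The type checker.** Expressions `Ex` are terms of `H` with an additional form for constants, each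
of which has a list of parameters, a type and a value. An expression stands for the term `Ex.toTm` in
which all constants are replaced by their values. The checker infers types and compares terms by
reduction, `η`-expansion and unfolding of constants. Since judgemental equality in `H` is typed, each
reduction step also checks the redex. The recursion is bounded by a number, and no claim is made about
completeness or termination; what is proved is soundness (`checker_sound`): what the checker accepts
is derivable in `H`. It rests on the substitution calculus of raw terms and on derived rules of `H`,
among them generation lemmas such as `Derivable.of_pi`. By induction along a list of constants, if
each constant passes the test relative to the ones before it, then the value of each constant is a
term of `H` of the declared type (`sigOf_valid`). The tests are evaluated by the kernel
(`entryOk_table`), as is the fact that replacing the constants by their values in the types of two of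
them gives the types of the theorem (`toTm_idEquivType`, `toTm_univalence`, `toTm_algUnivalence`).
-/

namespace TTH

open Tm Jdg

/-! ### The substitution calculus of raw terms -/

namespace Tm

theorem upr_comp (ρ τ : ℕ → ℕ) : upr ρ ∘ upr τ = upr (ρ ∘ τ) := by
  funext n; cases n <;> rfl

theorem rename_rename (t : Tm) : ∀ ρ τ : ℕ → ℕ, (t.rename τ).rename ρ = t.rename (ρ ∘ τ) := by
  induction t <;> intro ρ τ <;> simp_all [rename, upr_comp]

theorem up_upr (σ : ℕ → Tm) (τ : ℕ → ℕ) : up σ ∘ upr τ = up (σ ∘ τ) := by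
  funext n; cases n <;> rfl

theorem subst_rename (t : Tm) :
    ∀ (σ : ℕ → Tm) (τ : ℕ → ℕ), (t.rename τ).subst σ = t.subst (σ ∘ τ) := by
  induction t <;> intro σ τ <;> simp_all [rename, subst, up_upr]

theorem rename_wk (t : Tm) (ρ : ℕ → ℕ) : (t.wk 1).rename (upr ρ) = (t.rename ρ).wk 1 := by
  simp only [wk, rename_rename]; rfl

theorem rename_up (σ : ℕ → Tm) (ρ : ℕ → ℕ) :
    (fun n => (up σ n).rename (upr ρ)) = up (fun n => (σ n).rename ρ) := by
  funext n; cases n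
  · rfl
  · exact rename_wk _ _

theorem rename_subst (t : Tm) :
    ∀ (ρ : ℕ → ℕ) (σ : ℕ → Tm), (t.subst σ).rename ρ = t.subst (fun n => (σ n).rename ρ) := by
  induction t <;> intro ρ σ <;> simp_all [rename, subst, rename_up]

theorem subst_wk_up (t : Tm) (σ : ℕ → Tm) : (t.wk 1).subst (up σ) = (t.subst σ).wk 1 := by
  simp only [wk, subst_rename, rename_subst]; rfl

theorem subst_up (σ τ : ℕ → Tm) :
    (fun n => (up σ n).subst (up τ)) = up (fun n => (σ n).subst τ) := by
  funext n; cases n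
  · rfl
  · exact subst_wk_up _ _

theorem subst_subst (t : Tm) :
    ∀ σ τ : ℕ → Tm, (t.subst σ).subst τ = t.subst (fun n => (σ n).subst τ) := by
  induction t <;> intro σ τ <;> simp_all [subst, subst_up]

theorem up_var : up var = var := by
  funext n; cases n <;> rfl

theorem subst_var (t : Tm) : t.subst var = t := by
  induction t <;> simp_all [subst, up_var]

theorem rename_eq_subst (t : Tm) (ρ : ℕ → ℕ) : t.rename ρ = t.subst (fun n => var (ρ n)) := by
  have := subst_rename t var ρ
  rw [subst_var] at this
  exact this

theorem wk_eq_subst (t : Tm) (k : ℕ) : t.wk k = t.subst (fun n => var (n + k)) :=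
  rename_eq_subst t _

theorem subst_wk (t : Tm) (k : ℕ) (σ : ℕ → Tm) : (t.wk k).subst σ = t.subst (fun n => σ (n + k)) :=
  subst_rename t σ _

theorem wk_zero (t : Tm) : t.wk 0 = t := by
  rw [wk_eq_subst]; exact subst_var t

theorem wk_wk (t : Tm) (j k : ℕ) : (t.wk j).wk k = t.wk (j + k) := by
  simp only [wk, rename_rename]
  congr 1; funext n; simp; omega

theorem inst_rename_upr_var (B : Tm) : (B.rename (upr (fun n => n + 1))).inst (var 0) = B := by
  rw [inst, subst_rename]
  refine Eq.trans ?_ (subst_var B)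
  congr 1; funext n; cases n <;> rfl

end Tm

/-! ### Admissible rules and generation -/

/-- `σ` is a substitution from the context `Γ` to the context `Δ`: it sends each variable of `Γ` to
a term of `Δ` of the right type. -/
def IsSubst (Γ Δ : Ctx) (σ : ℕ → Tm) : Prop :=
  ∀ n A, Γ[n]? = some A → Derivable Δ (term (σ n) ((A.wk (n + 1)).subst σ))

theorem Derivable.type_subst {Γ Δ A σ} (h : Derivable Γ (type A)) (hΔ : Derivable Δ ctx)
    (hσ : IsSubst Γ Δ σ) : Derivable Δ (type (A.subst σ)) :=
  Derivable.subst h hΔ hσ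

theorem Derivable.typeEq_subst {Γ Δ A B σ} (h : Derivable Γ (typeEq A B)) (hΔ : Derivable Δ ctx)
    (hσ : IsSubst Γ Δ σ) : Derivable Δ (typeEq (A.subst σ) (B.subst σ)) :=
  Derivable.subst h hΔ hσ

theorem Derivable.term_subst {Γ Δ a A σ} (h : Derivable Γ (term a A)) (hΔ : Derivable Δ ctx)
    (hσ : IsSubst Γ Δ σ) : Derivable Δ (term (a.subst σ) (A.subst σ)) :=
  Derivable.subst h hΔ hσ

theorem IsSubst.shift {Γ Δ : Ctx} (hΔ : Derivable (Δ ++ Γ) ctx) :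
    IsSubst Γ (Δ ++ Γ) (fun n => var (n + Δ.length)) := by
  intro n A h
  have := Derivable.var (n := n + Δ.length) (A := A) hΔ
    (by rw [List.getElem?_append_right (by omega)]; simpa using h)
  rwa [← wk_eq_subst, wk_wk, show n + 1 + Δ.length = n + Δ.length + 1 by omega]

theorem IsSubst.cons {Γ Δ A a σ} (hσ : IsSubst Γ Δ σ) (ha : Derivable Δ (term a (A.subst σ))) :
    IsSubst (A :: Γ) Δ (scons a σ) := by
  intro n B h
  cases n with
  | zero =>
    obtain rfl : A = B := by simpa using h
    rw [subst_wk]; exact ha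
  | succ n =>
    rw [subst_wk]
    have := hσ n B (by simpa using h)
    rwa [subst_wk] at this

theorem IsSubst.nil {Δ σ} : IsSubst [] Δ σ := by
  intro n A h; simp at h

theorem IsSubst.refl {Γ : Ctx} (hΓ : Derivable Γ ctx) : IsSubst Γ Γ var := by
  intro n A h
  rw [subst_var]; exact Derivable.var hΓ h

/-- Weakening by one variable. -/
theorem Derivable.weaken_type {Γ A B} (h : Derivable Γ (type A)) (hB : Derivable Γ (type B)) :
    Derivable (B :: Γ) (type (A.wk 1)) := by
  have := h.type_subst (.cons hB) (IsSubst.shift (Δ := [B]) (.cons hB))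
  rwa [wk_eq_subst]

theorem Derivable.weaken_term {Γ a A B} (h : Derivable Γ (term a A)) (hB : Derivable Γ (type B)) :
    Derivable (B :: Γ) (term (a.wk 1) (A.wk 1)) := by
  have := h.term_subst (.cons hB) (IsSubst.shift (Δ := [B]) (.cons hB))
  rwa [wk_eq_subst, wk_eq_subst]

theorem Derivable.var_zero {Γ A} (hA : Derivable Γ (type A)) :
    Derivable (A :: Γ) (term (.var 0) (A.wk 1)) :=
  .var (.cons hA) rfl

theorem IsSubst.up {Γ Δ A σ} (hσ : IsSubst Γ Δ σ) (hA : Derivable Δ (type (A.subst σ))) :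
    IsSubst (A :: Γ) (A.subst σ :: Δ) (up σ) := by
  intro n B h
  cases n with
  | zero =>
    obtain rfl : A = B := by simpa using h
    have := Derivable.var_zero hA
    rw [subst_wk]
    rw [wk_eq_subst, subst_subst] at this
    change Derivable _ (term (.var 0) (A.subst fun n => (σ n).wk 1))
    simpa only [wk_eq_subst] using this
  | succ n =>
    have := (hσ n B (by simpa using h)).weaken_term hA
    rw [subst_wk] at this ⊢
    rw [wk_eq_subst (B.subst _), subst_subst] at this
    change Derivable _ (term ((σ n).wk 1) (B.subst fun m => (σ (m + (n + 1))).wk 1))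
    simpa only [wk_eq_subst] using this

/-- The substitution of a single term for the last variable. -/
theorem IsSubst.inst {Γ A a} (hΓ : Derivable Γ ctx) (ha : Derivable Γ (term a A)) :
    IsSubst (A :: Γ) Γ (scons a .var) :=
  (IsSubst.refl hΓ).cons (by rwa [subst_var])

theorem Derivable.type_inst {Γ A B a} (hΓ : Derivable Γ ctx) (hB : Derivable (A :: Γ) (type B))
    (ha : Derivable Γ (term a A)) : Derivable Γ (type (B.inst a)) :=
  hB.type_subst hΓ (.inst hΓ ha)

theorem Derivable.term_inst {Γ A B a b} (hΓ : Derivable Γ ctx) (hb : Derivable (A :: Γ) (term b B))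
    (ha : Derivable Γ (term a A)) : Derivable Γ (term (b.inst a) (B.inst a)) :=
  hb.term_subst hΓ (.inst hΓ ha)

/-- Equal terms may be substituted in a type. -/
theorem Derivable.typeEq_inst {Γ A B a a'} (hΓ : Derivable Γ ctx) (hB : Derivable (A :: Γ) (type B))
    (ha : Derivable Γ (termEq a a' A)) : Derivable Γ (typeEq (B.inst a) (B.inst a')) := by
  refine .subst_typeEq hB hΓ fun n C h => ?_
  cases n with
  | zero =>
    obtain rfl : A = C := by simpa using h
    rw [subst_wk]; exact (subst_var A).symm ▸ ha
  | succ n =>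
    rw [subst_wk]
    exact .termEq_refl ((subst_wk C (n + 1) .var ▸ IsSubst.refl hΓ n C (by simpa using h)))

theorem IsSubst.conv_head {Γ A A'} (hA : Derivable Γ (type A))
    (h : Derivable Γ (typeEq A A')) : IsSubst (A' :: Γ) (A :: Γ) .var := by
  intro n B hB
  rw [subst_var]
  cases n with
  | zero =>
    obtain rfl : A' = B := by simpa using hB
    have h' := h.typeEq_subst (.cons hA) (IsSubst.shift (Δ := [A]) (.cons hA))
    simp only [List.length_singleton, ← wk_eq_subst] at h'
    exact .conv (.var_zero hA) h'
  | succ n => exact .var (.cons hA) (by simpa using hB)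

/-- Replacing the last type of a context by an equal one. -/
theorem Derivable.ctx_conv_type {Γ A A' B} (hB : Derivable (A' :: Γ) (type B))
    (hA : Derivable Γ (type A)) (h : Derivable Γ (typeEq A A')) : Derivable (A :: Γ) (type B) :=
  subst_var B ▸ hB.type_subst (.cons hA) (.conv_head hA h)

theorem Derivable.type_of_mem_aux {Γ J} (h : Derivable Γ J) :
    J = ctx → ∀ A Γ', Γ = A :: Γ' → Derivable Γ' (type A) := by
  induction h with
  | cons h => rintro - _ _ ⟨⟩; exact h
  | @subst _ _ J _ _ _ _ _ ih => intro h; exact ih rfl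
  | _ => intro _ _ _ _; contradiction

theorem Derivable.type_of_cons {Γ A} (h : Derivable (A :: Γ) ctx) : Derivable Γ (type A) :=
  h.type_of_mem_aux rfl _ _ rfl

theorem Derivable.ctx_of {Γ J} (h : Derivable Γ J) : Derivable Γ ctx := by
  induction h with
  | nil => exact .nil
  | cons h => exact .cons h
  | _ => assumption

/-- What the derivability of a type, or of a term of some type, says about its immediate
subexpressions. Only the forms that the checker inspects are recorded; the clause for variables is
what makes the statement stable under substitution. -/
def Gen (Γ : Ctx) : Tm → Prop
  | .var n => n < Γ.length
  | .pi A B => Derivable Γ (type A) ∧ Derivable (A :: Γ) (type B)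
  | .sigma A B => Derivable Γ (type A) ∧ Derivable (A :: Γ) (type B)
  | .id A a b => Derivable Γ (type A) ∧ Derivable Γ (term a A) ∧ Derivable Γ (term b A)
  | _ => True

/-- The subject of a judgement satisfies `Gen`. -/
def GenJdg (Γ : Ctx) : Jdg → Prop
  | .type A => Gen Γ A
  | .term a _ => Gen Γ a
  | _ => True

theorem Gen.subst {Γ Δ : Ctx} {σ : ℕ → Tm} {t : Tm} (h : Gen Γ t) (hΔ : Derivable Δ ctx)
    (hσ : IsSubst Γ Δ σ) (ih : ∀ n A, Γ[n]? = some A → Gen Δ (σ n)) : Gen Δ (t.subst σ) := by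
  cases t with
  | var n => exact ih n _ (List.getElem?_eq_getElem h)
  | pi A B =>
    have hA := h.1.type_subst hΔ hσ
    exact ⟨hA, h.2.type_subst (.cons hA) (hσ.up hA)⟩
  | sigma A B =>
    have hA := h.1.type_subst hΔ hσ
    exact ⟨hA, h.2.type_subst (.cons hA) (hσ.up hA)⟩
  | id A a b =>
    exact ⟨h.1.type_subst hΔ hσ, h.2.1.term_subst hΔ hσ, h.2.2.term_subst hΔ hσ⟩
  | _ => trivial

theorem Derivable.gen {Γ J} (h : Derivable Γ J) : GenJdg Γ J := by
  induction h with
  | var _ h => exact (List.getElem?_eq_some_iff.1 h).1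
  | @subst Γ Δ J σ _ hΔ hσ ih _ ihσ =>
    cases J with
    | type A => exact Gen.subst ih hΔ hσ ihσ
    | term a A => exact Gen.subst ih hΔ hσ ihσ
    | _ => trivial
  | conv _ _ ih _ => exact ih
  | el _ ih => exact ih
  | pi_univ hA hB => exact ⟨.el hA, .el hB⟩
  | sigma_univ hA hB => exact ⟨.el hA, .el hB⟩
  | id_univ hA ha hb => exact ⟨.el hA, ha, hb⟩
  | pi hA hB => exact ⟨hA, hB⟩
  | sigma hA hB => exact ⟨hA, hB⟩
  | id hA ha hb => exact ⟨hA, ha, hb⟩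
  | _ => trivial

theorem Derivable.of_pi {Γ A B} (h : Derivable Γ (type (.pi A B))) :
    Derivable Γ (type A) ∧ Derivable (A :: Γ) (type B) := h.gen

theorem Derivable.of_sigma {Γ A B} (h : Derivable Γ (type (.sigma A B))) :
    Derivable Γ (type A) ∧ Derivable (A :: Γ) (type B) := h.gen

theorem Derivable.of_id {Γ A a b} (h : Derivable Γ (type (.id A a b))) :
    Derivable Γ (type A) ∧ Derivable Γ (term a A) ∧ Derivable Γ (term b A) := h.gen

/-! ### Contexts and types of the eliminators -/

/-- The type of the branch of `split`. -/
theorem Derivable.type_atPair {Γ A B E} (hA : Derivable Γ (type A))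
    (hB : Derivable (A :: Γ) (type B)) (hE : Derivable (.sigma A B :: Γ) (type E)) :
    Derivable (B :: A :: Γ) (type (E.atPair B)) := by
  have hc : Derivable (B :: A :: Γ) ctx := .cons hB
  have hs : IsSubst Γ (B :: A :: Γ) (fun n => .var (n + 2)) := IsSubst.shift (Δ := [B, A]) hc
  refine hE.type_subst hc (hs.cons ?_)
  have hA' := hA.type_subst hc hs
  have hB' := hB.type_subst (.cons hA') (hs.up hA')
  have e : B.rename (upr fun n => n + 2) = B.subst (Tm.up fun n => .var (n + 2)) := by
    rw [rename_eq_subst]; congr 1; funext n; cases n <;> rfl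
  rw [e]
  refine .pair hB' ?_ ?_
  · rw [← wk_eq_subst]
    exact .var hc rfl
  · have := Derivable.var (n := 0) hc rfl
    rw [inst, subst_subst]
    rw [wk_eq_subst] at this
    convert this using 3
    funext n
    cases n <;> rfl

/-- The context of the motive of `J`. -/
theorem Derivable.ctx_J {Γ A} (hA : Derivable Γ (type A)) :
    Derivable (.id (A.wk 2) (.var 1) (.var 0) :: A.wk 1 :: A :: Γ) ctx := by
  have h1 := hA.weaken_type hA
  have h2 := h1.weaken_type h1
  refine .cons (.id ?_ ?_ ?_)
  · rwa [wk_wk] at h2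
  · exact .var (n := 1) (.cons h1) rfl
  · have := Derivable.var_zero h1
    rwa [wk_wk] at this

theorem IsSubst.J {Γ Δ A a b p σ} (hσ : IsSubst Γ Δ σ) (ha : Derivable Δ (term a (A.subst σ)))
    (hb : Derivable Δ (term b (A.subst σ))) (hp : Derivable Δ (term p (.id (A.subst σ) a b))) :
    IsSubst (.id (A.wk 2) (.var 1) (.var 0) :: A.wk 1 :: A :: Γ) Δ
      (scons p (scons b (scons a σ))) := by
  refine ((hσ.cons ha).cons ?_).cons ?_
  · rw [subst_wk]; exact hb
  · simp only [Tm.subst, subst_wk]; exact hp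

/-- The type of the branch of `J`. -/
theorem Derivable.type_atRefl {Γ A E} (hA : Derivable Γ (type A))
    (hE : Derivable (.id (A.wk 2) (.var 1) (.var 0) :: A.wk 1 :: A :: Γ) (type E)) :
    Derivable (A :: Γ) (type E.atRefl) := by
  have hc : Derivable (A :: Γ) ctx := .cons hA
  have hv := Derivable.var_zero hA
  rw [wk_eq_subst] at hv
  exact hE.type_subst hc ((IsSubst.shift (Δ := [A]) hc).J hv hv (.refl hv))

theorem Derivable.type_inst₃ {Γ A E a b p} (hΓ : Derivable Γ ctx)
    (hE : Derivable (.id (A.wk 2) (.var 1) (.var 0) :: A.wk 1 :: A :: Γ) (type E))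
    (ha : Derivable Γ (term a A)) (hb : Derivable Γ (term b A))
    (hp : Derivable Γ (term p (.id A a b))) : Derivable Γ (type (E.inst₃ a b p)) := by
  refine hE.type_subst hΓ ((IsSubst.refl hΓ).J ?_ ?_ ?_) <;> rwa [subst_var]

/-- Equal endpoints and equal paths may be substituted in a motive of `J`. -/
theorem Derivable.typeEq_inst₃ {Γ A E a a' b b' p p'} (hΓ : Derivable Γ ctx)
    (hE : Derivable (.id (A.wk 2) (.var 1) (.var 0) :: A.wk 1 :: A :: Γ) (type E))
    (ha : Derivable Γ (termEq a a' A)) (hb : Derivable Γ (termEq b b' A))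
    (hp : Derivable Γ (termEq p p' (.id A a b))) :
    Derivable Γ (typeEq (E.inst₃ a b p) (E.inst₃ a' b' p')) := by
  refine .subst_typeEq hE hΓ fun n C h => ?_
  match n with
  | 0 =>
    obtain rfl : _ = C := by simpa using h
    simp only [Tm.subst, subst_wk]
    simpa only [scons, subst_var, Nat.reduceAdd] using hp
  | 1 =>
    obtain rfl : _ = C := by simpa using h
    simp only [subst_wk]
    simpa only [scons, subst_var, Nat.reduceAdd] using hb
  | 2 =>
    obtain rfl : _ = C := by simpa using h
    simp only [subst_wk]
    simpa only [scons, subst_var, Nat.reduceAdd] using ha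
  | n + 3 =>
    rw [subst_wk]
    exact .termEq_refl (subst_wk C (n + 1) .var ▸ IsSubst.refl hΓ n C (by simpa using h))

/-- The type of pointwise paths between `f` and `g`. -/
theorem Derivable.type_homotopy {Γ A B f g} (hA : Derivable Γ (type A))
    (hB : Derivable (A :: Γ) (type B)) (hf : Derivable Γ (term f (.pi A B)))
    (hg : Derivable Γ (term g (.pi A B))) :
    Derivable (A :: Γ) (type (.id B (.app (f.wk 1) (.var 0)) (.app (g.wk 1) (.var 0)))) := by
  have h : ∀ {f}, Derivable Γ (term f (.pi A B)) →
      Derivable (A :: Γ) (term (.app (f.wk 1) (.var 0)) B) := fun hf => by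
    have := Derivable.app (hf.weaken_term hA) (.var_zero hA)
    rwa [inst_rename_upr_var] at this
  exact .id hB (h hf) (h hg)

noncomputable section

/-! ### Expressions with defined constants -/

mutual
/-- Expressions of `H` with an additional form `cst c s`, the constant number `c` applied to the
list `s` of arguments. A constant stands for a term of `H` in a context of parameters. -/
inductive Ex : Type
  | var (n : ℕ)
  | univ
  | pi (A B : Ex)
  | lam (A b : Ex)
  | app (f a : Ex)
  | sigma (A B : Ex)
  | pair (B a b : Ex)
  | split (E e c : Ex)
  | id (A a b : Ex)
  | refl (a : Ex)
  | J (E e a b p : Ex)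
  | funext (f g α : Ex)
  | cst (c : ℕ) (s : Sp)

/-- Lists of arguments; the last argument is outermost. -/
inductive Sp : Type
  | nil
  | snoc (s : Sp) (a : Ex)
end

/-- Replaces each variable `n` that occurs under `d` binders by `v d n`; the expression itself is
placed under `d` binders. The recursor is used directly, since this function is evaluated often. -/
def Ex.map (v : ℕ → ℕ → Ex) (e : Ex) : ℕ → Ex :=
  Ex.rec (motive_1 := fun _ => ℕ → Ex) (motive_2 := fun _ => ℕ → Sp)
    (fun n d => v d n)
    (fun _ => .univ)
    (fun _ _ A B d => .pi (A d) (B (d + 1)))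
    (fun _ _ A b d => .lam (A d) (b (d + 1)))
    (fun _ _ f a d => .app (f d) (a d))
    (fun _ _ A B d => .sigma (A d) (B (d + 1)))
    (fun _ _ _ B a b d => .pair (B (d + 1)) (a d) (b d))
    (fun _ _ _ E e c d => .split (E (d + 1)) (e (d + 2)) (c d))
    (fun _ _ _ A a b d => .id (A d) (a d) (b d))
    (fun _ a d => .refl (a d))
    (fun _ _ _ _ _ E e a b p d => .J (E (d + 3)) (e (d + 1)) (a d) (b d) (p d))
    (fun _ _ _ f g α d => .funext (f d) (g d) (α (d + 1)))
    (fun c _ s d => .cst c (s d))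
    (fun _ => .nil)
    (fun _ _ s a d => .snoc (s d) (a d)) e

/-- Weakening by `k` variables, leaving the first `c` variables fixed. -/
def Ex.shift (k c : ℕ) (e : Ex) : Ex :=
  e.map (fun d n => .var (bif Nat.blt n d then n else n + k)) c

/-- Substitution under `d` binders: the first `d` variables are fixed. -/
def Ex.sub (σ : ℕ → Ex) (d : ℕ) (e : Ex) : Ex :=
  e.map (fun d n => bif Nat.blt n d then .var n else (σ (n - d)).shift d 0) d

/-- Syntactic equality. -/
def Ex.beq (e : Ex) : Ex → Bool :=
  Ex.rec (motive_1 := fun _ => Ex → Bool) (motive_2 := fun _ => Sp → Bool)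
    (fun n e => match e with | .var n' => Nat.beq n n' | _ => false)
    (fun e => match e with | .univ => true | _ => false)
    (fun _ _ A B e => match e with | .pi A' B' => A A' && B B' | _ => false)
    (fun _ _ A b e => match e with | .lam A' b' => A A' && b b' | _ => false)
    (fun _ _ f a e => match e with | .app f' a' => f f' && a a' | _ => false)
    (fun _ _ A B e => match e with | .sigma A' B' => A A' && B B' | _ => false)
    (fun _ _ _ B a b e => match e with | .pair B' a' b' => a a' && b b' && B B' | _ => false)
    (fun _ _ _ E e c e' => match e' with | .split E' e' c' => c c' && E E' && e e' | _ => false)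
    (fun _ _ _ A a b e => match e with | .id A' a' b' => a a' && b b' && A A' | _ => false)
    (fun _ a e => match e with | .refl a' => a a' | _ => false)
    (fun _ _ _ _ _ E e a b p e' => match e' with
      | .J E' e' a' b' p' => p p' && a a' && b b' && E E' && e e'
      | _ => false)
    (fun _ _ _ f g α e => match e with | .funext f' g' α' => f f' && g g' && α α' | _ => false)
    (fun c _ s e => match e with | .cst c' s' => Nat.beq c c' && s s' | _ => false)
    (fun s => match s with | .nil => true | _ => false)
    (fun _ _ s a s' => match s' with | .snoc s' a' => s s' && a a' | _ => false) e

/-- The substitution sending variable `0` to `a` and variable `n + 1` to `σ n`. -/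
def Ex.scons (a : Ex) (σ : ℕ → Ex) : ℕ → Ex
  | 0 => a
  | n + 1 => σ n

/-- The arguments as a substitution for the parameters; the other variables are sent to the closed
term `U`, so that the substitution commutes with any other one. -/
def Sp.toSub : Sp → ℕ → Ex
  | .nil => fun _ => .univ
  | .snoc s a => Ex.scons a s.toSub

/-- `B(a)`. -/
def Ex.inst (B a : Ex) : Ex := B.sub (scons a .var) 0

/-- `e(a, b)`, with `a` for the outer variable. -/
def Ex.inst₂ (e a b : Ex) : Ex := e.sub (scons b (scons a .var)) 0

/-- `E(a, b, p)`, with `a` for the outermost variable. -/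
def Ex.inst₃ (E a b p : Ex) : Ex := E.sub (scons p (scons b (scons a .var))) 0

/-- The type of the branch of `split`. -/
def Ex.atPair (E B : Ex) : Ex :=
  E.sub (scons (.pair (B.shift 2 1) (.var 1) (.var 0)) (fun n => .var (n + 2))) 0

/-- The type of the branch of `J`. -/
def Ex.atRefl (E : Ex) : Ex :=
  E.sub (scons (.refl (.var 0)) (scons (.var 0) (scons (.var 0) (fun n => .var (n + 1))))) 0

mutual
/-- The term of `H` that an expression stands for, where the constant `c` stands for `β c`. -/
def Ex.toTm (β : ℕ → Tm) : Ex → Tm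
  | .var n => .var n
  | .univ => .univ
  | .pi A B => .pi (A.toTm β) (B.toTm β)
  | .lam A b => .lam (A.toTm β) (b.toTm β)
  | .app f a => .app (f.toTm β) (a.toTm β)
  | .sigma A B => .sigma (A.toTm β) (B.toTm β)
  | .pair B a b => .pair (B.toTm β) (a.toTm β) (b.toTm β)
  | .split E e c => .split (E.toTm β) (e.toTm β) (c.toTm β)
  | .id A a b => .id (A.toTm β) (a.toTm β) (b.toTm β)
  | .refl a => .refl (a.toTm β)
  | .J E e a b p => .J (E.toTm β) (e.toTm β) (a.toTm β) (b.toTm β) (p.toTm β)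
  | .funext f g α => .funext (f.toTm β) (g.toTm β) (α.toTm β)
  | .cst c s => (β c).subst (s.toTm β)

/-- The substitution for the parameters that a list of arguments stands for. -/
def Sp.toTm (β : ℕ → Tm) : Sp → ℕ → Tm
  | .nil => fun _ => .univ
  | .snoc s a => scons (a.toTm β) (s.toTm β)
end

section
variable (β : ℕ → Tm)

/-- The arguments of a constant. -/
def Ex.args : Ex → Sp
  | .cst _ s => s
  | _ => .nil

/-- Lifting of a substitution under `d` binders. -/
def ups (τ : ℕ → Tm) : ℕ → ℕ → Tm
  | 0 => τ
  | d + 1 => up (ups τ d)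

theorem ups_apply (τ : ℕ → Tm) : ∀ d n : ℕ,
    ups τ d n = if n < d then .var n else (τ (n - d)).wk d
  | 0, n => by simp [ups, Tm.wk_zero]
  | d + 1, 0 => rfl
  | d + 1, n + 1 => by
    change (ups τ d n).wk 1 = _
    rw [ups_apply τ d n, Nat.add_sub_add_right]
    by_cases h : n < d
    · rw [if_pos h, if_pos (Nat.succ_lt_succ h)]; rfl
    · rw [if_neg h, if_neg (by omega), Tm.wk_wk]

theorem Ex.toTm_map {v : ℕ → ℕ → Ex} {τ : ℕ → Tm} (h : ∀ d n, (v d n).toTm β = ups τ d n) (e : Ex) :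
    ∀ d, (e.map v d).toTm β = (e.toTm β).subst (ups τ d) :=
  Ex.rec (motive_1 := fun e => ∀ d, (e.map v d).toTm β = (e.toTm β).subst (ups τ d))
    (motive_2 := fun s => ∀ d, ((Ex.cst 0 s).map v d).args.toTm β =
      fun n => (s.toTm β n).subst (ups τ d))
    (fun n d => h d n)
    (fun _ => rfl)
    (fun _ _ A B d => congrArg₂ Tm.pi (A d) (B (d + 1)))
    (fun _ _ A b d => congrArg₂ Tm.lam (A d) (b (d + 1)))
    (fun _ _ f a d => congrArg₂ Tm.app (f d) (a d))
    (fun _ _ A B d => congrArg₂ Tm.sigma (A d) (B (d + 1)))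
    (fun _ _ _ B a b d => congr (congrArg₂ Tm.pair (B (d + 1)) (a d)) (b d))
    (fun _ _ _ E e c d => congr (congrArg₂ Tm.split (E (d + 1)) (e (d + 2))) (c d))
    (fun _ _ _ A a b d => congr (congrArg₂ Tm.id (A d) (a d)) (b d))
    (fun _ a d => congrArg Tm.refl (a d))
    (fun _ _ _ _ _ E e a b p d =>
      congr (congr (congr (congrArg₂ Tm.J (E (d + 3)) (e (d + 1))) (a d)) (b d)) (p d))
    (fun _ _ _ f g α d => congr (congrArg₂ Tm.funext (f d) (g d)) (α (d + 1)))
    (fun c _ hs d => (congrArg (fun σ => (β c).subst σ) (hs d)).trans (subst_subst _ _ _).symm)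
    (fun _ => rfl)
    (fun _ _ hs ha d => _root_.funext fun n => match n with
      | 0 => ha d
      | n + 1 => congrFun (hs d) n) e

theorem Ex.toTm_shift (k : ℕ) (e : Ex) (c : ℕ) :
    (e.shift k c).toTm β = (e.toTm β).subst (ups (fun n => .var (n + k)) c) := by
  refine Ex.toTm_map β (fun d n => ?_) e c
  rw [ups_apply, Ex.toTm]
  by_cases h : n < d
  · have : Nat.blt n d = true := by simpa [Nat.blt_eq] using h
    simp [this, h]
  · have : Nat.blt n d = false := by
      rw [Bool.eq_false_iff, ne_eq, Nat.blt_eq]; exact h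
    simp only [this, h, cond_false, if_false, Tm.wk, rename, Tm.var.injEq]; omega

theorem Ex.toTm_wk (k : ℕ) (e : Ex) : (e.shift k 0).toTm β = (e.toTm β).wk k := by
  rw [toTm_shift, Tm.wk, rename_eq_subst]; rfl

theorem Ex.toTm_sub (σ : ℕ → Ex) (e : Ex) :
    (e.sub σ 0).toTm β = (e.toTm β).subst (fun n => (σ n).toTm β) := by
  refine Ex.toTm_map β (fun d n => ?_) e 0
  rw [ups_apply]
  by_cases h : n < d
  · have : Nat.blt n d = true := by simpa [Nat.blt_eq] using h
    simp [this, h, Ex.toTm]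
  · have : Nat.blt n d = false := by
      rw [Bool.eq_false_iff, ne_eq, Nat.blt_eq]; exact h
    simp only [this, h, cond_false, if_false, Ex.toTm_wk]

theorem Ex.toTm_scons (a : Ex) (σ : ℕ → Ex) :
    (fun n => (scons a σ n).toTm β) = Tm.scons (a.toTm β) (fun n => (σ n).toTm β) := by
  funext n; cases n <;> rfl

theorem Sp.toTm_toSub (s : Sp) : (fun n => (s.toSub n).toTm β) = s.toTm β := by
  induction s using Sp.rec (motive_1 := fun _ => True) with
  | nil => rfl
  | snoc s a ih => rw [Sp.toSub, Ex.toTm_scons, ih]; rfl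
  | _ => trivial

theorem Ex.toTm_inst (B a : Ex) : (B.inst a).toTm β = (B.toTm β).inst (a.toTm β) := by
  rw [Ex.inst, toTm_sub, toTm_scons]; rfl

theorem Ex.toTm_inst₂ (e a b : Ex) :
    (e.inst₂ a b).toTm β = (e.toTm β).inst₂ (a.toTm β) (b.toTm β) := by
  rw [Ex.inst₂, toTm_sub, toTm_scons, toTm_scons]; rfl

theorem Ex.toTm_inst₃ (E a b p : Ex) :
    (E.inst₃ a b p).toTm β = (E.toTm β).inst₃ (a.toTm β) (b.toTm β) (p.toTm β) := by
  rw [Ex.inst₃, toTm_sub, toTm_scons, toTm_scons, toTm_scons]; rfl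

theorem Ex.toTm_atPair (E B : Ex) : (E.atPair B).toTm β = (E.toTm β).atPair (B.toTm β) := by
  have h : ups (fun n => .var (n + 2)) 1 = fun n => .var (upr (fun n => n + 2) n) := by
    funext n; cases n <;> rfl
  rw [Ex.atPair, toTm_sub, toTm_scons, Ex.toTm, toTm_shift, h, Tm.atPair, rename_eq_subst]; rfl

theorem Ex.toTm_atRefl (E : Ex) : E.atRefl.toTm β = (E.toTm β).atRefl := by
  rw [Ex.atRefl, toTm_sub, toTm_scons, toTm_scons, toTm_scons]; rfl

end

theorem Ex.eq_of_beq {e e' : Ex} (h : e.beq e' = true) : e = e' := by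
  refine Ex.rec (motive_1 := fun e => ∀ e', e.beq e' = true → e = e')
    (motive_2 := fun s => ∀ s', (Ex.cst 0 s).beq (Ex.cst 0 s') = true → s = s')
    ?_ ?_ ?_ ?_ ?_ ?_ ?_ ?_ ?_ ?_ ?_ ?_ ?_ ?_ ?_ e e' h
  · rintro n (_ | _) h <;> first | exact absurd h Bool.false_ne_true | skip
    exact congrArg _ (Nat.eq_of_beq_eq_true h)
  · rintro (_ | _) h <;> first | exact absurd h Bool.false_ne_true | rfl
  iterate 4
    · rintro A B hA hB (_ | _) h <;> first | exact absurd h Bool.false_ne_true | skip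
      rename_i A' B'
      have h : (A.beq A' && B.beq B') = true := h
      rw [Bool.and_eq_true] at h
      rw [hA _ h.1, hB _ h.2]
  · rintro B a b hB ha hb (_ | _) h <;> first | exact absurd h Bool.false_ne_true | skip
    rename_i B' a' b'
    have h : (a.beq a' && b.beq b' && B.beq B') = true := h
    simp only [Bool.and_eq_true] at h
    rw [ha _ h.1.1, hb _ h.1.2, hB _ h.2]
  · rintro E e c hE he hc (_ | _) h <;> first | exact absurd h Bool.false_ne_true | skip
    rename_i E' e' c'
    have h : (c.beq c' && E.beq E' && e.beq e') = true := h
    simp only [Bool.and_eq_true] at h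
    rw [hc _ h.1.1, hE _ h.1.2, he _ h.2]
  · rintro A a b hA ha hb (_ | _) h <;> first | exact absurd h Bool.false_ne_true | skip
    rename_i A' a' b'
    have h : (a.beq a' && b.beq b' && A.beq A') = true := h
    simp only [Bool.and_eq_true] at h
    rw [ha _ h.1.1, hb _ h.1.2, hA _ h.2]
  · rintro a ha (_ | _) h <;> first | exact absurd h Bool.false_ne_true | skip
    exact congrArg _ (ha _ h)
  · rintro E e a b p hE he ha hb hp (_ | _) h <;>
      first | exact absurd h Bool.false_ne_true | skip
    rename_i E' e' a' b' p'
    have h : (p.beq p' && a.beq a' && b.beq b' && E.beq E' && e.beq e') = true := h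
    simp only [Bool.and_eq_true] at h
    rw [hp _ h.1.1.1.1, ha _ h.1.1.1.2, hb _ h.1.1.2, hE _ h.1.2, he _ h.2]
  · rintro f g α hf hg hα (_ | _) h <;> first | exact absurd h Bool.false_ne_true | skip
    rename_i f' g' α'
    have h : (f.beq f' && g.beq g' && α.beq α') = true := h
    simp only [Bool.and_eq_true] at h
    rw [hf _ h.1.1, hg _ h.1.2, hα _ h.2]
  · rintro c s hs (_ | _) h <;> first | exact absurd h Bool.false_ne_true | skip
    rename_i c' s'
    have h : (Nat.beq c c' && (Ex.cst 0 s).beq (Ex.cst 0 s')) = true := h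
    rw [Bool.and_eq_true] at h
    rw [Nat.eq_of_beq_eq_true h.1, hs _ h.2]
  · rintro (_ | _) h
    · rfl
    · exact absurd h Bool.false_ne_true
  · rintro s a hs ha (_ | ⟨s', a'⟩) h
    · exact absurd h Bool.false_ne_true
    · have h : ((Ex.cst 0 s).beq (Ex.cst 0 s') && a.beq a') = true := h
      rw [Bool.and_eq_true] at h
      rw [hs _ h.1, ha _ h.2]

end

end TTH

namespace TTH

noncomputable section

/-! ### A type checker with conversion -/

/-- A constant: the types of its parameters (each over the previous ones), its type and its value
over the parameters, and whether it may be unfolded. -/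
structure Entry where
  tele : List Ex
  res : Ex
  val : Ex
  unfoldable : Bool

/-- A table of constants. -/
abbrev Sig := ℕ → Option Entry

/-- The mutually recursive functions of the checker: inference of a type; a head reduction step,
returning the reduct and the type; a test of the judgemental equality of two terms, returning the
type; a test of the equality of two types; a test for being a type; the weak head normal form of a
type. -/
structure Checker where
  infer : List Ex → Ex → Option Ex
  red : List Ex → Ex → Option (Ex × Ex)
  conv : List Ex → Ex → Ex → Option Ex
  convT : List Ex → Ex → Ex → Bool
  isTy : List Ex → Ex → Bool
  whnfT : List Ex → Ex → Ex

namespace Ex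

/-- Recognizes `Π`-types. -/
def asPi : Ex → Option (Ex × Ex)
  | pi A B => some (A, B)
  | _ => none

/-- Recognizes `Σ`-types. -/
def asSigma : Ex → Option (Ex × Ex)
  | sigma A B => some (A, B)
  | _ => none

/-- Unfolds a constant at the head. -/
def unfold (S : Sig) : Ex → Option Ex
  | cst c s => (S c).bind fun en => bif en.unfoldable then some (en.val.sub s.toSub 0) else none
  | _ => none

/-- The context of the motive of `J`, over the context `Γ`. -/
def ctxJ (Γ : List Ex) (A : Ex) : List Ex :=
  .id (A.shift 2 0) (var 1) (var 0) :: A.shift 1 0 :: A :: Γ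

/-- The type of paths between `f x` and `g x`, in the context extended by `x`. -/
def homotopy (B f g : Ex) : Ex :=
  .id B (app (f.shift 1 0) (var 0)) (app (g.shift 1 0) (var 0))

end Ex

/-- `some x` if `b` holds. -/
def guardO {α : Type} (b : Bool) (x : Option α) : Option α := bif b then x else none

namespace Checker

open Ex

variable (S : Sig) (F : Checker)

/-- Equality of two expressions that are known to be types. -/
def eqT (Γ : List Ex) (A B : Ex) : Bool := A.beq B || F.convT Γ A B

/-- Whether `a : A`, where `A` is known to be a type. -/
def check (Γ : List Ex) (a A : Ex) : Bool :=
  match F.infer Γ a with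
  | some A' => F.eqT Γ A' A
  | none => false

/-- Whether `a = b : A`, where `A` is known to be a type. -/
def eqAt (Γ : List Ex) (a b A : Ex) : Bool :=
  match F.conv Γ a b with
  | some A' => F.eqT Γ A' A
  | none => false

/-- Whether `A : U`. -/
def isU (Γ : List Ex) (A : Ex) : Bool := F.check Γ A univ

/-- The domain and the codomain of a type that is equal to a `Π`-type. -/
def toPi (Γ : List Ex) (A : Ex) : Option (Ex × Ex) := (F.whnfT Γ A).asPi

/-- The two components of a type that is equal to a `Σ`-type. -/
def toSigma (Γ : List Ex) (A : Ex) : Option (Ex × Ex) := (F.whnfT Γ A).asSigma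

/-- Checks arguments against the types of the parameters. Returns the arguments as a substitution,
and the parameters that are left. -/
def inferSp (Γ : List Ex) (tele : List Ex) : Sp → Option ((ℕ → Ex) × List Ex)
  | .nil => some (fun _ => univ, tele)
  | .snoc s a =>
    match inferSp Γ tele s with
    | some (σ, P :: Ps) => guardO (F.check Γ a (P.sub σ 0)) (some (scons a σ, Ps))
    | _ => none

/-- Compares two lists of arguments. -/
def convSp (Γ : List Ex) (tele : List Ex) : Sp → Sp → Option ((ℕ → Ex) × List Ex)
  | .nil, .nil => some (fun _ => univ, tele)
  | .snoc s a, .snoc s' a' =>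
    match convSp Γ tele s s' with
    | some (σ, P :: Ps) => guardO (F.eqAt Γ a a' (P.sub σ 0)) (some (scons a σ, Ps))
    | _ => none
  | _, _ => none

/-- The type of a constant, for a complete list of arguments. -/
def spRes (res : Ex) : (ℕ → Ex) × List Ex → Option Ex
  | (σ, []) => some (res.sub σ 0)
  | _ => none

/-- Inference of a type. -/
def inferStep (Γ : List Ex) : Ex → Option Ex
  | var n => (Γ[n]?).map fun A => A.shift (n + 1) 0
  | univ => none
  | pi A B => guardO (F.isU Γ A && F.isU (A :: Γ) B) (some univ)
  | sigma A B => guardO (F.isU Γ A && F.isU (A :: Γ) B) (some univ)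
  | .id A a b => guardO (F.isU Γ A && F.check Γ a A && F.check Γ b A) (some univ)
  | lam A b => guardO (F.isTy Γ A) ((F.infer (A :: Γ) b).map (pi A))
  | app f a => (F.infer Γ f).bind fun T => (F.toPi Γ T).bind fun (A, B) =>
      guardO (F.check Γ a A) (some (B.inst a))
  | pair B a b => (F.infer Γ a).bind fun A =>
      guardO (F.isTy (A :: Γ) B && F.check Γ b (B.inst a)) (some (sigma A B))
  | split E e c => (F.infer Γ c).bind fun T => (F.toSigma Γ T).bind fun (A, B) =>
      guardO (F.isTy (sigma A B :: Γ) E && F.check (B :: A :: Γ) e (E.atPair B))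
        (some (E.inst c))
  | .refl a => (F.infer Γ a).map fun A => .id A a a
  | J E e a b p => (F.infer Γ a).bind fun A =>
      guardO (F.check Γ b A && F.check Γ p (.id A a b) && F.isTy (ctxJ Γ A) E &&
        F.check (A :: Γ) e E.atRefl) (some (E.inst₃ a b p))
  | .funext f g α => (F.infer Γ f).bind fun T => (F.toPi Γ T).bind fun (A, B) =>
      guardO (F.check Γ g (pi A B) && F.check (A :: Γ) α (homotopy B f g))
        (some (.id (pi A B) f g))
  | cst c s => (S c).bind fun en => (F.inferSp Γ en.tele s).bind (spRes en.res)

/-- Test for being a type. -/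
def isTyStep (Γ : List Ex) : Ex → Bool
  | univ => true
  | pi A B => F.isTy Γ A && F.isTy (A :: Γ) B
  | sigma A B => F.isTy Γ A && F.isTy (A :: Γ) B
  | .id A a b => F.isTy Γ A && F.check Γ a A && F.check Γ b A
  | A => F.isU Γ A

/-- Reduction in the head `f` of `app f a`. -/
def redApp (Γ : List Ex) (f a : Ex) : Option (Ex × Ex) :=
  match f.unfold S with
  | some f' => F.red Γ (app f' a)
  | none => (F.red Γ f).bind fun (f', T) => (F.toPi Γ T).bind fun (A, B) =>
      guardO (F.check Γ a A) (some (app f' a, B.inst a))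

/-- Reduction in the argument `c` of `split E e c`. -/
def redSplit (Γ : List Ex) (E e c : Ex) : Option (Ex × Ex) :=
  match c.unfold S with
  | some c' => F.red Γ (split E e c')
  | none => (F.red Γ c).bind fun (c', T) => (F.toSigma Γ T).bind fun (A, B) =>
      guardO (F.isTy (sigma A B :: Γ) E && F.check (B :: A :: Γ) e (E.atPair B))
        (some (split E e c', E.inst c))

/-- Reduction in the argument `p` of `J E e a b p`. -/
def redJ (Γ : List Ex) (E e a b p : Ex) : Option (Ex × Ex) :=
  match p.unfold S with
  | some p' => F.red Γ (J E e a b p')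
  | none => (F.infer Γ a).bind fun A => guardO (F.check Γ b A) ((F.red Γ p).bind fun (p', T) =>
      guardO (F.eqT Γ T (.id A a b) && F.isTy (ctxJ Γ A) E && F.check (A :: Γ) e E.atRefl)
        (some (J E e a b p', E.inst₃ a b p)))

/-- A head reduction step. The type of the redex is inferred again, since the judgemental equality
of `H` is typed. -/
def redStep (Γ : List Ex) : Ex → Option (Ex × Ex)
  | app (lam A b) a => guardO (F.isTy Γ A && F.check Γ a A)
      ((F.infer (A :: Γ) b).map fun B => (b.inst a, B.inst a))
  | app f a => F.redApp S Γ f a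
  | split E e (pair B a b) => (F.infer Γ a).bind fun A =>
      guardO (F.isTy (A :: Γ) B && F.check Γ b (B.inst a) && F.isTy (sigma A B :: Γ) E &&
        F.check (B :: A :: Γ) e (E.atPair B)) (some (e.inst₂ a b, E.inst (pair B a b)))
  | split E e c => F.redSplit S Γ E e c
  | J E e a b (.refl c) => (F.infer Γ a).bind fun A =>
      guardO (F.eqAt Γ a b A && F.eqAt Γ a c A && F.check Γ b A && F.check Γ (.refl c) (.id A a b) &&
        F.isTy (ctxJ Γ A) E && F.check (A :: Γ) e E.atRefl) (some (e.inst a, E.inst₃ a b (.refl c)))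
  | J E e a b p => F.redJ S Γ E e a b p
  | _ => none

/-- Comparison of terms of the same form, part by part. -/
def convStruct (Γ : List Ex) : Ex → Ex → Option Ex
  | pi A B, pi A' B' => guardO (F.eqAt Γ A A' univ && F.eqAt (A :: Γ) B B' univ) (some univ)
  | sigma A B, sigma A' B' => guardO (F.eqAt Γ A A' univ && F.eqAt (A :: Γ) B B' univ) (some univ)
  | .id A a b, .id A' a' b' =>
      guardO (F.eqAt Γ A A' univ && F.eqAt Γ a a' A && F.eqAt Γ b b' A) (some univ)
  | lam A b, lam A' b' => guardO (F.isTy Γ A && F.isTy Γ A' && F.eqT Γ A A')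
      ((F.conv (A :: Γ) b b').map (pi A))
  | app f a, app f' a' => (F.conv Γ f f').bind fun T => (F.toPi Γ T).bind fun (A, B) =>
      guardO (F.eqAt Γ a a' A) (some (B.inst a))
  | pair B a b, pair B' a' b' => (F.conv Γ a a').bind fun A =>
      guardO (F.isTy (A :: Γ) B && F.isTy (A :: Γ) B' && F.eqT (A :: Γ) B B' &&
        F.eqAt Γ b b' (B.inst a)) (some (sigma A B))
  | split E e c, split E' e' c' => (F.conv Γ c c').bind fun T =>
      (F.toSigma Γ T).bind fun (A, B) =>
        guardO (F.isTy (sigma A B :: Γ) E && F.isTy (sigma A B :: Γ) E' &&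
          F.eqT (sigma A B :: Γ) E E' && F.eqAt (B :: A :: Γ) e e' (E.atPair B)) (some (E.inst c))
  | .refl a, .refl a' => (F.conv Γ a a').map fun A => .id A a a
  | J E e a b p, J E' e' a' b' p' => (F.conv Γ a a').bind fun A =>
      guardO (F.eqAt Γ b b' A && F.eqAt Γ p p' (.id A a b) && F.isTy (ctxJ Γ A) E &&
        F.isTy (ctxJ Γ A) E' && F.eqT (ctxJ Γ A) E E' && F.eqAt (A :: Γ) e e' E.atRefl)
        (some (E.inst₃ a b p))
  | .funext f g α, .funext f' g' α' => (F.conv Γ f f').bind fun T => (F.toPi Γ T).bind fun (A, B) =>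
      guardO (F.eqAt Γ g g' (pi A B) && F.eqAt (A :: Γ) α α' (homotopy B f g))
        (some (.id (pi A B) f g))
  | cst c s, cst c' s' => guardO (Nat.beq c c') ((S c).bind fun en =>
      (F.convSp Γ en.tele s s').bind (spRes en.res))
  | _, _ => none

/-- Comparison by the `η`-rule, when one of the terms is a `λ`-abstraction. -/
def convEta (Γ : List Ex) : Ex → Ex → Option Ex
  | lam _ _, lam _ _ => none
  | lam A b, f => (F.infer Γ f).bind fun T => (F.toPi Γ T).bind fun (A', B') =>
      (F.conv Γ (lam A b) (lam A' (app (f.shift 1 0) (var 0)))).bind fun T' =>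
        guardO (F.eqT Γ T' (pi A' B')) (some T')
  | f, lam A b => (F.infer Γ f).bind fun T => (F.toPi Γ T).bind fun (A', B') =>
      (F.conv Γ (lam A' (app (f.shift 1 0) (var 0))) (lam A b)).bind fun T' =>
        guardO (F.eqT Γ T' (pi A' B')) (some (pi A' B'))
  | _, _ => none

/-- Whether both expressions are constants and the second one is defined later. -/
def unfoldsLater : Ex → Ex → Bool
  | cst c _, cst c' _ => Nat.blt c c'
  | _, _ => false

/-- Comparison after unfolding a constant at the head of one of the two sides. Of two constants, the
one that is defined later is unfolded. -/
def convUnfold (Γ : List Ex) (a b : Ex) : Option Ex :=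
  match bif unfoldsLater a b then b.unfold S else none with
  | some b' => F.conv Γ a b'
  | none =>
    match a.unfold S with
    | some a' => F.conv Γ a' b
    | none =>
      match b.unfold S with
      | some b' => F.conv Γ a b'
      | none => F.convEta Γ a b

/-- Comparison after a step of reduction or of unfolding on one of the two sides. -/
def convRed (Γ : List Ex) (a b : Ex) : Option Ex :=
  match F.red Γ a with
  | some (a', T) => (F.conv Γ a' b).bind fun T' => guardO (F.eqT Γ T' T) (some T)
  | none =>
    match F.red Γ b with
    | some (b', T) => (F.conv Γ a b').bind fun T' => guardO (F.eqT Γ T T') (some T')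
    | none => F.convUnfold S Γ a b

/-- Comparison of terms. -/
def convStep (Γ : List Ex) (a b : Ex) : Option Ex :=
  bif a.beq b then F.infer Γ a else
    match F.convStruct S Γ a b with
    | some T => some T
    | none => F.convRed S Γ a b

/-- Comparison of types in weak head normal form. -/
def convTWhnf (Γ : List Ex) : Ex → Ex → Bool
  | univ, univ => true
  | pi A B, pi A' B' => F.eqT Γ A A' && F.eqT (A :: Γ) B B'
  | sigma A B, sigma A' B' => F.eqT Γ A A' && F.eqT (A :: Γ) B B'
  | .id A a b, .id A' a' b' => F.eqT Γ A A' && F.eqAt Γ a a' A && F.eqAt Γ b b' A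
  | A, B => F.eqAt Γ A B univ

/-- Whether two expressions are applications of the same constant. -/
def sameHead : Ex → Ex → Bool
  | cst c _, cst c' _ => Nat.beq c c'
  | _, _ => false

/-- Comparison of types. -/
def convTStep (Γ : List Ex) (A B : Ex) : Bool :=
  (sameHead A B && F.eqAt Γ A B univ) || F.convTWhnf Γ (F.whnfT Γ A) (F.whnfT Γ B)

/-- The weak head normal form of a type. -/
def whnfTStep (Γ : List Ex) : Ex → Ex
  | univ => univ
  | pi A B => pi A B
  | sigma A B => sigma A B
  | .id A a b => .id A a b
  | A =>
    match A.unfold S with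
    | some A' => F.whnfT Γ A'
    | none =>
      match F.red Γ A with
      | some (A', T) => bif F.eqT Γ T univ then F.whnfT Γ A' else A
      | none => A

end Checker

/-- The checker with recursion depth at most `n`. -/
def checker (S : Sig) : ℕ → Checker
  | 0 => ⟨fun _ _ => none, fun _ _ => none, fun _ _ _ => none, fun _ _ _ => false,
      fun _ _ => false, fun _ A => A⟩
  | n + 1 =>
    ⟨(checker S n).inferStep S, (checker S n).redStep S, (checker S n).convStep S,
      (checker S n).convTStep, (checker S n).isTyStep, (checker S n).whnfTStep S⟩

end

end TTH

namespace TTH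

open Jdg

/-! ### Soundness of the checker -/

section
variable (β : ℕ → Tm)

/-- The context of `H` that a list of expressions stands for. -/
abbrev ctxTm (Γ : List Ex) : Ctx := Γ.map (Ex.toTm β)

/-- `Γ ⊢ A : type`, for expressions with constants. -/
abbrev ETy (Γ : List Ex) (A : Ex) : Prop := Derivable (ctxTm β Γ) (type (A.toTm β))

/-- `Γ ⊢ A = B : type`, for expressions with constants. -/
abbrev ETyEq (Γ : List Ex) (A B : Ex) : Prop :=
  Derivable (ctxTm β Γ) (typeEq (A.toTm β) (B.toTm β))

/-- `Γ ⊢ a : A`, for expressions with constants. -/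
abbrev ETerm (Γ : List Ex) (a A : Ex) : Prop :=
  Derivable (ctxTm β Γ) (term (a.toTm β) (A.toTm β))

/-- `Γ ⊢ a = b : A`, for expressions with constants. -/
abbrev ETermEq (Γ : List Ex) (a b A : Ex) : Prop :=
  Derivable (ctxTm β Γ) (termEq (a.toTm β) (b.toTm β) (A.toTm β))

/-- The constants of the table have the values `β` and the types that the table declares. -/
def Sig.Valid (S : Sig) : Prop := ∀ c en, S c = some en →
  ETy β en.tele.reverse en.res ∧
  Derivable (ctxTm β en.tele.reverse) (term (β c) (en.res.toTm β)) ∧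
  β c = en.val.toTm β

/-- The functions of the checker return only what is derivable. -/
structure Checker.Sound (F : Checker) : Prop where
  infer : ∀ {Γ e T}, Derivable (ctxTm β Γ) ctx → F.infer Γ e = some T → ETerm β Γ e T ∧ ETy β Γ T
  red : ∀ {Γ e e' T}, Derivable (ctxTm β Γ) ctx → F.red Γ e = some (e', T) →
    ETermEq β Γ e e' T ∧ ETerm β Γ e T ∧ ETerm β Γ e' T ∧ ETy β Γ T
  conv : ∀ {Γ a b T}, Derivable (ctxTm β Γ) ctx → F.conv Γ a b = some T →
    ETermEq β Γ a b T ∧ ETerm β Γ a T ∧ ETy β Γ T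
  convT : ∀ {Γ A B}, ETy β Γ A → ETy β Γ B → F.convT Γ A B = true → ETyEq β Γ A B
  isTy : ∀ {Γ A}, Derivable (ctxTm β Γ) ctx → F.isTy Γ A = true → ETy β Γ A
  whnfT : ∀ {Γ A}, ETy β Γ A → ETyEq β Γ A (F.whnfT Γ A) ∧ ETy β Γ (F.whnfT Γ A)

end

theorem guardO_eq_some {α : Type} {b : Bool} {x : Option α} {y : α} :
    guardO b x = some y ↔ b = true ∧ x = some y := by
  cases b <;> simp [guardO]

theorem Ex.asPi_eq {A : Ex} {p : Ex × Ex} (h : A.asPi = some p) : A = .pi p.1 p.2 := by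
  cases A <;> simp only [asPi, Option.some.injEq, reduceCtorEq] at h
  subst h; rfl

theorem Ex.asSigma_eq {A : Ex} {p : Ex × Ex} (h : A.asSigma = some p) : A = .sigma p.1 p.2 := by
  cases A <;> simp only [asSigma, Option.some.injEq, reduceCtorEq] at h
  subst h; rfl

variable {β : ℕ → Tm} {S : Sig} {F : Checker}

/-- Unfolding does not change the term that is stood for. -/
theorem Ex.toTm_unfold (hS : S.Valid β) {e e' : Ex} (h : e.unfold S = some e') :
    e'.toTm β = e.toTm β := by
  cases e with
  | cst c s =>
    simp only [unfold, Option.bind_eq_some_iff] at h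
    obtain ⟨en, hen, h⟩ := h
    cases hu : en.unfoldable
    · simp [hu] at h
    · simp only [hu, cond_true, Option.some.injEq] at h
      subst h
      rw [toTm_sub, Sp.toTm_toSub, ← (hS c en hen).2.2, toTm]
  | _ => simp [unfold] at h

namespace Checker.Sound

theorem eqT (hF : F.Sound β) {Γ A B} (hA : ETy β Γ A) (hB : ETy β Γ B)
    (h : F.eqT Γ A B = true) : ETyEq β Γ A B := by
  rw [Checker.eqT, Bool.or_eq_true] at h
  rcases h with h | h
  · rw [Ex.eq_of_beq h]; exact .typeEq_refl hB
  · exact hF.convT hA hB h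

theorem check (hF : F.Sound β) {Γ a A} (hA : ETy β Γ A) (h : F.check Γ a A = true) :
    ETerm β Γ a A := by
  unfold Checker.check at h
  split at h
  · rename_i A' hA'
    obtain ⟨h1, h2⟩ := hF.infer hA.ctx_of hA'
    exact .conv h1 (hF.eqT h2 hA h)
  · contradiction

theorem eqAt (hF : F.Sound β) {Γ a b A} (hA : ETy β Γ A) (h : F.eqAt Γ a b A = true) :
    ETermEq β Γ a b A ∧ ETerm β Γ a A := by
  unfold Checker.eqAt at h
  split at h
  · rename_i A' hA'
    obtain ⟨h1, h2, h3⟩ := hF.conv hA.ctx_of hA'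
    have := hF.eqT h3 hA h
    exact ⟨.conv_eq h1 this, .conv h2 this⟩
  · contradiction

theorem univ {Γ : List Ex} (hΓ : Derivable (ctxTm β Γ) ctx) : ETy β Γ .univ := .univ hΓ

theorem cons {Γ A} (hA : ETy β Γ A) : Derivable (ctxTm β (A :: Γ)) ctx := .cons hA

theorem isU (hF : F.Sound β) {Γ A} (hΓ : Derivable (ctxTm β Γ) ctx) (h : F.isU Γ A = true) :
    ETerm β Γ A .univ := hF.check (univ hΓ) h

theorem eqU (hF : F.Sound β) {Γ A B} (hΓ : Derivable (ctxTm β Γ) ctx)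
    (h : F.eqAt Γ A B .univ = true) : ETermEq β Γ A B .univ ∧ ETerm β Γ A .univ :=
  hF.eqAt (univ hΓ) h

theorem toPi (hF : F.Sound β) {Γ T p} (hT : ETy β Γ T) (h : F.toPi Γ T = some p) :
    ETyEq β Γ T (.pi p.1 p.2) ∧ ETy β Γ (.pi p.1 p.2) := by
  rw [← Ex.asPi_eq h]; exact hF.whnfT hT

theorem toSigma (hF : F.Sound β) {Γ T p} (hT : ETy β Γ T) (h : F.toSigma Γ T = some p) :
    ETyEq β Γ T (.sigma p.1 p.2) ∧ ETy β Γ (.sigma p.1 p.2) := by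
  rw [← Ex.asSigma_eq h]; exact hF.whnfT hT

theorem type_of_append {Γ Δ : Ctx} (h : Derivable (Γ ++ Δ) ctx) : Derivable Δ ctx := by
  induction Γ with
  | nil => exact h
  | cons A Γ ih => exact ih (Derivable.type_of_cons h).ctx_of

/-- The next parameter of a list of parameters, some of which are given. -/
theorem type_param {Γ tele pre : List Ex} {P : Ex} {Ps : List Ex} {σ : ℕ → Ex}
    (htele : Derivable (ctxTm β tele.reverse) ctx) (h : tele = pre ++ P :: Ps)
    (hΓ : Derivable (ctxTm β Γ) ctx)
    (hσ : IsSubst (ctxTm β pre.reverse) (ctxTm β Γ) (fun n => (σ n).toTm β)) :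
    ETy β Γ (P.sub σ 0) := by
  subst h
  have : Derivable (P.toTm β :: ctxTm β pre.reverse) ctx := by
    have e : ctxTm β (pre ++ P :: Ps).reverse =
      ctxTm β Ps.reverse ++ (P.toTm β :: ctxTm β pre.reverse) := by simp [ctxTm]
    rw [e] at htele
    exact type_of_append htele
  rw [ETy, Ex.toTm_sub]
  exact this.type_of_cons.type_subst hΓ hσ

theorem inferSp (hF : F.Sound β) {Γ tele : List Ex} (htele : Derivable (ctxTm β tele.reverse) ctx)
    (hΓ : Derivable (ctxTm β Γ) ctx) : ∀ (s : Sp) {σ rest},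
    F.inferSp Γ tele s = some (σ, rest) → ∃ pre, tele = pre ++ rest ∧
      (fun n => (σ n).toTm β) = s.toTm β ∧
      IsSubst (ctxTm β pre.reverse) (ctxTm β Γ) (fun n => (σ n).toTm β)
  | .nil, σ, rest, h => by
    simp only [Checker.inferSp, Option.some.injEq, Prod.mk.injEq] at h
    obtain ⟨rfl, rfl⟩ := h
    exact ⟨[], rfl, rfl, .nil⟩
  | .snoc s a, σ, rest, h => by
    rw [Checker.inferSp] at h
    split at h
    · rename_i σ' P Ps hs
      obtain ⟨hc, h⟩ := guardO_eq_some.1 h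
      simp only [Option.some.injEq, Prod.mk.injEq] at h
      obtain ⟨rfl, rfl⟩ := h
      obtain ⟨pre, hpre, hσ, hsub⟩ := inferSp hF htele hΓ s hs
      have hP := type_param htele hpre hΓ hsub
      have ha := hF.check hP hc
      rw [ETerm, Ex.toTm_sub] at ha
      refine ⟨pre ++ [P], by simp [hpre], ?_, ?_⟩
      · rw [Ex.toTm_scons, hσ]; rfl
      · rw [Ex.toTm_scons]
        simpa [ctxTm] using hsub.cons ha
    · contradiction

/-- A substitution all whose terms equal those of a second one. -/
def EqSubst (Γ Δ : Ctx) (σ τ : ℕ → Tm) : Prop :=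
  ∀ n A, Γ[n]? = some A → Derivable Δ (termEq (σ n) (τ n) ((A.wk (n + 1)).subst σ))

theorem EqSubst.cons {Γ Δ A a b σ τ} (hσ : EqSubst Γ Δ σ τ)
    (ha : Derivable Δ (termEq a b (A.subst σ))) :
    EqSubst (A :: Γ) Δ (Tm.scons a σ) (Tm.scons b τ) := by
  intro n B h
  cases n with
  | zero =>
    obtain rfl : A = B := by simpa using h
    rw [Tm.subst_wk]; exact ha
  | succ n =>
    rw [Tm.subst_wk]
    have := hσ n B (by simpa using h)
    rwa [Tm.subst_wk] at this

theorem convSp (hF : F.Sound β) {Γ tele : List Ex} (htele : Derivable (ctxTm β tele.reverse) ctx)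
    (hΓ : Derivable (ctxTm β Γ) ctx) : ∀ (s s' : Sp) {σ rest},
    F.convSp Γ tele s s' = some (σ, rest) → ∃ pre, tele = pre ++ rest ∧
      (fun n => (σ n).toTm β) = s.toTm β ∧
      IsSubst (ctxTm β pre.reverse) (ctxTm β Γ) (fun n => (σ n).toTm β) ∧
      EqSubst (ctxTm β pre.reverse) (ctxTm β Γ) (fun n => (σ n).toTm β) (s'.toTm β)
  | .nil, .nil, σ, rest, h => by
    simp only [Checker.convSp, Option.some.injEq, Prod.mk.injEq] at h
    obtain ⟨rfl, rfl⟩ := h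
    exact ⟨[], rfl, rfl, .nil, by intro n A h; simp at h⟩
  | .snoc s a, .snoc s' a', σ, rest, h => by
    rw [Checker.convSp] at h
    split at h
    · rename_i σ' P Ps hs
      obtain ⟨hc, h⟩ := guardO_eq_some.1 h
      simp only [Option.some.injEq, Prod.mk.injEq] at h
      obtain ⟨rfl, rfl⟩ := h
      obtain ⟨pre, hpre, hσ, hsub, heq⟩ := convSp hF htele hΓ s s' hs
      have hP := type_param htele hpre hΓ hsub
      obtain ⟨he, ha⟩ := hF.eqAt hP hc
      rw [ETerm, Ex.toTm_sub] at ha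
      rw [ETermEq, Ex.toTm_sub] at he
      refine ⟨pre ++ [P], by simp [hpre], ?_, ?_, ?_⟩
      · rw [Ex.toTm_scons, hσ]; rfl
      · rw [Ex.toTm_scons]
        simpa [ctxTm] using hsub.cons ha
      · rw [Ex.toTm_scons]
        simpa [ctxTm, Sp.toTm] using heq.cons he
    · contradiction
  | .nil, .snoc _ _, _, _, h => by simp [Checker.convSp] at h
  | .snoc _ _, .nil, _, _, h => by simp [Checker.convSp] at h

theorem spRes_eq {res T : Ex} {p : (ℕ → Ex) × List Ex} (h : Checker.spRes res p = some T) :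
    p = (p.1, []) ∧ T = res.sub p.1 0 := by
  obtain ⟨σ, l⟩ := p
  cases l with
  | nil => simpa [Checker.spRes, eq_comm] using h
  | cons _ _ => simp [Checker.spRes] at h

theorem inferCst (hS : S.Valid β) (hF : F.Sound β) {Γ : List Ex}
    (hΓ : Derivable (ctxTm β Γ) ctx) {c s en p T} (hen : S c = some en)
    (h : F.inferSp Γ en.tele s = some p) (hT : Checker.spRes en.res p = some T) :
    ETerm β Γ (.cst c s) T ∧ ETy β Γ T := by
  obtain ⟨hp, rfl⟩ := spRes_eq hT
  rw [hp] at h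
  obtain ⟨h1, h2, -⟩ := hS c en hen
  obtain ⟨pre, hpre, hσ, hsub⟩ := hF.inferSp h1.ctx_of hΓ s h
  rw [List.append_nil] at hpre
  subst hpre
  simp only [ETerm, ETy, Ex.toTm_sub, Ex.toTm, hσ] at hsub h1 ⊢
  exact ⟨h2.term_subst hΓ hsub, h1.type_subst hΓ hsub⟩

theorem convCst (hS : S.Valid β) (hF : F.Sound β) {Γ : List Ex}
    (hΓ : Derivable (ctxTm β Γ) ctx) {c s s' en p T} (hen : S c = some en)
    (h : F.convSp Γ en.tele s s' = some p) (hT : Checker.spRes en.res p = some T) :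
    ETermEq β Γ (.cst c s) (.cst c s') T ∧ ETerm β Γ (.cst c s) T ∧ ETy β Γ T := by
  obtain ⟨hp, rfl⟩ := spRes_eq hT
  rw [hp] at h
  obtain ⟨h1, h2, -⟩ := hS c en hen
  obtain ⟨pre, hpre, hσ, hsub, heq⟩ := hF.convSp h1.ctx_of hΓ s s' h
  rw [List.append_nil] at hpre
  subst hpre
  simp only [ETerm, ETy, ETermEq, Ex.toTm_sub, Ex.toTm, hσ] at hsub h1 heq ⊢
  exact ⟨.subst_termEq h2 hΓ heq, h2.term_subst hΓ hsub, h1.type_subst hΓ hsub⟩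

theorem type_ctxJ {Γ A} (hA : ETy β Γ A) : Derivable (ctxTm β (Ex.ctxJ Γ A)) ctx := by
  have := Derivable.ctx_J hA
  simpa only [ctxTm, Ex.ctxJ, List.map_cons, Ex.toTm, Ex.toTm_wk] using this

theorem ctxTm_ctxJ (Γ : List Ex) (A : Ex) : ctxTm β (Ex.ctxJ Γ A) =
    .id ((A.toTm β).wk 2) (.var 1) (.var 0) :: (A.toTm β).wk 1 :: A.toTm β :: ctxTm β Γ := by
  simp only [ctxTm, Ex.ctxJ, List.map_cons, Ex.toTm, Ex.toTm_wk]

theorem type_homotopy {Γ A B f g} (hT : ETy β Γ (.pi A B)) (hf : ETerm β Γ f (.pi A B))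
    (hg : ETerm β Γ g (.pi A B)) : ETy β (A :: Γ) (Ex.homotopy B f g) := by
  have := Derivable.type_homotopy hT.of_pi.1 hT.of_pi.2 hf hg
  simpa only [ETy, ctxTm, Ex.homotopy, List.map_cons, Ex.toTm, Ex.toTm_wk] using this

theorem type_id {Γ A a b} (hA : ETy β Γ A) (ha : ETerm β Γ a A) (hb : ETerm β Γ b A) :
    ETy β Γ (.id A a b) := .id hA ha hb

theorem type_inst {Γ A B a} (hB : ETy β (A :: Γ) B) (ha : ETerm β Γ a A) :
    ETy β Γ (B.inst a) := by
  rw [ETy, Ex.toTm_inst]; exact Derivable.type_inst ha.ctx_of hB ha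

theorem term_inst {Γ A B a b} (hb : ETerm β (A :: Γ) b B) (ha : ETerm β Γ a A) :
    ETerm β Γ (b.inst a) (B.inst a) := by
  rw [ETerm, Ex.toTm_inst, Ex.toTm_inst]; exact Derivable.term_inst ha.ctx_of hb ha

theorem typeEq_inst {Γ A B a a'} (hB : ETy β (A :: Γ) B) (ha : ETermEq β Γ a a' A) :
    ETyEq β Γ (B.inst a) (B.inst a') := by
  rw [ETyEq, Ex.toTm_inst, Ex.toTm_inst]; exact Derivable.typeEq_inst ha.ctx_of hB ha

theorem term_app {Γ A B f a} (hf : ETerm β Γ f (.pi A B)) (ha : ETerm β Γ a A) :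
    ETerm β Γ (.app f a) (B.inst a) := by
  rw [ETerm, Ex.toTm_inst]; exact .app hf ha

theorem termEq_app {Γ A B f f' a a'} (hf : ETermEq β Γ f f' (.pi A B)) (ha : ETermEq β Γ a a' A) :
    ETermEq β Γ (.app f a) (.app f' a') (B.inst a) := by
  rw [ETermEq, Ex.toTm_inst]; exact .app_eq hf ha

theorem type_atPair {Γ A B E} (hT : ETy β Γ (.sigma A B)) (hE : ETy β (.sigma A B :: Γ) E) :
    ETy β (B :: A :: Γ) (E.atPair B) := by
  rw [ETy, Ex.toTm_atPair]; exact .type_atPair hT.of_sigma.1 hT.of_sigma.2 hE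

theorem term_split {Γ A B E e c} (hE : ETy β (.sigma A B :: Γ) E)
    (he : ETerm β (B :: A :: Γ) e (E.atPair B)) (hc : ETerm β Γ c (.sigma A B)) :
    ETerm β Γ (.split E e c) (E.inst c) := by
  rw [ETerm, Ex.toTm_inst]
  rw [ETerm, Ex.toTm_atPair] at he
  exact .split hE he hc

theorem termEq_split {Γ A B E E' e e' c c'} (hE : ETyEq β (.sigma A B :: Γ) E E')
    (he : ETermEq β (B :: A :: Γ) e e' (E.atPair B)) (hc : ETermEq β Γ c c' (.sigma A B)) :
    ETermEq β Γ (.split E e c) (.split E' e' c') (E.inst c) := by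
  rw [ETermEq, Ex.toTm_inst]
  rw [ETermEq, Ex.toTm_atPair] at he
  exact .split_eq hE he hc

theorem type_atRefl {Γ A E} (hA : ETy β Γ A) (hE : ETy β (Ex.ctxJ Γ A) E) :
    ETy β (A :: Γ) E.atRefl := by
  rw [ETy, ctxTm_ctxJ] at hE
  rw [ETy, Ex.toTm_atRefl]; exact .type_atRefl hA hE

theorem type_inst₃ {Γ A E a b p} (hE : ETy β (Ex.ctxJ Γ A) E) (ha : ETerm β Γ a A)
    (hb : ETerm β Γ b A) (hp : ETerm β Γ p (.id A a b)) : ETy β Γ (E.inst₃ a b p) := by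
  rw [ETy, ctxTm_ctxJ] at hE
  rw [ETy, Ex.toTm_inst₃]; exact .type_inst₃ ha.ctx_of hE ha hb hp

theorem typeEq_inst₃ {Γ A E a b p p'} (hE : ETy β (Ex.ctxJ Γ A) E) (ha : ETerm β Γ a A)
    (hb : ETerm β Γ b A) (hp : ETermEq β Γ p p' (.id A a b)) :
    ETyEq β Γ (E.inst₃ a b p) (E.inst₃ a b p') := by
  rw [ETy, ctxTm_ctxJ] at hE
  rw [ETyEq, Ex.toTm_inst₃, Ex.toTm_inst₃]
  exact .typeEq_inst₃ ha.ctx_of hE (.termEq_refl ha) (.termEq_refl hb) hp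

theorem term_J {Γ A E e a b p} (hE : ETy β (Ex.ctxJ Γ A) E) (he : ETerm β (A :: Γ) e E.atRefl)
    (ha : ETerm β Γ a A) (hb : ETerm β Γ b A) (hp : ETerm β Γ p (.id A a b)) :
    ETerm β Γ (.J E e a b p) (E.inst₃ a b p) := by
  rw [ETy, ctxTm_ctxJ] at hE
  rw [ETerm, Ex.toTm_atRefl] at he
  rw [ETerm, Ex.toTm_inst₃]
  exact .J hE he ha hb hp

theorem termEq_J {Γ A E E' e e' a a' b b' p p'} (hE : ETyEq β (Ex.ctxJ Γ A) E E')
    (he : ETermEq β (A :: Γ) e e' E.atRefl) (ha : ETermEq β Γ a a' A) (hb : ETermEq β Γ b b' A)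
    (hp : ETermEq β Γ p p' (.id A a b)) :
    ETermEq β Γ (.J E e a b p) (.J E' e' a' b' p') (E.inst₃ a b p) := by
  rw [ETyEq, ctxTm_ctxJ] at hE
  rw [ETermEq, Ex.toTm_atRefl] at he
  rw [ETermEq, Ex.toTm_inst₃]
  exact .J_eq hE he ha hb hp

theorem term_funext {Γ A B f g α} (hf : ETerm β Γ f (.pi A B)) (hg : ETerm β Γ g (.pi A B))
    (hα : ETerm β (A :: Γ) α (Ex.homotopy B f g)) :
    ETerm β Γ (.funext f g α) (.id (.pi A B) f g) := by
  simp only [ETerm, ctxTm, Ex.homotopy, List.map_cons, Ex.toTm, Ex.toTm_wk] at hα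
  exact .funext hf hg hα

theorem termEq_funext {Γ A B f f' g g' α α'} (hf : ETermEq β Γ f f' (.pi A B))
    (hg : ETermEq β Γ g g' (.pi A B)) (hα : ETermEq β (A :: Γ) α α' (Ex.homotopy B f g)) :
    ETermEq β Γ (.funext f g α) (.funext f' g' α') (.id (.pi A B) f g) := by
  simp only [ETermEq, ctxTm, Ex.homotopy, List.map_cons, Ex.toTm, Ex.toTm_wk] at hα
  exact .funext_eq hf hg hα

theorem termEq_eta {Γ A B f} (hf : ETerm β Γ f (.pi A B)) :
    ETermEq β Γ f (.lam A (.app (f.shift 1 0) (.var 0))) (.pi A B) := by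
  simp only [ETermEq, Ex.toTm, Ex.toTm_wk]
  exact .pi_eta hf

theorem inferStep (hS : S.Valid β) (hF : F.Sound β) {Γ e T} (hΓ : Derivable (ctxTm β Γ) ctx)
    (h : F.inferStep S Γ e = some T) : ETerm β Γ e T ∧ ETy β Γ T := by
  cases e <;> simp only [Checker.inferStep, guardO_eq_some, Option.bind_eq_some_iff,
    Option.map_eq_some_iff, Bool.and_eq_true, Option.some.injEq, reduceCtorEq] at h
  case var n =>
    obtain ⟨A, hA, rfl⟩ := h
    have hA' : (ctxTm β Γ)[n]? = some (A.toTm β) := by simp [hA]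
    have hT := Derivable.var hΓ hA'
    refine ⟨by rwa [ETerm, Ex.toTm_wk], ?_⟩
    rw [ETy, Ex.toTm_wk]
    obtain ⟨hn, hn'⟩ := List.getElem?_eq_some_iff.1 hA'
    have e : ctxTm β Γ = (ctxTm β Γ).take (n + 1) ++ (ctxTm β Γ).drop (n + 1) := by simp
    have e' : ctxTm β Γ = (ctxTm β Γ).take n ++ (A.toTm β :: (ctxTm β Γ).drop (n + 1)) := by
      rw [← hn', ← List.drop_eq_getElem_cons hn, List.take_append_drop]
    have h1 : ETy β (Γ.drop (n + 1)) A := by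
      rw [e'] at hΓ
      have := (type_of_append hΓ).type_of_cons
      simpa [ETy, ctxTm, List.map_drop] using this
    have hs := IsSubst.shift (Γ := (ctxTm β Γ).drop (n + 1)) (Δ := (ctxTm β Γ).take (n + 1))
      (by rwa [← e])
    rw [← e, List.length_take, min_eq_left (by omega)] at hs
    rw [Tm.wk_eq_subst]
    refine Derivable.type_subst ?_ hΓ hs
    simpa [ETy, ctxTm, List.map_drop] using h1
  case pi A B =>
    obtain ⟨⟨h1, h2⟩, rfl⟩ := h
    have hA := hF.isU hΓ h1
    exact ⟨.pi_univ hA (hF.isU (cons (.el hA)) h2), univ hΓ⟩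
  case sigma A B =>
    obtain ⟨⟨h1, h2⟩, rfl⟩ := h
    have hA := hF.isU hΓ h1
    exact ⟨.sigma_univ hA (hF.isU (cons (.el hA)) h2), univ hΓ⟩
  case id A a b =>
    obtain ⟨⟨⟨h1, h2⟩, h3⟩, rfl⟩ := h
    have hA := hF.isU hΓ h1
    exact ⟨.id_univ hA (hF.check (.el hA) h2) (hF.check (.el hA) h3), univ hΓ⟩
  case lam A b =>
    obtain ⟨h1, B, h2, rfl⟩ := h
    have hA := hF.isTy hΓ h1
    obtain ⟨h3, h4⟩ := hF.infer (cons hA) h2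
    exact ⟨.lam hA h3, .pi hA h4⟩
  case app f a =>
    obtain ⟨T', h1, ⟨A, B⟩, h2, h3, rfl⟩ := h
    obtain ⟨hf, hT'⟩ := hF.infer hΓ h1
    obtain ⟨he, hP⟩ := hF.toPi hT' h2
    have ha := hF.check hP.of_pi.1 h3
    exact ⟨term_app (.conv hf he) ha, type_inst hP.of_pi.2 ha⟩
  case pair B a b =>
    obtain ⟨A, h1, ⟨h2, h3⟩, rfl⟩ := h
    obtain ⟨ha, hA⟩ := hF.infer hΓ h1
    have hB := hF.isTy (cons hA) h2
    have hb := hF.check (type_inst hB ha) h3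
    rw [ETerm, Ex.toTm_inst] at hb
    exact ⟨.pair hB ha hb, .sigma hA hB⟩
  case split E e c =>
    obtain ⟨T', h1, ⟨A, B⟩, h2, ⟨h3, h4⟩, rfl⟩ := h
    obtain ⟨hc, hT'⟩ := hF.infer hΓ h1
    obtain ⟨he, hP⟩ := hF.toSigma hT' h2
    have hE := hF.isTy (cons hP) h3
    have hc' := Derivable.conv hc he
    exact ⟨term_split hE (hF.check (type_atPair hP hE) h4) hc', type_inst hE hc'⟩
  case refl a =>
    obtain ⟨A, h1, rfl⟩ := h
    obtain ⟨ha, hA⟩ := hF.infer hΓ h1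
    exact ⟨.refl ha, .id hA ha ha⟩
  case J E e a b p =>
    obtain ⟨A, h1, ⟨⟨⟨h2, h3⟩, h4⟩, h5⟩, rfl⟩ := h
    obtain ⟨ha, hA⟩ := hF.infer hΓ h1
    have hb := hF.check hA h2
    have hp := hF.check (type_id hA ha hb) h3
    have hE := hF.isTy (type_ctxJ hA) h4
    exact ⟨term_J hE (hF.check (type_atRefl hA hE) h5) ha hb hp, type_inst₃ hE ha hb hp⟩
  case funext f g α =>
    obtain ⟨T', h1, ⟨A, B⟩, h2, ⟨h3, h4⟩, rfl⟩ := h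
    obtain ⟨hf, hT'⟩ := hF.infer hΓ h1
    obtain ⟨he, hP⟩ := hF.toPi hT' h2
    have hf' := Derivable.conv hf he
    have hg := hF.check hP h3
    exact ⟨term_funext hf' hg (hF.check (type_homotopy hP hf' hg) h4), .id hP hf' hg⟩
  case cst c s =>
    obtain ⟨en, hen, p, h1, h2⟩ := h
    exact inferCst hS hF hΓ hen h1 h2

theorem isTyStep (hF : F.Sound β) {Γ A} (hΓ : Derivable (ctxTm β Γ) ctx)
    (h : F.isTyStep Γ A = true) : ETy β Γ A := by
  cases A <;> simp only [Checker.isTyStep, Bool.and_eq_true] at h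
  case univ => exact univ hΓ
  case pi A B =>
    have hA := hF.isTy hΓ h.1
    exact .pi hA (hF.isTy (cons hA) h.2)
  case sigma A B =>
    have hA := hF.isTy hΓ h.1
    exact .sigma hA (hF.isTy (cons hA) h.2)
  case id A a b =>
    have hA := hF.isTy hΓ h.1.1
    exact .id hA (hF.check hA h.1.2) (hF.check hA h.2)
  all_goals exact .el (hF.isU hΓ h)

end Checker.Sound

variable {β : ℕ → Tm} {S : Sig} {F : Checker}

namespace Checker.Sound

/-- What is proved about a reduction step. -/
abbrev RedSpec (β : ℕ → Tm) (Γ : List Ex) (e e' T : Ex) : Prop :=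
  ETermEq β Γ e e' T ∧ ETerm β Γ e T ∧ ETerm β Γ e' T ∧ ETy β Γ T

theorem redApp (hS : S.Valid β) (hF : F.Sound β) {Γ f a e' T} (hΓ : Derivable (ctxTm β Γ) ctx)
    (h : F.redApp S Γ f a = some (e', T)) : RedSpec β Γ (.app f a) e' T := by
  unfold Checker.redApp at h
  split at h
  · rename_i f' hf
    have := hF.red hΓ h
    simpa only [RedSpec, ETermEq, ETerm, Ex.toTm, Ex.toTm_unfold hS hf] using this
  · simp only [guardO_eq_some, Option.bind_eq_some_iff, Option.some.injEq, Prod.mk.injEq] at h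
    obtain ⟨⟨f', T'⟩, h1, ⟨A, B⟩, h2, h3, rfl, rfl⟩ := h
    obtain ⟨he, hf, hf', hT'⟩ := hF.red hΓ h1
    obtain ⟨hc, hP⟩ := hF.toPi hT' h2
    have ha := hF.check hP.of_pi.1 h3
    exact ⟨termEq_app (.conv_eq he hc) (.termEq_refl ha), term_app (.conv hf hc) ha,
      term_app (.conv hf' hc) ha, type_inst hP.of_pi.2 ha⟩

theorem redSplit (hS : S.Valid β) (hF : F.Sound β) {Γ E e c e' T}
    (hΓ : Derivable (ctxTm β Γ) ctx) (h : F.redSplit S Γ E e c = some (e', T)) :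
    RedSpec β Γ (.split E e c) e' T := by
  unfold Checker.redSplit at h
  split at h
  · rename_i c' hc
    have := hF.red hΓ h
    simpa only [RedSpec, ETermEq, ETerm, Ex.toTm, Ex.toTm_unfold hS hc] using this
  · simp only [guardO_eq_some, Option.bind_eq_some_iff, Option.some.injEq, Prod.mk.injEq,
      Bool.and_eq_true] at h
    obtain ⟨⟨c', T'⟩, h1, ⟨A, B⟩, h2, ⟨h3, h4⟩, rfl, rfl⟩ := h
    obtain ⟨he, hc, hc', hT'⟩ := hF.red hΓ h1
    obtain ⟨hs, hP⟩ := hF.toSigma hT' h2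
    have hE := hF.isTy (cons hP) h3
    have hb := hF.check (type_atPair hP hE) h4
    have he' := Derivable.conv_eq he hs
    have hc₁ := Derivable.conv hc hs
    exact ⟨termEq_split (.typeEq_refl hE) (.termEq_refl hb) he', term_split hE hb hc₁,
      .conv (term_split hE hb (.conv hc' hs)) (.typeEq_symm (typeEq_inst hE he')),
      type_inst hE hc₁⟩

theorem redJ (hS : S.Valid β) (hF : F.Sound β) {Γ E e a b p e' T}
    (hΓ : Derivable (ctxTm β Γ) ctx) (h : F.redJ S Γ E e a b p = some (e', T)) :
    RedSpec β Γ (.J E e a b p) e' T := by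
  unfold Checker.redJ at h
  split at h
  · rename_i p' hp
    have := hF.red hΓ h
    simpa only [RedSpec, ETermEq, ETerm, Ex.toTm, Ex.toTm_unfold hS hp] using this
  · simp only [guardO_eq_some, Option.bind_eq_some_iff, Option.some.injEq, Prod.mk.injEq,
      Bool.and_eq_true] at h
    obtain ⟨A, h1, h2, ⟨p', T'⟩, h3, ⟨⟨h4, h5⟩, h6⟩, rfl, rfl⟩ := h
    obtain ⟨ha, hA⟩ := hF.infer hΓ h1
    have hb := hF.check hA h2
    obtain ⟨he, hp, hp', hT'⟩ := hF.red hΓ h3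
    have hs := hF.eqT hT' (type_id hA ha hb) h4
    have hE := hF.isTy (type_ctxJ hA) h5
    have hb' := hF.check (type_atRefl hA hE) h6
    have he' := Derivable.conv_eq he hs
    have hp₁ := Derivable.conv hp hs
    exact ⟨termEq_J (.typeEq_refl hE) (.termEq_refl hb') (.termEq_refl ha) (.termEq_refl hb) he',
      term_J hE hb' ha hb hp₁,
      .conv (term_J hE hb' ha hb (.conv hp' hs)) (.typeEq_symm (typeEq_inst₃ hE ha hb he')),
      type_inst₃ hE ha hb hp₁⟩

theorem red_beta (hF : F.Sound β) {Γ A b a e' T} (hΓ : Derivable (ctxTm β Γ) ctx)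
    (h : guardO (F.isTy Γ A && F.check Γ a A)
      ((F.infer (A :: Γ) b).map fun B => (b.inst a, B.inst a)) = some (e', T)) :
    RedSpec β Γ (.app (.lam A b) a) e' T := by
  simp only [guardO_eq_some, Option.map_eq_some_iff, Prod.mk.injEq, Bool.and_eq_true] at h
  obtain ⟨⟨h1, h2⟩, B, h3, rfl, rfl⟩ := h
  have hA := hF.isTy hΓ h1
  have ha := hF.check hA h2
  obtain ⟨hb, hB⟩ := hF.infer (cons hA) h3
  refine ⟨?_, term_app (.lam hA hb) ha, term_inst hb ha, type_inst hB ha⟩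
  rw [ETermEq, Ex.toTm_inst, Ex.toTm_inst]
  exact .pi_beta hb ha

theorem red_sigma_beta (hF : F.Sound β) {Γ E e B a b e' T} (hΓ : Derivable (ctxTm β Γ) ctx)
    (h : ((F.infer Γ a).bind fun A =>
      guardO (F.isTy (A :: Γ) B && F.check Γ b (B.inst a) && F.isTy (.sigma A B :: Γ) E &&
        F.check (B :: A :: Γ) e (E.atPair B)) (some (e.inst₂ a b, E.inst (.pair B a b)))) =
      some (e', T)) :
    RedSpec β Γ (.split E e (.pair B a b)) e' T := by
  simp only [guardO_eq_some, Option.bind_eq_some_iff, Option.some.injEq, Prod.mk.injEq,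
    Bool.and_eq_true] at h
  obtain ⟨A, h1, ⟨⟨⟨h2, h3⟩, h4⟩, h5⟩, rfl, rfl⟩ := h
  obtain ⟨ha, hA⟩ := hF.infer hΓ h1
  have hB := hF.isTy (cons hA) h2
  have hb := hF.check (type_inst hB ha) h3
  have hP : ETy β Γ (.sigma A B) := .sigma hA hB
  have hE := hF.isTy (cons hP) h4
  have he := hF.check (type_atPair hP hE) h5
  have hb' := hb
  rw [ETerm, Ex.toTm_inst] at hb'
  have hp : ETerm β Γ (.pair B a b) (.sigma A B) := .pair hB ha hb'
  have he' := he
  rw [ETerm, Ex.toTm_atPair] at he'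
  refine ⟨?_, term_split hE he hp, ?_, type_inst hE hp⟩
  · rw [ETermEq, Ex.toTm_inst₂, Ex.toTm_inst]
    exact .sigma_beta hE he' ha hb'
  · have hs := ((IsSubst.refl hΓ).cons (by rwa [Tm.subst_var] : Derivable (ctxTm β Γ)
      (term (a.toTm β) ((A.toTm β).subst Tm.var)))).cons hb'
    have := he'.term_subst hΓ hs
    rw [ETerm, Ex.toTm_inst₂, Ex.toTm_inst]
    have e : Tm.subst (Tm.scons (b.toTm β) (Tm.scons (a.toTm β) Tm.var))
        ((E.toTm β).atPair (B.toTm β)) = (E.toTm β).inst ((Ex.pair B a b).toTm β) := by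
      simp only [Tm.atPair, Tm.inst, Tm.subst_subst, Ex.toTm]
      congr 1
      funext n
      cases n with
      | zero =>
        simp only [Tm.scons, Tm.subst, Tm.subst_rename]
        congr 1
        refine Eq.trans ?_ (Tm.subst_var _)
        congr 1
        funext n
        cases n <;> rfl
      | succ n => rfl
    rw [e] at this
    exact this

theorem red_id_beta (hF : F.Sound β) {Γ E e a b c e' T} (hΓ : Derivable (ctxTm β Γ) ctx)
    (h : ((F.infer Γ a).bind fun A =>
      guardO (F.eqAt Γ a b A && F.eqAt Γ a c A && F.check Γ b A &&
        F.check Γ (.refl c) (.id A a b) && F.isTy (Ex.ctxJ Γ A) E &&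
        F.check (A :: Γ) e E.atRefl) (some (e.inst a, E.inst₃ a b (.refl c)))) = some (e', T)) :
    RedSpec β Γ (.J E e a b (.refl c)) e' T := by
  simp only [guardO_eq_some, Option.bind_eq_some_iff, Option.some.injEq, Prod.mk.injEq,
    Bool.and_eq_true] at h
  obtain ⟨A, h1, ⟨⟨⟨⟨⟨h2, h3⟩, h4⟩, h5⟩, h6⟩, h7⟩, rfl, rfl⟩ := h
  obtain ⟨ha, hA⟩ := hF.infer hΓ h1
  have hab := (hF.eqAt hA h2).1
  have hac := (hF.eqAt hA h3).1
  have hb := hF.check hA h4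
  have hp := hF.check (type_id hA ha hb) h5
  have hE := hF.isTy (type_ctxJ hA) h6
  have he := hF.check (type_atRefl hA hE) h7
  -- The endpoints and the path agree with `a`, `a` and `refl(a)`.
  have hid : ETyEq β Γ (.id A a a) (.id A a b) := .id_eq (.typeEq_refl hA) (.termEq_refl ha) hab
  have hpa : ETermEq β Γ (.refl c) (.refl a) (.id A a b) :=
    .conv_eq (.termEq_symm (.refl_eq hac)) hid
  have h₁ : ETermEq β Γ (.J E e a b (.refl c)) (.J E e a a (.refl a)) (E.inst₃ a b (.refl c)) :=
    termEq_J (.typeEq_refl hE) (.termEq_refl he) (.termEq_refl ha) (.termEq_symm hab) hpa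
  have hT : ETyEq β Γ (E.inst₃ a b (.refl c)) (E.inst₃ a a (.refl a)) := by
    rw [ETy, ctxTm_ctxJ] at hE
    rw [ETyEq, Ex.toTm_inst₃, Ex.toTm_inst₃]
    exact .typeEq_inst₃ hΓ hE (.termEq_refl ha) (.termEq_symm hab) hpa
  have h₂ : ETermEq β Γ (.J E e a a (.refl a)) (e.inst a) (E.inst₃ a a (.refl a)) := by
    rw [ETy, ctxTm_ctxJ] at hE
    rw [ETerm, Ex.toTm_atRefl] at he
    rw [ETermEq, Ex.toTm_inst₃, Ex.toTm_inst]
    exact .id_beta hE he ha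
  have h₃ : ETerm β Γ (e.inst a) (E.inst₃ a a (.refl a)) := by
    have := term_inst he ha
    have e : (E.atRefl.inst a).toTm β = (E.inst₃ a a (.refl a)).toTm β := by
      rw [Ex.toTm_inst₃, Ex.toTm_inst, Ex.toTm_atRefl]
      simp only [Tm.atRefl, Tm.inst, Tm.inst₃, Tm.subst_subst, Ex.toTm]
      congr 1
      funext n
      match n with
      | 0 => rfl
      | 1 => rfl
      | 2 => rfl
      | n + 3 => rfl
    rwa [ETerm, e] at this
  exact ⟨.termEq_trans h₁ (.conv_eq h₂ (.typeEq_symm hT)), term_J hE he ha hb hp,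
    .conv h₃ (.typeEq_symm hT), type_inst₃ hE ha hb hp⟩

theorem redStep (hS : S.Valid β) (hF : F.Sound β) {Γ e e' T} (hΓ : Derivable (ctxTm β Γ) ctx)
    (h : F.redStep S Γ e = some (e', T)) : RedSpec β Γ e e' T := by
  unfold Checker.redStep at h
  split at h
  · exact red_beta hF hΓ h
  · exact redApp hS hF hΓ h
  · exact red_sigma_beta hF hΓ h
  · exact redSplit hS hF hΓ h
  · exact red_id_beta hF hΓ h
  · exact redJ hS hF hΓ h
  · contradiction

/-- What is proved about a comparison of terms. -/
abbrev ConvSpec (β : ℕ → Tm) (Γ : List Ex) (a b T : Ex) : Prop :=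
  ETermEq β Γ a b T ∧ ETerm β Γ a T ∧ ETy β Γ T

theorem convStruct (hS : S.Valid β) (hF : F.Sound β) {Γ a b T} (hΓ : Derivable (ctxTm β Γ) ctx)
    (h : F.convStruct S Γ a b = some T) : ConvSpec β Γ a b T := by
  unfold Checker.convStruct at h
  split at h <;> simp only [guardO_eq_some, Option.bind_eq_some_iff,
    Option.map_eq_some_iff, Bool.and_eq_true, Option.some.injEq, reduceCtorEq] at h
  · obtain ⟨⟨h1, h2⟩, rfl⟩ := h
    obtain ⟨eA, hA⟩ := hF.eqU hΓ h1
    obtain ⟨eB, hB⟩ := hF.eqU (cons (.el hA)) h2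
    exact ⟨.pi_univ_eq eA eB, .pi_univ hA hB, univ hΓ⟩
  · obtain ⟨⟨h1, h2⟩, rfl⟩ := h
    obtain ⟨eA, hA⟩ := hF.eqU hΓ h1
    obtain ⟨eB, hB⟩ := hF.eqU (cons (.el hA)) h2
    exact ⟨.sigma_univ_eq eA eB, .sigma_univ hA hB, univ hΓ⟩
  · obtain ⟨⟨⟨h1, h2⟩, h3⟩, rfl⟩ := h
    obtain ⟨eA, hA⟩ := hF.eqU hΓ h1
    obtain ⟨ea, ha⟩ := hF.eqAt (.el hA) h2
    obtain ⟨eb, hb⟩ := hF.eqAt (.el hA) h3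
    exact ⟨.id_univ_eq eA ea eb, .id_univ hA ha hb, univ hΓ⟩
  · obtain ⟨⟨⟨h1, h2⟩, h3⟩, B, h4, rfl⟩ := h
    have hA := hF.isTy hΓ h1
    have eA := hF.eqT hA (hF.isTy hΓ h2) h3
    obtain ⟨eb, hb, hB⟩ := hF.conv (cons hA) h4
    exact ⟨.lam_eq eA eb, .lam hA hb, .pi hA hB⟩
  · obtain ⟨T', h1, ⟨A, B⟩, h2, h3, rfl⟩ := h
    obtain ⟨ef, hf, hT'⟩ := hF.conv hΓ h1
    obtain ⟨he, hP⟩ := hF.toPi hT' h2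
    obtain ⟨ea, ha⟩ := hF.eqAt hP.of_pi.1 h3
    exact ⟨termEq_app (.conv_eq ef he) ea, term_app (.conv hf he) ha, type_inst hP.of_pi.2 ha⟩
  · obtain ⟨A, h1, ⟨⟨⟨h2, h3⟩, h4⟩, h5⟩, rfl⟩ := h
    obtain ⟨ea, ha, hA⟩ := hF.conv hΓ h1
    have hB := hF.isTy (cons hA) h2
    have eB := hF.eqT hB (hF.isTy (cons hA) h3) h4
    obtain ⟨eb, hb⟩ := hF.eqAt (type_inst hB ha) h5
    rw [ETerm, Ex.toTm_inst] at hb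
    rw [ETermEq, Ex.toTm_inst] at eb
    exact ⟨.pair_eq eB ea eb, .pair hB ha hb, .sigma hA hB⟩
  · obtain ⟨T', h1, ⟨A, B⟩, h2, ⟨⟨⟨h3, h4⟩, h5⟩, h6⟩, rfl⟩ := h
    obtain ⟨ec, hc, hT'⟩ := hF.conv hΓ h1
    obtain ⟨hs, hP⟩ := hF.toSigma hT' h2
    have hE := hF.isTy (cons hP) h3
    have eE := hF.eqT hE (hF.isTy (cons hP) h4) h5
    obtain ⟨ee, he⟩ := hF.eqAt (type_atPair hP hE) h6
    have hc' := Derivable.conv hc hs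
    exact ⟨termEq_split eE ee (.conv_eq ec hs), term_split hE he hc', type_inst hE hc'⟩
  · obtain ⟨A, h1, rfl⟩ := h
    obtain ⟨ea, ha, hA⟩ := hF.conv hΓ h1
    exact ⟨.refl_eq ea, .refl ha, .id hA ha ha⟩
  · obtain ⟨A, h1, ⟨⟨⟨⟨⟨h2, h3⟩, h4⟩, h5⟩, h6⟩, h7⟩, rfl⟩ := h
    obtain ⟨ea, ha, hA⟩ := hF.conv hΓ h1
    obtain ⟨eb, hb⟩ := hF.eqAt hA h2
    obtain ⟨ep, hp⟩ := hF.eqAt (type_id hA ha hb) h3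
    have hE := hF.isTy (type_ctxJ hA) h4
    have eE := hF.eqT hE (hF.isTy (type_ctxJ hA) h5) h6
    obtain ⟨ee, he⟩ := hF.eqAt (type_atRefl hA hE) h7
    exact ⟨termEq_J eE ee ea eb ep, term_J hE he ha hb hp, type_inst₃ hE ha hb hp⟩
  · obtain ⟨T', h1, ⟨A, B⟩, h2, ⟨h3, h4⟩, rfl⟩ := h
    obtain ⟨ef, hf, hT'⟩ := hF.conv hΓ h1
    obtain ⟨he, hP⟩ := hF.toPi hT' h2
    obtain ⟨eg, hg⟩ := hF.eqAt hP h3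
    have hf' := Derivable.conv hf he
    obtain ⟨eα, hα⟩ := hF.eqAt (type_homotopy hP hf' hg) h4
    exact ⟨termEq_funext (.conv_eq ef he) eg eα, term_funext hf' hg hα, .id hP hf' hg⟩
  · obtain ⟨h1, en, hen, p, h2, h3⟩ := h
    rw [← Nat.eq_of_beq_eq_true h1]
    exact convCst hS hF hΓ hen h2 h3

theorem convEta (hF : F.Sound β) {Γ a b T} (hΓ : Derivable (ctxTm β Γ) ctx)
    (h : F.convEta Γ a b = some T) : ConvSpec β Γ a b T := by
  unfold Checker.convEta at h
  split at h <;> simp only [guardO_eq_some, Option.bind_eq_some_iff, Option.some.injEq,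
    reduceCtorEq] at h
  · obtain ⟨T₁, h1, ⟨A', B'⟩, h2, T₂, h3, h4, rfl⟩ := h
    obtain ⟨hf, hT₁⟩ := hF.infer hΓ h1
    obtain ⟨he, hP⟩ := hF.toPi hT₁ h2
    obtain ⟨e, ha, hT₂⟩ := hF.conv hΓ h3
    have hs := Derivable.typeEq_symm (hF.eqT hT₂ hP h4)
    have eη := termEq_eta (.conv hf he)
    exact ⟨.termEq_trans e (.conv_eq (.termEq_symm eη) hs), ha, hT₂⟩
  · obtain ⟨T₁, h1, ⟨A', B'⟩, h2, T₂, h3, h4, rfl⟩ := h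
    obtain ⟨hf, hT₁⟩ := hF.infer hΓ h1
    obtain ⟨he, hP⟩ := hF.toPi hT₁ h2
    obtain ⟨e, -, hT₂⟩ := hF.conv hΓ h3
    have hs := hF.eqT hT₂ hP h4
    have hf' := Derivable.conv hf he
    exact ⟨.termEq_trans (termEq_eta hf') (.conv_eq e hs), hf', hP⟩

theorem convUnfold (hS : S.Valid β) (hF : F.Sound β) {Γ a b T} (hΓ : Derivable (ctxTm β Γ) ctx)
    (h : F.convUnfold S Γ a b = some T) : ConvSpec β Γ a b T := by
  have left {a'} (ha : a.unfold S = some a') (h : F.conv Γ a' b = some T) :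
      ConvSpec β Γ a b T := by
    have := hF.conv hΓ h
    simpa only [ConvSpec, ETermEq, ETerm, Ex.toTm_unfold hS ha] using this
  have right {b'} (hb : b.unfold S = some b') (h : F.conv Γ a b' = some T) :
      ConvSpec β Γ a b T := by
    have := hF.conv hΓ h
    simpa only [ConvSpec, ETermEq, ETerm, Ex.toTm_unfold hS hb] using this
  unfold Checker.convUnfold at h
  split at h
  · rename_i b' hb
    refine right ?_ h
    cases hab : Checker.unfoldsLater a b with
    | true => rwa [hab, cond_true] at hb
    | false => rw [hab, cond_false] at hb; exact absurd hb (by simp)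
  split at h
  · rename_i a' ha
    exact left ha h
  split at h
  · rename_i b' hb
    exact right hb h
  · exact convEta hF hΓ h

theorem convRed (hS : S.Valid β) (hF : F.Sound β) {Γ a b T} (hΓ : Derivable (ctxTm β Γ) ctx)
    (h : F.convRed S Γ a b = some T) : ConvSpec β Γ a b T := by
  unfold Checker.convRed at h
  split at h
  · rename_i a' T₁ ha
    simp only [guardO_eq_some, Option.bind_eq_some_iff, Option.some.injEq] at h
    obtain ⟨T₂, h1, h2, rfl⟩ := h
    obtain ⟨e₁, ha₁, -, hT₁⟩ := hF.red hΓ ha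
    obtain ⟨e₂, -, hT₂⟩ := hF.conv hΓ h1
    exact ⟨.termEq_trans e₁ (.conv_eq e₂ (hF.eqT hT₂ hT₁ h2)), ha₁, hT₁⟩
  split at h
  · rename_i b' T₁ hb
    simp only [guardO_eq_some, Option.bind_eq_some_iff, Option.some.injEq] at h
    obtain ⟨T₂, h1, h2, rfl⟩ := h
    obtain ⟨e₁, -, -, hT₁⟩ := hF.red hΓ hb
    obtain ⟨e₂, ha, hT₂⟩ := hF.conv hΓ h1
    exact ⟨.termEq_trans e₂ (.conv_eq (.termEq_symm e₁) (hF.eqT hT₁ hT₂ h2)), ha, hT₂⟩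
  · exact convUnfold hS hF hΓ h

theorem convStep (hS : S.Valid β) (hF : F.Sound β) {Γ a b T} (hΓ : Derivable (ctxTm β Γ) ctx)
    (h : F.convStep S Γ a b = some T) : ConvSpec β Γ a b T := by
  unfold Checker.convStep at h
  cases hab : a.beq b with
  | true =>
    rw [hab, cond_true] at h
    obtain ⟨ha, hT⟩ := hF.infer hΓ h
    rw [← Ex.eq_of_beq hab]
    exact ⟨.termEq_refl ha, ha, hT⟩
  | false =>
    rw [hab, cond_false] at h
    split at h
    · rename_i T' hT
      obtain rfl : T' = T := by simpa using h
      exact convStruct hS hF hΓ hT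
    · exact convRed hS hF hΓ h

theorem of_pi {Γ A B} (h : ETy β Γ (.pi A B)) : ETy β Γ A ∧ ETy β (A :: Γ) B :=
  Derivable.of_pi h

theorem of_sigma {Γ A B} (h : ETy β Γ (.sigma A B)) : ETy β Γ A ∧ ETy β (A :: Γ) B :=
  Derivable.of_sigma h

theorem convTWhnf (hF : F.Sound β) {Γ A B} (hA : ETy β Γ A) (hB : ETy β Γ B)
    (h : F.convTWhnf Γ A B = true) : ETyEq β Γ A B := by
  unfold Checker.convTWhnf at h
  split at h <;> try simp only [Bool.and_eq_true] at h
  · exact .typeEq_refl hA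
  · have e := hF.eqT hA.of_pi.1 hB.of_pi.1 h.1
    exact .pi_eq e (hF.eqT (of_pi hA).2 (Derivable.ctx_conv_type hB.of_pi.2 hA.of_pi.1 e) h.2)
  · have e := hF.eqT hA.of_sigma.1 hB.of_sigma.1 h.1
    exact .sigma_eq e
      (hF.eqT (of_sigma hA).2 (Derivable.ctx_conv_type hB.of_sigma.2 hA.of_sigma.1 e) h.2)
  · exact .id_eq (hF.eqT hA.of_id.1 hB.of_id.1 h.1.1) (hF.eqAt hA.of_id.1 h.1.2).1
      (hF.eqAt hA.of_id.1 h.2).1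
  · exact .el_eq (hF.eqU hA.ctx_of h).1

theorem convTStep (hF : F.Sound β) {Γ A B} (hA : ETy β Γ A) (hB : ETy β Γ B)
    (h : F.convTStep Γ A B = true) : ETyEq β Γ A B := by
  rw [Checker.convTStep, Bool.or_eq_true, Bool.and_eq_true] at h
  rcases h with h | h
  · exact .el_eq (hF.eqU hA.ctx_of h.2).1
  · obtain ⟨eA, hA'⟩ := hF.whnfT hA
    obtain ⟨eB, hB'⟩ := hF.whnfT hB
    exact .typeEq_trans eA (.typeEq_trans (hF.convTWhnf hA' hB' h) (.typeEq_symm eB))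

theorem whnfTStep (hS : S.Valid β) (hF : F.Sound β) {Γ A} (hA : ETy β Γ A) :
    ETyEq β Γ A (F.whnfTStep S Γ A) ∧ ETy β Γ (F.whnfTStep S Γ A) := by
  have h0 : ETyEq β Γ A A ∧ ETy β Γ A := ⟨.typeEq_refl hA, hA⟩
  unfold Checker.whnfTStep
  split <;> try exact h0
  split
  · rename_i A' h
    have e := Ex.toTm_unfold hS h
    have := hF.whnfT (A := A') (Γ := Γ) (by rwa [ETy, e])
    rwa [ETyEq, e] at this
  · split
    · rename_i A' T h
      cases hT : F.eqT Γ T .univ with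
      | false => exact h0
      | true =>
        rw [cond_true]
        obtain ⟨e, -, hA', hT'⟩ := hF.red hA.ctx_of h
        have hs := hF.eqT hT' (univ hA.ctx_of) hT
        obtain ⟨e', h'⟩ := hF.whnfT (.el (.conv hA' hs) : ETy β Γ A')
        exact ⟨.typeEq_trans (.el_eq (.conv_eq e hs)) e', h'⟩
    · exact h0

end Checker.Sound

/-- The checker is sound, for every recursion depth. -/
theorem checker_sound (hS : S.Valid β) (n : ℕ) : (checker S n).Sound β := by
  induction n with
  | zero =>
    constructor
    · intro _ _ _ _ h; simp [checker] at h
    · intro _ _ _ _ _ h; simp [checker] at h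
    · intro _ _ _ _ _ h; simp [checker] at h
    · intro _ _ _ _ _ h; simp [checker] at h
    · intro _ _ _ h; simp [checker] at h
    · intro _ _ h; exact ⟨.typeEq_refl h, h⟩
  | succ n ih =>
    exact ⟨Checker.Sound.inferStep hS ih, Checker.Sound.redStep hS ih,
      Checker.Sound.convStep hS ih, Checker.Sound.convTStep ih, Checker.Sound.isTyStep ih,
      Checker.Sound.whnfTStep hS ih⟩

/-! ### Tables of constants -/

mutual
/-- Whether all constants that occur have a number less than `n`. -/
def Ex.bounded (n : ℕ) : Ex → Bool
  | .var _ => true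
  | .univ => true
  | .pi A B => A.bounded n && B.bounded n
  | .lam A b => A.bounded n && b.bounded n
  | .app f a => f.bounded n && a.bounded n
  | .sigma A B => A.bounded n && B.bounded n
  | .pair B a b => B.bounded n && a.bounded n && b.bounded n
  | .split E e c => E.bounded n && e.bounded n && c.bounded n
  | .id A a b => A.bounded n && a.bounded n && b.bounded n
  | .refl a => a.bounded n
  | .J E e a b p => E.bounded n && e.bounded n && a.bounded n && b.bounded n && p.bounded n
  | .funext f g α => f.bounded n && g.bounded n && α.bounded n
  | .cst c s => Nat.blt c n && s.bounded n

/-- Whether all constants that occur in the arguments have a number less than `n`. -/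
def Sp.bounded (n : ℕ) : Sp → Bool
  | .nil => true
  | .snoc s a => s.bounded n && a.bounded n
end

mutual
theorem Ex.toTm_congr {n : ℕ} {β β' : ℕ → Tm} (hβ : ∀ c < n, β c = β' c) :
    ∀ {e : Ex}, e.bounded n = true → e.toTm β = e.toTm β'
  | .var _, _ => rfl
  | .univ, _ => rfl
  | .pi A B, h => by
    simp only [Ex.bounded, Bool.and_eq_true] at h
    simp only [Ex.toTm, Ex.toTm_congr hβ h.1, Ex.toTm_congr hβ h.2]
  | .lam A B, h => by
    simp only [Ex.bounded, Bool.and_eq_true] at h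
    simp only [Ex.toTm, Ex.toTm_congr hβ h.1, Ex.toTm_congr hβ h.2]
  | .app A B, h => by
    simp only [Ex.bounded, Bool.and_eq_true] at h
    simp only [Ex.toTm, Ex.toTm_congr hβ h.1, Ex.toTm_congr hβ h.2]
  | .sigma A B, h => by
    simp only [Ex.bounded, Bool.and_eq_true] at h
    simp only [Ex.toTm, Ex.toTm_congr hβ h.1, Ex.toTm_congr hβ h.2]
  | .pair A B C, h => by
    simp only [Ex.bounded, Bool.and_eq_true] at h
    simp only [Ex.toTm, Ex.toTm_congr hβ h.1.1, Ex.toTm_congr hβ h.1.2, Ex.toTm_congr hβ h.2]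
  | .split A B C, h => by
    simp only [Ex.bounded, Bool.and_eq_true] at h
    simp only [Ex.toTm, Ex.toTm_congr hβ h.1.1, Ex.toTm_congr hβ h.1.2, Ex.toTm_congr hβ h.2]
  | .id A B C, h => by
    simp only [Ex.bounded, Bool.and_eq_true] at h
    simp only [Ex.toTm, Ex.toTm_congr hβ h.1.1, Ex.toTm_congr hβ h.1.2, Ex.toTm_congr hβ h.2]
  | .refl A, h => by
    simp only [Ex.bounded] at h
    simp only [Ex.toTm, Ex.toTm_congr hβ h]
  | .J A B C D E, h => by
    simp only [Ex.bounded, Bool.and_eq_true] at h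
    simp only [Ex.toTm, Ex.toTm_congr hβ h.1.1.1.1, Ex.toTm_congr hβ h.1.1.1.2,
      Ex.toTm_congr hβ h.1.1.2, Ex.toTm_congr hβ h.1.2, Ex.toTm_congr hβ h.2]
  | .funext A B C, h => by
    simp only [Ex.bounded, Bool.and_eq_true] at h
    simp only [Ex.toTm, Ex.toTm_congr hβ h.1.1, Ex.toTm_congr hβ h.1.2, Ex.toTm_congr hβ h.2]
  | .cst c s, h => by
    simp only [Ex.bounded, Bool.and_eq_true, Nat.blt_eq] at h
    simp only [Ex.toTm, hβ c h.1, Sp.toTm_congr hβ h.2]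

theorem Sp.toTm_congr {n : ℕ} {β β' : ℕ → Tm} (hβ : ∀ c < n, β c = β' c) :
    ∀ {s : Sp}, s.bounded n = true → s.toTm β = s.toTm β'
  | .nil, _ => rfl
  | .snoc s a, h => by
    simp only [Sp.bounded, Bool.and_eq_true] at h
    simp only [Sp.toTm, Sp.toTm_congr hβ h.1, Ex.toTm_congr hβ h.2]
end

/-- The first `n` constants of a list. -/
def sigOf (l : List Entry) (n : ℕ) : Sig := fun c => bif Nat.blt c n then l[c]? else none

/-- The values of the first `n` constants of a list, as terms of `H`. -/
def values (l : List Entry) : ℕ → ℕ → Tm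
  | 0 => fun _ => .univ
  | n + 1 => fun c => bif Nat.beq c n then
      (match l[n]? with
        | some en => en.val.toTm (values l n)
        | none => .univ)
      else values l n c

/-- Whether a list consists of types, each over the variables of `Γ` and the types before it. -/
noncomputable def checkTele (F : Checker) : List Ex → List Ex → Bool
  | _, [] => true
  | Γ, P :: Ps => F.isTy Γ P && checkTele F (P :: Γ) Ps

/-- Whether the value of a constant has the declared type. -/
noncomputable def Entry.ok (F : Checker) (en : Entry) : Bool :=
  checkTele F [] en.tele && F.isTy en.tele.reverse en.res &&
    F.check en.tele.reverse en.val en.res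

/-- Whether constant number `n` is correct, given the ones before. The recursion depth of the
checker is an arbitrary bound that is large enough. -/
noncomputable def entryOk (l : List Entry) (n : ℕ) : Bool :=
  match l[n]? with
  | some en => en.val.bounded n && en.ok (checker (sigOf l n) 1000)
  | none => false

theorem checkTele_sound {β : ℕ → Tm} {F : Checker} (hF : F.Sound β) :
    ∀ (Ps Γ : List Ex), Derivable (ctxTm β Γ) ctx → checkTele F Γ Ps = true →
      Derivable (ctxTm β (Ps.reverse ++ Γ)) ctx
  | [], _, hΓ, _ => hΓ
  | P :: Ps, Γ, hΓ, h => by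
    rw [checkTele, Bool.and_eq_true] at h
    have := checkTele_sound hF Ps (P :: Γ) (.cons (hF.isTy hΓ h.1)) h.2
    simpa using this

theorem values_eq_of_lt (l : List Entry) {c n m : ℕ} (hn : c < n) (hm : n ≤ m) :
    values l m c = values l n c := by
  induction m, hm using Nat.le_induction with
  | base => rfl
  | succ m hm ih =>
    have : Nat.beq c m = false := by
      rw [Bool.eq_false_iff, ne_eq, Nat.beq_eq]; omega
    simp only [values, this, cond_false, ih]

theorem values_eq {l : List Entry} (h : ∀ n < l.length, entryOk l n = true) {c : ℕ} {en : Entry}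
    (hc : l[c]? = some en) : values l l.length c = en.val.toTm (values l l.length) := by
  have hlt := (List.getElem?_eq_some_iff.1 hc).1
  have hok := h c hlt
  simp only [entryOk, hc, Bool.and_eq_true] at hok
  have : Nat.beq c c = true := by simp
  rw [values_eq_of_lt l (Nat.lt_succ_self c) hlt]
  simp only [values, this, cond_true, hc]
  refine Ex.toTm_congr (n := c) (fun k hk => ?_) hok.1
  exact (values_eq_of_lt l hk hlt.le).symm

/-- If all constants of a list pass the test, then their values have the declared types: by induction
on the length, since each constant is checked against the ones before it. -/
theorem sigOf_valid {l : List Entry} (h : ∀ n < l.length, entryOk l n = true) :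
    ∀ n ≤ l.length, (sigOf l n).Valid (values l l.length)
  | 0, _ => by
    intro c en hc
    have : Nat.blt c 0 = false := by rw [Bool.eq_false_iff, ne_eq, Nat.blt_eq]; omega
    simp [sigOf, this] at hc
  | n + 1, hn => by
    have hS := sigOf_valid h n (by omega)
    intro c en hc
    rw [sigOf] at hc
    rcases Nat.lt_succ_iff_lt_or_eq.1 (show c < n + 1 by
      by_contra hlt
      have : Nat.blt c (n + 1) = false := by rw [Bool.eq_false_iff, ne_eq, Nat.blt_eq]; exact hlt
      simp [this] at hc) with hlt | rfl
    · refine hS c en ?_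
      have h1 : Nat.blt c (n + 1) = true := by rw [Nat.blt_eq]; omega
      have h2 : Nat.blt c n = true := by rw [Nat.blt_eq]; exact hlt
      rw [h1] at hc
      rw [sigOf, h2]; exact hc
    · have h1 : Nat.blt c (c + 1) = true := by rw [Nat.blt_eq]; omega
      rw [h1, cond_true] at hc
      have hv := values_eq h hc
      have hok := h c hn
      simp only [entryOk, hc, Bool.and_eq_true, Entry.ok] at hok
      obtain ⟨-, ⟨h2, h3⟩, h4⟩ := hok
      have hF := checker_sound hS 1000
      have hΓ := checkTele_sound hF _ [] .nil h2
      rw [List.append_nil] at hΓ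
      have hT := hF.isTy hΓ h3
      exact ⟨hT, hv ▸ hF.check hT h4, hv⟩

/-! ### Higher-order abstract syntax -/

/-- An expression that may be placed under any number of binders: the argument is the number of
variables in scope. Binders are written as functions. -/
abbrev HEx := ℕ → Ex

namespace HEx

/-- The variable that is number `i` when counted from the outside. In a scope of `d` variables this is
the de Bruijn index `d - (i + 1)`, so `par d` is the variable bound in the scope of `d` variables. -/
def par (i : ℕ) : HEx := fun d => .var (d - (i + 1))

def univ : HEx := fun _ => .univ

def pi (A : HEx) (B : HEx → HEx) : HEx := fun d => .pi (A d) (B (par d) (d + 1))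

def lam (A : HEx) (b : HEx → HEx) : HEx := fun d => .lam (A d) (b (par d) (d + 1))

def app (f a : HEx) : HEx := fun d => .app (f d) (a d)

def sigma (A : HEx) (B : HEx → HEx) : HEx := fun d => .sigma (A d) (B (par d) (d + 1))

def pair (B : HEx → HEx) (a b : HEx) : HEx := fun d => .pair (B (par d) (d + 1)) (a d) (b d)

def split (E : HEx → HEx) (e : HEx → HEx → HEx) (c : HEx) : HEx := fun d =>
  .split (E (par d) (d + 1)) (e (par d) (par (d + 1)) (d + 2)) (c d)

def id (A a b : HEx) : HEx := fun d => .id (A d) (a d) (b d)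

def refl (a : HEx) : HEx := fun d => .refl (a d)

def J (E : HEx → HEx → HEx → HEx) (e : HEx → HEx) (a b p : HEx) : HEx := fun d =>
  .J (E (par d) (par (d + 1)) (par (d + 2)) (d + 3)) (e (par d) (d + 1)) (a d) (b d) (p d)

def funext (f g : HEx) (α : HEx → HEx) : HEx := fun d => .funext (f d) (g d) (α (par d) (d + 1))

/-- The constant number `c`, applied to a list of arguments. -/
def cst (c : ℕ) (l : List HEx) : HEx := fun d => .cst c (l.foldl (fun s a => .snoc s (a d)) .nil)

/-- Expressions placed in the scope of `d`, `d + 1`, … variables. -/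
def tele : ℕ → List HEx → List Ex
  | _, [] => []
  | d, P :: Ps => P d :: tele (d + 1) Ps

end HEx

/-- A constant that may be unfolded. -/
def Entry.define (tele : List HEx) (res val : HEx) : Entry :=
  ⟨HEx.tele 0 tele, res tele.length, val tele.length, true⟩

/-- A constant that is never unfolded. -/
def Entry.lemma (tele : List HEx) (res val : HEx) : Entry :=
  ⟨HEx.tele 0 tele, res tele.length, val tele.length, false⟩

end TTH

namespace TTH

/-!
### The definitions of `H` as constants

The number `k` in `cst k` is a position in the list of constants that begins with `definitions`. For
a constant `foo`, the function `foo` of this namespace applies it to arguments, and its value over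
the parameters is `fooVal` or is written out in the list.
-/

namespace HEx

def arrow (X Y : HEx) : HEx := pi X fun _ => Y

def prod (X Y : HEx) : HEx := sigma X fun _ => Y

def idFun (X : HEx) : HEx := lam X fun x => x

/-- The composite `g ∘ f` of functions, where `X` is the domain of `f`. -/
def comp (X g f : HEx) : HEx := lam X fun x => g.app (f.app x)

/-- The first component of `c : (Σ x : A) B(x)`. -/
def fst (A c : HEx) : HEx := split (fun _ => A) (fun x _ => x) c

/-- The second component of `c : (Σ x : A) B(x)`. -/
def snd (A : HEx) (B : HEx → HEx) (c : HEx) : HEx :=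
  split (fun z => B (fst A z)) (fun _ y => y) c

def isContr (X : HEx) : HEx := sigma X fun x => pi X fun y => id X x y

/-- The homotopy fiber of `f : X → Y` over `y`. -/
def hfiber (X Y f y : HEx) : HEx := sigma X fun x => id Y (f.app x) y

def isEquiv (X Y f : HEx) : HEx := pi Y fun y => isContr (hfiber X Y f y)

def equiv (X Y : HEx) : HEx := sigma (arrow X Y) fun f => isEquiv X Y f

/-- The element of the fiber of the identity function over `y` given by `x` and `q : Id(x, y)`. -/
def fiberPt (X x y q : HEx) : HEx := pair (fun z => id X ((idFun X).app z) y) x q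

/-- The identity function is an equivalence. -/
def idIsEquivVal (X : HEx) : HEx :=
  lam X fun y =>
    pair (fun c => pi (hfiber X X (idFun X) y) fun z => id (hfiber X X (idFun X) y) c z)
      (fiberPt X y y (refl y))
      (lam (hfiber X X (idFun X) y) fun z =>
        split (fun z => id (hfiber X X (idFun X) y) (fiberPt X y y (refl y)) z)
          (fun x q => J
            (fun a b p => id (hfiber X X (idFun X) b) (fiberPt X b b (refl b)) (fiberPt X a b p))
            (fun x => refl (fiberPt X x x (refl x))) x y q)
          z)

def idIsEquiv (X : HEx) : HEx := cst 0 [X]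

/-- The canonical function from paths between types to equivalences. -/
def extUVal (X Y : HEx) : HEx :=
  lam (id univ X Y) fun p =>
    J (fun x y _ => equiv x y) (fun x => pair (isEquiv x x) (idFun x) (idIsEquiv x)) X Y p

def extU (X Y : HEx) : HEx := cst 1 [X, Y]

def univalence : HEx :=
  pi univ fun X => pi univ fun Y => isEquiv (id univ X Y) (equiv X Y) (extU X Y)

/-- The inverse path `p⁻¹`, for a type `X` that need not be in `U`, unlike in `pathInv`. -/
def pathInvVal (X a b p : HEx) : HEx := J (fun x y _ => id X y x) (fun x => refl x) a b p

def pathInv (X a b p : HEx) : HEx := cst 2 [X, a, b, p]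

/-- The composite path `q · p` of `p : Id(a, b)` and `q : Id(b, c)`, for a type `X` that need not be
in `U`, unlike in `pathComp`. -/
def pathCompVal (X a b c q p : HEx) : HEx :=
  (J (fun x y _ => arrow (id X y c) (id X x c)) (fun x => lam (id X x c) fun q => q) a b p).app q

def pathComp (X a b c q p : HEx) : HEx := cst 3 [X, a, b, c, q, p]

def whiskerLVal (X Z g u v p : HEx) : HEx :=
  J (fun x y _ => id (arrow X Z) (comp X g x) (comp X g y)) (fun x => refl (comp X g x)) u v p

/-- `g ∘ p` for `g : Y → Z` and a path `p` between `u, v : X → Y`. -/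
def whiskerL (X Y Z g u v p : HEx) : HEx := cst 4 [X, Y, Z, g, u, v, p]

def whiskerRVal (X Z f u v p : HEx) : HEx :=
  J (fun x y _ => id (arrow X Z) (comp X x f) (comp X y f)) (fun x => refl (comp X x f)) u v p

/-- `p ∘ f` for `f : X → Y` and a path `p` between `u, v : Y → Z`. -/
def whiskerR (X Y Z f u v p : HEx) : HEx := cst 5 [X, Y, Z, f, u, v, p]

/-- The path `Id(f, g)` given by a homotopy `α`, normalized so that the constant homotopy gives
`refl(f)` up to a path: this holds for `funext` only after composing with an inverse. -/
def integral (X Y f g : HEx) (α : HEx → HEx) : HEx :=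
  pathComp (arrow X Y) f f g (funext f g α)
    (pathInv (arrow X Y) f f (funext f f fun x => refl (f.app x)))

/-- The family `B(x) → X` of `x : A`, whose total space is `P X`. -/
def polyFam (B X : HEx) (x : HEx) : HEx := arrow (B.app x) X

def poly (A B X : HEx) : HEx := cst 6 [A, B, X]

/-- The action `P f` of `P` on a function `f`. -/
def polyMapVal (A B X Y f : HEx) : HEx :=
  lam (poly A B X) fun z =>
    split (fun _ => poly A B Y) (fun x u => pair (polyFam B Y) x (comp (B.app x) f u)) z

def polyMap (A B X Y f : HEx) : HEx := cst 7 [A, B, X, Y, f]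

/-- The path between `P(g ∘ f)` and `P g ∘ P f`. -/
def polyPhiVal (A B X Y Z f g : HEx) : HEx :=
  integral (poly A B X) (poly A B Z) (polyMap A B X Z (comp X g f))
    (comp (poly A B X) (polyMap A B Y Z g) (polyMap A B X Y f))
    (fun z => split
      (fun z => id (poly A B Z) ((polyMap A B X Z (comp X g f)).app z)
        ((comp (poly A B X) (polyMap A B Y Z g) (polyMap A B X Y f)).app z))
      (fun x u => refl (pair (polyFam B Z) x (comp (B.app x) (comp X g f) u))) z)

def polyPhi (A B X Y Z f g : HEx) : HEx := cst 8 [A, B, X, Y, Z, f, g]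

/-- The type `P X → X` of structure maps on `X`. -/
def strFam (A B X : HEx) : HEx := arrow (poly A B X) X

def alg (A B : HEx) : HEx := sigma univ (strFam A B)

def carrier (A B C : HEx) : HEx := cst 9 [A, B, C]

def str (A B C : HEx) : HEx := cst 10 [A, B, C]

/-- The type of paths between `f ∘ sup` and `sup ∘ P f`. -/
def isAlgHomVal (A B C D f : HEx) : HEx :=
  id (arrow (poly A B (carrier A B C)) (carrier A B D))
    (comp (poly A B (carrier A B C)) f (str A B C))
    (comp (poly A B (carrier A B C)) (str A B D) (polyMap A B (carrier A B C) (carrier A B D) f))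

def isAlgHom (A B C D f : HEx) : HEx := cst 11 [A, B, C, D, f]

def algHom (A B C D : HEx) : HEx := cst 12 [A, B, C, D]

def homFun (A B C D f : HEx) : HEx := cst 13 [A, B, C, D, f]

def homPath (A B C D f : HEx) : HEx := cst 14 [A, B, C, D, f]

/-- The path of the identity morphism, given by `refl` at canonical pairs. -/
def algIdPathVal (A B C : HEx) : HEx :=
  let X := carrier A B C
  let l := comp (poly A B X) (idFun X) (str A B C)
  let r := comp (poly A B X) (str A B C) (polyMap A B X X (idFun X))
  integral (poly A B X) X l r fun z =>
    split (fun z => id X (l.app z) (r.app z))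
      (fun x u => refl ((str A B C).app (pair (polyFam B X) x u))) z

def algIdPath (A B C : HEx) : HEx := cst 15 [A, B, C]

def algId (A B C : HEx) : HEx := cst 16 [A, B, C]

/-- The path of a composite of morphisms. -/
def algCompPathVal (A B C D E g f : HEx) : HEx :=
  let X := carrier A B C
  let Y := carrier A B D
  let Z := carrier A B E
  let PX := poly A B X
  let PY := poly A B Y
  let PZ := poly A B Z
  let f₀ := homFun A B C D f
  let g₀ := homFun A B D E g
  let Pf := polyMap A B X Y f₀
  let Pg := polyMap A B Y Z g₀
  let gf := comp X g₀ f₀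
  let Pgf := polyMap A B X Z gf
  let s₀ := comp PX g₀ (comp PX f₀ (str A B C))
  let s₁ := comp PX g₀ (comp PX (str A B D) Pf)
  let s₂ := comp PX (str A B E) (comp PX Pg Pf)
  let s₃ := comp PX (str A B E) Pgf
  let p₁ := whiskerL PX Y Z g₀ (comp PX f₀ (str A B C)) (comp PX (str A B D) Pf)
    (homPath A B C D f)
  let p₂ := whiskerR PX PY Z Pf (comp PY g₀ (str A B D)) (comp PY (str A B E) Pg)
    (homPath A B D E g)
  let p₃ := whiskerL PX PZ Z (str A B E) (comp PX Pg Pf) Pgf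
    (pathInv (arrow PX PZ) Pgf (comp PX Pg Pf) (polyPhi A B X Y Z f₀ g₀))
  pathComp (arrow PX Z) s₀ s₂ s₃ p₃ (pathComp (arrow PX Z) s₀ s₁ s₂ p₂ p₁)

def algCompPath (A B C D E g f : HEx) : HEx := cst 17 [A, B, C, D, E, g, f]

def algComp (A B C D E g f : HEx) : HEx := cst 18 [A, B, C, D, E, g, f]

/-- The type of left inverses of `f : Alg(C, D)`. -/
def algLeftInv (A B C D f : HEx) : HEx :=
  sigma (algHom A B D C) fun g => id (algHom A B C C) (algComp A B C D C g f) (algId A B C)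

/-- The type of right inverses of `f : Alg(C, D)`. -/
def algRightInv (A B C D f : HEx) : HEx :=
  sigma (algHom A B D C) fun h => id (algHom A B D D) (algComp A B D C D f h) (algId A B D)

def isAlgEquiv (A B C D f : HEx) : HEx := cst 19 [A, B, C, D, f]

def algEquiv (A B C D : HEx) : HEx := cst 20 [A, B, C, D]

def idIsAlgEquiv (A B : HEx) : HEx := pi (alg A B) fun C => isAlgEquiv A B C C (algId A B C)

/-- The canonical function from paths between algebras to algebra equivalences. -/
def extAlgVal (A B ι C D : HEx) : HEx :=
  lam (id (alg A B) C D) fun p =>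
    J (fun x y _ => algEquiv A B x y)
      (fun x => pair (fun f => isAlgEquiv A B x x f) (algId A B x) (ι.app x)) C D p

def extAlg (A B ι C D : HEx) : HEx := cst 21 [A, B, ι, C, D]

/-- The statement that identity morphisms are algebra equivalences. -/
def idEquivType : HEx := pi univ fun A => pi (arrow A univ) fun B => idIsAlgEquiv A B

/-- The statement that the canonical function from paths to algebra equivalences is an equivalence. -/
def algUnivalence : HEx :=
  pi univ fun A => pi (arrow A univ) fun B => pi (idIsAlgEquiv A B) fun ι =>
    pi (alg A B) fun C => pi (alg A B) fun D =>
      isEquiv (id (alg A B) C D) (algEquiv A B C D) (extAlg A B ι C D)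

/-- The definitions of `H` that occur in the statement of the theorem. -/
def definitions : List Entry :=
  -- Parameters are numbered from the outside.
  let v := par
  let U := univ
  let algP : List HEx := [U, arrow (v 0) U]
  let alg₁ := algP ++ [alg (v 0) (v 1)]
  let alg₂ := alg₁ ++ [alg (v 0) (v 1)]
  let hom := alg₂ ++ [algHom (v 0) (v 1) (v 2) (v 3)]
  let hom₂ := alg₂ ++ [alg (v 0) (v 1), algHom (v 0) (v 1) (v 3) (v 4),
    algHom (v 0) (v 1) (v 2) (v 3)]
  let CA := carrier (v 0) (v 1)
  [ .define [U] (isEquiv (v 0) (v 0) (idFun (v 0))) (idIsEquivVal (v 0)),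
    .define [U, U] (arrow (id U (v 0) (v 1)) (equiv (v 0) (v 1))) (extUVal (v 0) (v 1)),
    .define [U, v 0, v 0, id (v 0) (v 1) (v 2)] (id (v 0) (v 2) (v 1))
      (pathInvVal (v 0) (v 1) (v 2) (v 3)),
    .define [U, v 0, v 0, v 0, id (v 0) (v 2) (v 3), id (v 0) (v 1) (v 2)] (id (v 0) (v 1) (v 3))
      (pathCompVal (v 0) (v 1) (v 2) (v 3) (v 4) (v 5)),
    .define [U, U, U, arrow (v 1) (v 2), arrow (v 0) (v 1), arrow (v 0) (v 1),
        id (arrow (v 0) (v 1)) (v 4) (v 5)]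
      (id (arrow (v 0) (v 2)) (comp (v 0) (v 3) (v 4)) (comp (v 0) (v 3) (v 5)))
      (whiskerLVal (v 0) (v 2) (v 3) (v 4) (v 5) (v 6)),
    .define [U, U, U, arrow (v 0) (v 1), arrow (v 1) (v 2), arrow (v 1) (v 2),
        id (arrow (v 1) (v 2)) (v 4) (v 5)]
      (id (arrow (v 0) (v 2)) (comp (v 0) (v 4) (v 3)) (comp (v 0) (v 5) (v 3)))
      (whiskerRVal (v 0) (v 2) (v 3) (v 4) (v 5) (v 6)),
    .define (algP ++ [U]) U (sigma (v 0) (polyFam (v 1) (v 2))),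
    .define (algP ++ [U, U, arrow (v 2) (v 3)])
      (arrow (poly (v 0) (v 1) (v 2)) (poly (v 0) (v 1) (v 3)))
      (polyMapVal (v 0) (v 1) (v 2) (v 3) (v 4)),
    .define (algP ++ [U, U, U, arrow (v 2) (v 3), arrow (v 3) (v 4)])
      (id (arrow (poly (v 0) (v 1) (v 2)) (poly (v 0) (v 1) (v 4)))
        (polyMap (v 0) (v 1) (v 2) (v 4) (comp (v 2) (v 6) (v 5)))
        (comp (poly (v 0) (v 1) (v 2)) (polyMap (v 0) (v 1) (v 3) (v 4) (v 6))
          (polyMap (v 0) (v 1) (v 2) (v 3) (v 5))))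
      (polyPhiVal (v 0) (v 1) (v 2) (v 3) (v 4) (v 5) (v 6)),
    .define alg₁ U (fst U (v 2)),
    .define alg₁ (strFam (v 0) (v 1) (CA (v 2))) (snd U (strFam (v 0) (v 1)) (v 2)),
    .define (alg₂ ++ [arrow (CA (v 2)) (CA (v 3))]) U (isAlgHomVal (v 0) (v 1) (v 2) (v 3) (v 4)),
    .define alg₂ U (sigma (arrow (CA (v 2)) (CA (v 3))) (isAlgHom (v 0) (v 1) (v 2) (v 3))),
    .define hom (arrow (CA (v 2)) (CA (v 3))) (fst (arrow (CA (v 2)) (CA (v 3))) (v 4)),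
    .define hom (isAlgHom (v 0) (v 1) (v 2) (v 3) (homFun (v 0) (v 1) (v 2) (v 3) (v 4)))
      (snd (arrow (CA (v 2)) (CA (v 3))) (isAlgHom (v 0) (v 1) (v 2) (v 3)) (v 4)),
    .define alg₁ (isAlgHom (v 0) (v 1) (v 2) (v 2) (idFun (CA (v 2))))
      (algIdPathVal (v 0) (v 1) (v 2)),
    .define alg₁ (algHom (v 0) (v 1) (v 2) (v 2))
      (pair (isAlgHom (v 0) (v 1) (v 2) (v 2)) (idFun (CA (v 2))) (algIdPath (v 0) (v 1) (v 2))),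
    .define hom₂
      (isAlgHom (v 0) (v 1) (v 2) (v 4) (comp (CA (v 2)) (homFun (v 0) (v 1) (v 3) (v 4) (v 5))
        (homFun (v 0) (v 1) (v 2) (v 3) (v 6))))
      (algCompPathVal (v 0) (v 1) (v 2) (v 3) (v 4) (v 5) (v 6)),
    .define hom₂ (algHom (v 0) (v 1) (v 2) (v 4))
      (pair (isAlgHom (v 0) (v 1) (v 2) (v 4))
        (comp (CA (v 2)) (homFun (v 0) (v 1) (v 3) (v 4) (v 5))
          (homFun (v 0) (v 1) (v 2) (v 3) (v 6)))
        (algCompPath (v 0) (v 1) (v 2) (v 3) (v 4) (v 5) (v 6))),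
    .define hom U (prod (algLeftInv (v 0) (v 1) (v 2) (v 3) (v 4))
      (algRightInv (v 0) (v 1) (v 2) (v 3) (v 4))),
    .define alg₂ U (sigma (algHom (v 0) (v 1) (v 2) (v 3)) (isAlgEquiv (v 0) (v 1) (v 2) (v 3))),
    .define (algP ++ [idIsAlgEquiv (v 0) (v 1), alg (v 0) (v 1), alg (v 0) (v 1)])
      (arrow (id (alg (v 0) (v 1)) (v 3) (v 4)) (algEquiv (v 0) (v 1) (v 3) (v 4)))
      (extAlgVal (v 0) (v 1) (v 2) (v 3) (v 4)) ]

/-!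
### Paths and contractible types in `H`

From here on, `fooEntry` is the constant that proves a lemma of type theory, as an entry of the
table, and `foo` applies this constant to arguments. Lemmas are never unfolded by the checker.
-/

/-- `M(b)` from `m : M(a)` along `p : Id(a, b)`. -/
def transport (M : HEx → HEx) (a b p m : HEx) : HEx :=
  (J (fun x y _ => arrow (M x) (M y)) (fun x => lam (M x) fun m => m) a b p).app m

/-- The path `Id(g(a), g(b))` in `Y` from `p : Id(a, b)`. -/
def mapPath (Y : HEx) (g : HEx → HEx) (a b p : HEx) : HEx :=
  J (fun x y _ => id Y (g x) (g y)) (fun x => refl (g x)) a b p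

/-- The statement that `p · p⁻¹` is `refl(b)` up to a path. -/
def compInvType (X a b p : HEx) : HEx :=
  id (id X b b) (pathCompVal X b a b p (pathInvVal X a b p)) (refl b)

/-- The proof of `compInvType`, for a type `X` that need not be in `U`. -/
def compInvVal (X a b p : HEx) : HEx :=
  J (fun a b p => compInvType X a b p) (fun x => refl (refl x)) a b p

def compInv (X a b p : HEx) : HEx := cst 22 [X, a, b, p]

def compInvEntry : Entry :=
  let X := par 0; let a := par 1; let b := par 2; let p := par 3
  .lemma [univ, X, X, id X a b]
    (id (id X b b) (pathComp X b a b p (pathInv X a b p)) (refl b)) (compInvVal X a b p)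

/-- The element of the total space of the family `Id(x, y)` of `y`. -/
def singlPair (X x y p : HEx) : HEx := pair (fun y => id X x y) y p

def singl (X x y p : HEx) : HEx := cst 23 [X, x, y, p]

/-- All elements of the total space of the family `Id(x, y)` of `y` are equal to `refl(x)`. -/
def singlEntry : Entry :=
  let X := par 0; let x := par 1; let y := par 2; let p := par 3
  .lemma [univ, X, X, id X x y]
    (id (sigma X fun y => id X x y) (singlPair X x x (refl x)) (singlPair X x y p))
    (J (fun x y p => id (sigma X fun y => id X x y) (singlPair X x x (refl x)) (singlPair X x y p))
      (fun x => refl (singlPair X x x (refl x))) x y p)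

/-- The type of homotopies `Id(f(w), g(w))`. -/
def htpy (W : HEx) (F f g : HEx → HEx) : HEx := pi W fun w => id (F w) (f w) (g w)

def htpyInd (W F f M d g h : HEx) : HEx := cst 24 [W, F, f, M, d, g, h]

/-- Induction on homotopies: it suffices to treat the constant homotopy `refl(f(w))`. The pairs
`(g(w), h(w))` are functions of `w` into contractible types, so `funext` gives a path from the pairs
`(f(w), refl(f(w)))`, and the motive is transported along it. -/
def htpyIndEntry : Entry :=
  let W := par 0; let F := par 1; let f := par 2; let M := par 3
  let d := par 4; let g := par 5; let h := par 6
  let pt (g h : HEx) : HEx :=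
    lam W fun w => singlPair (F.app w) (f.app w) (g.app w) (h.app w)
  let reflf : HEx := lam W fun w => refl (f.app w)
  .lemma [univ, arrow W univ, pi W fun w => F.app w,
      pi (pi W fun w => F.app w) fun g => arrow (htpy W F.app f.app g.app) univ,
      (M.app f).app reflf, pi W fun w => F.app w, htpy W F.app f.app g.app]
    ((M.app g).app h)
    (transport (fun φ => (M.app (lam W fun w => fst (F.app w) (φ.app w))).app
        (lam W fun w => snd (F.app w) (fun y => id (F.app w) (f.app w) y) (φ.app w)))
      (pt f reflf) (pt g h)
      (funext (pt f reflf) (pt g h) fun w => singl (F.app w) (f.app w) (g.app w) (h.app w)) d)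

def contrProp (X c a b : HEx) : HEx := cst 25 [X, c, a, b]

/-- Two elements of a contractible type are equal. -/
def contrPropEntry : Entry :=
  let X := par 0; let c := par 1; let a := par 2; let b := par 3
  .lemma [univ, isContr X, X, X] (id X a b)
    (split (fun _ => id X a b)
      (fun x h => pathComp X a x b (h.app b) (pathInv X x a (h.app a))) c)

def prodProp (X Y c d e e' : HEx) : HEx := cst 26 [X, Y, c, d, e, e']

/-- Two elements of a product of contractible types are equal. -/
def prodPropEntry : Entry :=
  let X := par 0; let Y := par 1; let c := par 2; let d := par 3; let e := par 4; let e' := par 5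
  let P := prod X Y
  let mk (a b : HEx) : HEx := pair (fun _ => Y) a b
  .lemma [univ, univ, isContr X, isContr Y, P, P] (id P e e')
    (split (fun e => id P e e') (fun a b => split (fun e' => id P (mk a b) e')
      (fun a' b' => pathComp P (mk a b) (mk a' b) (mk a' b')
        (mapPath P (fun b => mk a' b) b b' (contrProp Y d b b'))
        (mapPath P (fun a => mk a b) a a' (contrProp X c a a'))) e') e)

def fibContr (X m ε y : HEx) : HEx := cst 27 [X, m, ε, y]

/-- The fibers of a function that is homotopic to the identity are contractible. -/
def fibContrEntry : Entry :=
  let X := par 0; let m := par 1; let ε := par 2; let y := par 3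
  .lemma [univ, arrow X X, pi X fun x => id X (m.app x) x, X] (isContr (hfiber X X m y))
    (transport (fun m => isContr (hfiber X X m y)) (idFun X) m
      (pathInv (arrow X X) m (idFun X) (funext m (idFun X) fun x => ε.app x))
      ((idIsEquiv X).app y))

/-- The fiber `(Σ x : X) Id(y, m(x))`, with the path reversed. -/
def cofiber (X m y : HEx) : HEx := sigma X fun x => id X y (m.app x)

def cofibContr (X m ε y : HEx) : HEx := cst 28 [X, m, ε, y]

/-- The analogue of `fibContrEntry` for fibers with the path reversed. -/
def cofibContrEntry : Entry :=
  let X := par 0; let m := par 1; let ε := par 2; let y := par 3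
  let T := sigma X fun x => id X y x
  let c := singlPair X y y (refl y)
  .lemma [univ, arrow X X, pi X fun x => id X (m.app x) x, X] (isContr (cofiber X m y))
    (transport (fun m => isContr (cofiber X m y)) (idFun X) m
      (pathInv (arrow X X) m (idFun X) (funext m (idFun X) fun x => ε.app x))
      (pair (fun c => pi T fun z => id T c z) c
        (lam T fun z => split (fun z => id T c z) (fun x q => singl X y x q) z)))

/-- A function `f : X → Y` with a left inverse `g` and a right inverse `h` is an equivalence. Here
`Y : U`, but `X` need not be in `U`. There is a homotopy from `h ∘ f` to the identity, so the fibers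
of `f` are retracts of those of `f ∘ h`, and these are contractible since `f ∘ h` is homotopic to the
identity. -/
def biinvEquivVal (X Y f : HEx) (g h α β : HEx → HEx) : HEx :=
  let fib (y : HEx) : HEx := hfiber X Y f y
  let mk (y x q : HEx) : HEx := pair (fun x => id Y (f.app x) y) x q
  let hf : HEx := lam X fun x => h (f.app x)
  let fh : HEx := lam Y fun y => f.app (h y)
  let η : HEx → HEx := fun x =>
    let x₁ := h (f.app x)
    let x₂ := g (f.app x₁)
    let x₃ := g (f.app x)
    pathCompVal X x₁ x₂ x
      (pathCompVal X x₂ x₃ x (α x) (mapPath X g (f.app x₁) (f.app x) (β (f.app x))))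
      (pathInvVal X x₂ x₁ (α x₁))
  lam Y fun y =>
    pair (fun c => pi (fib y) fun z => id (fib y) c z) (mk y (h y) (β y))
      (lam (fib y) fun z => split (fun z => id (fib y) (mk y (h y) (β y)) z)
        (fun x q =>
          split (fun _ => id (fib y) (mk y (h y) (β y)) (mk y x q))
            (fun q' r => pathCompVal (fib y) (mk y (h y) (β y)) (mk y (h (f.app x)) q') (mk y x q) r
              (mapPath (fib y)
                (fun z => mk y (h (fst Y z)) (snd Y (fun z => id Y (fh.app z) y) z))
                (pair (fun z => id Y (fh.app z) y) y (β y))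
                (pair (fun z => id Y (fh.app z) y) (f.app x) q')
                (contrProp (hfiber Y Y fh y) (fibContr Y fh (lam Y β) y)
                  (pair (fun z => id Y (fh.app z) y) y (β y))
                  (pair (fun z => id Y (fh.app z) y) (f.app x) q'))))
            (((J (fun k k' _ => pi X fun x => pi (id Y (f.app (k'.app x)) y) fun q =>
                sigma (id Y (f.app (k.app x)) y) fun q' =>
                  id (fib y) (mk y (k.app x) q') (mk y (k'.app x) q))
              (fun k => lam X fun x => lam (id Y (f.app (k.app x)) y) fun q =>
                pair (fun q' => id (fib y) (mk y (k.app x) q') (mk y (k.app x) q)) q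
                  (refl (mk y (k.app x) q)))
              hf (idFun X) (funext hf (idFun X) η)).app x).app q)) z)

def biinvEquiv (X Y f g h α β : HEx) : HEx := cst 29 [X, Y, f, g, h, α, β]

/-- The case of `biinvEquivVal` in which both types are in `U`. -/
def biinvEquivEntry : Entry :=
  let X := par 0; let Y := par 1; let f := par 2; let g := par 3; let h := par 4
  let α := par 5; let β := par 6
  .lemma [univ, univ, arrow X Y, arrow Y X, arrow Y X, pi X fun x => id X (g.app (f.app x)) x,
      pi Y fun y => id Y (f.app (h.app y)) y]
    (isEquiv X Y f) (biinvEquivVal X Y f g.app h.app α.app β.app)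

/-- The constants number 22 to 29. -/
def pathLemmas : List Entry := [compInvEntry, singlEntry, htpyIndEntry, contrPropEntry,
  prodPropEntry, fibContrEntry, cofibContrEntry, biinvEquivEntry]

/-!
### The unit laws for algebra morphisms

The unit laws are first proved for arbitrary functions in place of `P X` and the structure map. The
paths in a composite with the identity morphism then come from homotopies over a homotopy `β` from
`1_W` to `k`, where `W` is `P X` and `k` is `P(1_X)`; induction on homotopies makes all of them
constant, and what is left is the groupoid law for a path `p`.
-/

/-- The types of the data in both unit laws: a homotopy `β` from `1_W` to `k`, and functions `s, f,
q` with a path from `f ∘ s` to `s ∘ q`. -/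
def unitTele : List HEx :=
  let W := par 0; let X := par 1; let s := par 2; let k := par 3; let f := par 5; let q := par 6
  [univ, univ, arrow W X, arrow W W, pi W fun w => id W w (k.app w), arrow X X, arrow W W,
    id (arrow W X) (comp W f s) (comp W s q)]

/-- The path of the composite of a morphism `(f, p)` with the identity morphism on the right, where `a`
is the path of the identity morphism and `a'` the path from `P(f ∘ 1)` to `P f ∘ P 1`. -/
def runitSource (W X s k f q p : HEx) (a a' : HEx) : HEx :=
  let WX := arrow W X
  let qk := comp W q k
  let s₀ := comp W f s
  let s₁ := comp W f (comp W s k)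
  let s₂ := comp W s qk
  let s₃ := comp W s q
  let p₁ := whiskerL W X X f s (comp W s k) a
  let p₂ := whiskerR W W X k s₀ s₃ p
  let p₃ := whiskerL W W X s qk q (pathInv (arrow W W) q qk a')
  pathComp WX s₀ s₂ s₃ p₃ (pathComp WX s₀ s₁ s₂ p₂ p₁)

/-- The path of the composite of a morphism `(f, p)` with the identity morphism on the left, where `a`
is the path of the identity morphism and `a'` the path from `P(1 ∘ f)` to `P 1 ∘ P f`. -/
def lunitSource (W X s k f q p : HEx) (a a' : HEx) : HEx :=
  let WX := arrow W X
  let kq := comp W k q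
  let s₀ := comp W f s
  let s₁ := comp W s q
  let s₂ := comp W s kq
  let p₁ := whiskerL W X X (idFun X) s₀ s₁ p
  let p₂ := whiskerR W W X q s (comp W s k) a
  let p₃ := whiskerL W W X s kq q (pathInv (arrow W W) q kq a')
  pathComp WX s₀ s₂ s₁ p₃ (pathComp WX s₀ s₁ s₂ p₂ p₁)

def runitRefl (W X s f q p : HEx) : HEx := cst 30 [W, X, s, f, q, p]

/-- The right unit law for paths, when all paths but `p` are `refl`. -/
def runitReflEntry : Entry :=
  let W := par 0; let X := par 1; let s := par 2; let f := par 3; let q := par 4; let p := par 5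
  let u := comp W f s
  let v := comp W s q
  let WX := arrow W X
  .lemma [univ, univ, arrow W X, arrow X X, arrow W W, id WX u v]
    (id (id WX u v) (runitSource W X s (idFun W) f q p (refl s) (refl q)) p)
    (J (fun u v p => id (id WX u v) (pathComp WX u v v (refl v)
        (pathComp WX u u v (whiskerR W W X (idFun W) u v p) (refl u))) p)
      (fun u => refl (refl u)) u v p)

def lunitRefl (W X s f q p : HEx) : HEx := cst 31 [W, X, s, f, q, p]

/-- The left unit law for paths, when all paths but `p` are `refl`. -/
def lunitReflEntry : Entry :=
  let W := par 0; let X := par 1; let s := par 2; let f := par 3; let q := par 4; let p := par 5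
  let u := comp W f s
  let v := comp W s q
  let WX := arrow W X
  .lemma [univ, univ, arrow W X, arrow X X, arrow W W, id WX u v]
    (id (id WX u v) (lunitSource W X s (idFun W) f q p (refl s) (refl q)) p)
    (J (fun u v p => id (id WX u v) (pathComp WX u v v (refl v)
        (pathComp WX u v v (refl v) (whiskerL W X X (idFun X) u v p))) p)
      (fun u => refl (refl u)) u v p)

/-- The statement that `M(α)` holds for all homotopies `α` between `f` and `g` that agree with the
homotopy `b`. -/
def unitHtpy (W X f g : HEx) (b : HEx → HEx) (M : (HEx → HEx) → HEx) : HEx :=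
  pi (htpy W (fun _ => X) f.app g.app) fun α =>
    pi (pi W fun w => id (id X (f.app w) (g.app w)) (b w) (α.app w)) fun _ => M α.app

/-- The right unit law for paths that are given by homotopies `α` and `α'`, both determined by `β`. -/
def runitStep (W X s k : HEx) (β : HEx → HEx) (f q p : HEx) : HEx :=
  let src := runitSource W X s k f q p
  unitHtpy W X s (comp W s k) (fun w => mapPath X s.app w (k.app w) (β w)) fun α =>
  unitHtpy W W q (comp W q k) (fun w => mapPath W q.app w (k.app w) (β w)) fun α' =>
    id (id (arrow W X) (comp W f s) (comp W s q))
      (src (integral W X s (comp W s k) α) (integral W W q (comp W q k) α')) p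

/-- The proof of a statement `M` about two homotopies `α` and `α'` that agree with constant
homotopies, from the case of `refl` paths. -/
def unitStepVal (W X s q : HEx) (M : HEx → HEx → HEx) (d : HEx) : HEx :=
  let int (Y f : HEx) : HEx := integral W Y f f fun w => refl (f.app w)
  let cinv (Y f : HEx) : HEx := compInv (arrow W Y) f f (funext f f fun w => refl (f.app w))
  let fromRefl (Y f : HEx) (N : HEx → HEx) (d : HEx) : HEx :=
    transport N (refl f) (int Y f)
      (pathInv (id (arrow W Y) f f) (int Y f) (refl f) (cinv Y f)) d
  let R (Y f : HEx) : HEx := lam W fun w => id Y (f.app w) (f.app w)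
  let ind (Y f : HEx) (N : HEx → HEx) (d α γ : HEx) : HEx :=
    htpyInd W (R Y f) (lam W fun w => refl (f.app w))
      (lam (htpy W (fun _ => Y) f.app f.app) fun α =>
        lam (pi W fun w => id (id Y (f.app w) (f.app w)) (refl (f.app w)) (α.app w)) fun _ =>
          N (integral W Y f f α.app)) (fromRefl Y f N d) α γ
  let hyp (Y f α : HEx) : HEx :=
    pi W fun w => id (id Y (f.app w) (f.app w)) (refl (f.app w)) (α.app w)
  lam (htpy W (fun _ => X) s.app s.app) fun α => lam (hyp X s α) fun γ =>
    lam (htpy W (fun _ => W) q.app q.app) fun α' => lam (hyp W q α') fun γ' =>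
      ind W q (fun a' => M (integral W X s s α.app) a')
        (ind X s (fun a => M a (refl q)) d α γ) α' γ'

def runit (W X s k β f q p α γ α' γ' : HEx) : HEx :=
  (((cst 32 [W, X, s, k, β, f, q, p]).app α).app γ |>.app α').app γ'

/-- The right unit law for paths, by induction on the homotopy `β`. -/
def runitEntry : Entry :=
  let W := par 0; let X := par 1; let s := par 2; let k := par 3; let β := par 4
  let f := par 5; let q := par 6; let p := par 7
  .lemma unitTele (runitStep W X s k β.app f q p)
    (htpyInd W (lam W fun _ => W) (idFun W)
      (lam (arrow W W) fun k => lam (pi W fun w => id W w (k.app w)) fun β =>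
        runitStep W X s k β.app f q p)
      (unitStepVal W X s q (fun a a' => id (id (arrow W X) (comp W f s) (comp W s q))
          (runitSource W X s (idFun W) f q p a a') p) (runitRefl W X s f q p)) k β)

/-- The left unit law for paths that are given by homotopies `α` and `α'`, both determined by `β`. -/
def lunitStep (W X s k : HEx) (β : HEx → HEx) (f q p : HEx) : HEx :=
  let src := lunitSource W X s k f q p
  unitHtpy W X s (comp W s k) (fun w => mapPath X s.app w (k.app w) (β w)) fun α =>
  unitHtpy W W q (comp W k q) (fun w => β (q.app w)) fun α' =>
    id (id (arrow W X) (comp W f s) (comp W s q))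
      (src (integral W X s (comp W s k) α) (integral W W q (comp W k q) α')) p

def lunit (W X s k β f q p α γ α' γ' : HEx) : HEx :=
  (((cst 33 [W, X, s, k, β, f, q, p]).app α).app γ |>.app α').app γ'

/-- The left unit law for paths, by induction on the homotopy `β`. -/
def lunitEntry : Entry :=
  let W := par 0; let X := par 1; let s := par 2; let k := par 3; let β := par 4
  let f := par 5; let q := par 6; let p := par 7
  .lemma unitTele (lunitStep W X s k β.app f q p)
    (htpyInd W (lam W fun _ => W) (idFun W)
      (lam (arrow W W) fun k => lam (pi W fun w => id W w (k.app w)) fun β =>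
        lunitStep W X s k β.app f q p)
      (unitStepVal W X s q (fun a a' => id (id (arrow W X) (comp W f s) (comp W s q))
          (lunitSource W X s (idFun W) f q p a a') p) (lunitRefl W X s f q p)) k β)

def polyIdHtpy (A B X : HEx) : HEx := cst 34 [A, B, X]

/-- The homotopy from the identity of `P X` to `P(1_X)` that is `refl` at canonical pairs. -/
def polyIdHtpyEntry : Entry :=
  let A := par 0; let B := par 1; let X := par 2
  let P := poly A B X
  let k := polyMap A B X X (idFun X)
  .define [univ, arrow A univ, univ] (pi P fun w => id P w (k.app w))
    (lam P fun w => split (fun w => id P w (k.app w)) (fun x u => refl (pair (polyFam B X) x u)) w)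

/-- The homotopy from `f` to `g` on `P X` that is `refl` at canonical pairs. -/
def polyReflHtpy (A B X Y : HEx) (f g : HEx → HEx) : HEx :=
  lam (poly A B X) fun w =>
    split (fun w => id Y (f w) (g w)) (fun x u => refl (f (pair (polyFam B X) x u))) w

/-- The path between two paths over `w : P X` that are both `refl` at canonical pairs. -/
def polyReflHtpy₂ (A B X Y : HEx) (f g b α : HEx → HEx) : HEx :=
  lam (poly A B X) fun w =>
    split (fun w => id (id Y (f w) (g w)) (b w) (α w))
      (fun x u => refl (refl (f (pair (polyFam B X) x u)))) w

def homEta (A B C D f : HEx) : HEx := cst 35 [A, B, C, D, f]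

/-- A morphism is equal to the pair of its components. -/
def homEtaEntry : Entry :=
  let A := par 0; let B := par 1; let C := par 2; let D := par 3; let f := par 4
  let η (f : HEx) : HEx :=
    pair (isAlgHom A B C D) (homFun A B C D f) (homPath A B C D f)
  .lemma [univ, arrow A univ, alg A B, alg A B, algHom A B C D] (id (algHom A B C D) (η f) f)
    (split (fun f => id (algHom A B C D) (η f) f)
      (fun f p => refl (pair (isAlgHom A B C D) f p)) f)

/-- A unit law `Id(lhs, f)` for algebra morphisms, from a unit law for the paths. The functions `r`
and `b` describe the homotopy from `P(f)` to its composite with `P(1_C)`. -/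
def unitVal
    (law : HEx → HEx → HEx → HEx → HEx → HEx → HEx → HEx → HEx → HEx → HEx → HEx → HEx)
    (r : HEx → HEx → HEx) (b : HEx → HEx → HEx → HEx) (lhs path : HEx) (A B C f : HEx) : HEx :=
  let H := algHom A B C C
  let X := carrier A B C
  let W := poly A B X
  let s := str A B C
  let k := polyMap A B X X (idFun X)
  let β := polyIdHtpy A B X
  let f₀ := homFun A B C C f
  let p := homPath A B C C f
  let mk (p : HEx) : HEx := pair (isAlgHom A B C C) f₀ p
  let q := polyMap A B X X f₀
  let α := polyReflHtpy A B X X (fun w => s.app w) (fun w => s.app (k.app w))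
  let α' := polyReflHtpy A B X W (fun w => q.app w) (r q k).app
  pathComp H lhs (mk p) f (homEta A B C C f)
    (mapPath H mk path p
      (law W X s k β f₀ q p α
        (polyReflHtpy₂ A B X X s.app (comp W s k).app
          (fun w => mapPath X s.app w (k.app w) (β.app w)) α.app)
        α' (polyReflHtpy₂ A B X W q.app (r q k).app (b q β) α'.app)))

def unitR (A B C f : HEx) : HEx := cst 36 [A, B, C, f]

/-- The types of `A`, `B`, an algebra and an endomorphism of it. -/
def algEndTele : List HEx :=
  [univ, arrow (par 0) univ, alg (par 0) (par 1), algHom (par 0) (par 1) (par 2) (par 2)]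

/-- The right unit law for endomorphisms of algebras, `f ∘ 1_C = f`. -/
def unitREntry : Entry :=
  let A := par 0; let B := par 1; let C := par 2; let f := par 3
  let X := carrier A B C
  let W := poly A B X
  let k := polyMap A B X X (idFun X)
  let I := algId A B C
  .lemma algEndTele (id (algHom A B C C) (algComp A B C C C f I) f)
    (unitVal runit (fun q k => comp W q k)
      (fun q β w => mapPath W q.app w (k.app w) (β.app w))
      (algComp A B C C C f I) (algCompPath A B C C C f I) A B C f)

def unitL (A B C f : HEx) : HEx := cst 37 [A, B, C, f]

/-- The left unit law for endomorphisms of algebras, `1_C ∘ f = f`. -/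
def unitLEntry : Entry :=
  let A := par 0; let B := par 1; let C := par 2; let f := par 3
  let X := carrier A B C
  let W := poly A B X
  let I := algId A B C
  .lemma algEndTele (id (algHom A B C C) (algComp A B C C C I f) f)
    (unitVal lunit (fun q k => comp W k q) (fun q β w => β.app (q.app w))
      (algComp A B C C C I f) (algCompPath A B C C C I f) A B C f)

/-- The constants number 30 to 37. -/
def unitLemmas : List Entry := [runitReflEntry, lunitReflEntry, runitEntry, lunitEntry,
  polyIdHtpyEntry, homEtaEntry, unitREntry, unitLEntry]

/-! ### Algebra equivalences -/

/-- The algebra with carrier `X` and structure map `s`. -/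
def mkAlg (A B X s : HEx) : HEx := pair (strFam A B) X s

/-- The algebra morphism with underlying function `f` and path `p`. -/
def mkHom (A B C D f p : HEx) : HEx := pair (isAlgHom A B C D) f p

/-- The algebra equivalence given by a morphism `f` and a proof `e` that it is an equivalence. -/
def mkEquiv (A B C D f e : HEx) : HEx := pair (isAlgEquiv A B C D) f e

/-- The types of `A`, `B` and an algebra. -/
def algTele : List HEx := [univ, arrow (par 0) univ, alg (par 0) (par 1)]

def idAlgEquivProp (A B C e e' : HEx) : HEx := cst 38 [A, B, C, e, e']

/-- Any two proofs that an identity morphism is an equivalence are equal: left and right inverses of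
the identity are fibers of functions that are homotopic to the identity by the unit laws. -/
def idAlgEquivPropEntry : Entry :=
  let A := par 0; let B := par 1; let C := par 2; let e := par 3; let e' := par 4
  let H := algHom A B C C
  let I := algId A B C
  let T := isAlgEquiv A B C C I
  .lemma (algTele ++ [T, T]) (id T e e')
    (prodProp (algLeftInv A B C C I) (algRightInv A B C C I)
      (fibContr H (lam H fun g => algComp A B C C C g I) (lam H fun g => unitR A B C g) I)
      (fibContr H (lam H fun g => algComp A B C C C I g) (lam H fun g => unitL A B C g) I) e e')

/-- Identity morphisms are equivalences. -/
def idAlgEquivEntry : Entry :=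
  .lemma [] idEquivType
    (lam univ fun A => lam (arrow A univ) fun B => lam (alg A B) fun C =>
      let I := algId A B C
      let H := algHom A B C C
      pair (fun _ => algRightInv A B C C I)
        (pair (fun g => id H (algComp A B C C C g I) I) I (unitR A B C I))
        (pair (fun h => id H (algComp A B C C C I h) I) I (unitL A B C I)))

def algEquivFun (A B C D f e : HEx) : HEx := cst 40 [A, B, C, D, f, e]

/-- The function underlying an algebra equivalence is an equivalence. -/
def algEquivFunEntry : Entry :=
  let A := par 0; let B := par 1; let C := par 2; let D := par 3; let f := par 4; let e := par 5
  let X := carrier A B C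
  let Y := carrier A B D
  let T := isEquiv X Y (homFun A B C D f)
  let at_ (C x : HEx) (g : HEx) : HEx := (homFun A B C C g).app x
  .lemma (algTele ++ [alg A B, algHom A B C D, isAlgEquiv A B C D f]) T
    (split (fun _ => T) (fun l r => split (fun _ => T) (fun g α => split (fun _ => T) (fun h β =>
      biinvEquiv X Y (homFun A B C D f) (homFun A B D C g) (homFun A B D C h)
        (lam X fun x => mapPath X (at_ C x) (algComp A B C D C g f) (algId A B C) α)
        (lam Y fun y => mapPath Y (at_ D y) (algComp A B D C D f h) (algId A B D) β)) r) l) e)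

/-- The type of preimages of an algebra equivalence `r` under the canonical function. -/
def preimage (A B ι C D r : HEx) : HEx :=
  sigma (id (alg A B) C D) fun p => id (algEquiv A B C D) ((extAlg A B ι C D).app p) r

/-- The morphism whose underlying function is the identity of `X`, from the structure map `s` to `t`. -/
def idHom (A B X s t p : HEx) : HEx := mkHom A B (mkAlg A B X s) (mkAlg A B X t) (idFun X) p

/-- The family of proofs that the identity of `X` is a morphism from the structure map `s` to `t`. -/
def idHomFam (A B X s t : HEx) : HEx :=
  isAlgHom A B (mkAlg A B X s) (mkAlg A B X t) (idFun X)

def idHomContr (A B X s : HEx) : HEx := cst 41 [A, B, X, s]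

/-- The pairs of a structure map `t` and a proof that the identity is a morphism from `s` to `t` form
a contractible type: this is a fiber of `t ↦ t ∘ P(1_X)`, which is homotopic to the identity. -/
def idHomContrEntry : Entry :=
  let A := par 0; let B := par 1; let X := par 2; let s := par 3
  let W := poly A B X
  let T := strFam A B X
  let k := polyMap A B X X (idFun X)
  .lemma [univ, arrow A univ, univ, T] (isContr (sigma T (idHomFam A B X s)))
    (cofibContr T (lam T fun t => comp W t k) (lam T fun t => funext (comp W t k) t
      (polyReflHtpy A B X X (comp W t k).app t.app).app) s)

def idPreimage (A B ι X s t p e : HEx) : HEx := cst 42 [A, B, ι, X, s, t, p, e]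

/-- The types of `A`, `B` and `ι`. -/
def preimageTele : List HEx :=
  [univ, arrow (par 0) univ, idIsAlgEquiv (par 0) (par 1)]

/-- An equivalence whose underlying function is an identity function comes from a path: since
`idHomContr` is contractible, `t` may be replaced by `s` and the morphism by the identity morphism,
and then `refl` is a preimage because `ι(C)` is equal to any other proof. -/
def idPreimageEntry : Entry :=
  let A := par 0; let B := par 1; let ι := par 2; let X := par 3; let s := par 4; let t := par 5
  let p := par 6; let e := par 7
  let T := strFam A B X
  let C := mkAlg A B X s
  let isEq (t p : HEx) : HEx := isAlgEquiv A B C (mkAlg A B X t) (idHom A B X s t p)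
  let goal (t p e : HEx) : HEx := preimage A B ι C (mkAlg A B X t)
    (mkEquiv A B C (mkAlg A B X t) (idHom A B X s t p) e)
  let fam := idHomFam A B X s
  let pt (t p : HEx) : HEx := pair fam t p
  let p₀ := algIdPath A B C
  .lemma (preimageTele ++ [univ, T, T, fam t, isEq t p]) (goal t p e)
    ((transport (fun c => pi (isEq (fst T c) (snd T fam c)) fun e => goal (fst T c) (snd T fam c) e)
      (pt s p₀) (pt t p) (contrProp (sigma T fam) (idHomContr A B X s) (pt s p₀) (pt t p))
      (lam (isEq s p₀) fun e =>
        pair (fun q => id (algEquiv A B C C) ((extAlg A B ι C C).app q)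
            (mkEquiv A B C C (idHom A B X s s p₀) e)) (refl C)
          (mapPath (algEquiv A B C C) (fun e => mkEquiv A B C C (algId A B C) e) (ι.app C) e
            (idAlgEquivProp A B C (ι.app C) e)))).app e)

/-- The statement that all equivalences of algebras with underlying function `f` come from paths. -/
def preimages (A B ι X Y s t f : HEx) : HEx :=
  let C := mkAlg A B X s
  let D := mkAlg A B Y t
  pi (isAlgHom A B C D f) fun p => pi (isAlgEquiv A B C D (mkHom A B C D f p)) fun e =>
    preimage A B ι C D (mkEquiv A B C D (mkHom A B C D f p) e)

def equivPreimages (ua A B ι X Y s t F : HEx) : HEx := cst 43 [ua, A, B, ι, X, Y, s, t, F]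

/-- The case of an arbitrary equivalence of the carriers reduces to the identity by univalence. -/
def equivPreimagesEntry : Entry :=
  let ua := par 0; let A := par 1; let B := par 2; let ι := par 3; let X := par 4; let Y := par 5
  let s := par 6; let t := par 7; let F := par 8
  let goal (X Y s t F : HEx) : HEx := preimages A B ι X Y s t (fst (arrow X Y) F)
  let T := goal X Y s t F
  .lemma [univalence, univ, arrow A univ, idIsAlgEquiv A B, univ, univ, strFam A B X, strFam A B Y,
      equiv X Y] T
    (split (fun _ => T) (fun c _ => split (fun _ => T) (fun p w =>
        transport (fun F => goal X Y s t F) ((extU X Y).app p) F w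
          ((J (fun X Y p => pi (strFam A B X) fun s => pi (strFam A B Y) fun t =>
              goal X Y s t ((extU X Y).app p))
            (fun X => lam (strFam A B X) fun s => lam (strFam A B X) fun t =>
              let C := mkAlg A B X s
              let D := mkAlg A B X t
              lam (isAlgHom A B C D (idFun X)) fun p =>
                lam (isAlgEquiv A B C D (mkHom A B C D (idFun X) p)) fun e =>
                  idPreimage A B ι X s t p e) X Y p).app s |>.app t)) c)
      (((ua.app X).app Y).app F))

def algPreimage (ua A B ι C D r : HEx) : HEx := cst 44 [ua, A, B, ι, C, D, r]

/-- Every equivalence of algebras comes from a path: `equivPreimages` applies to its components. -/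
def algPreimageEntry : Entry :=
  let ua := par 0; let A := par 1; let B := par 2; let ι := par 3; let C := par 4; let D := par 5
  let r := par 6
  .lemma [univalence, univ, arrow A univ, idIsAlgEquiv A B, alg A B, alg A B, algEquiv A B C D]
    (preimage A B ι C D r)
    ((split (fun C => pi (alg A B) fun D => pi (algEquiv A B C D) fun r => preimage A B ι C D r)
      (fun X s => lam (alg A B) fun D =>
        split (fun D => pi (algEquiv A B (mkAlg A B X s) D) fun r =>
            preimage A B ι (mkAlg A B X s) D r)
          (fun Y t =>
            let C := mkAlg A B X s
            let D := mkAlg A B Y t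
            lam (algEquiv A B C D) fun r => split (fun r => preimage A B ι C D r)
              (fun h e => (split (fun h => pi (isAlgEquiv A B C D h) fun e =>
                  preimage A B ι C D (mkEquiv A B C D h e))
                (fun f p => lam (isAlgEquiv A B C D (mkHom A B C D f p)) fun e =>
                  ((equivPreimages ua A B ι X Y s t (pair (fun f => isEquiv X Y f) f
                    (algEquivFun A B C D (mkHom A B C D f p) e))).app p).app e) h).app e) r) D)
      C).app D |>.app r)

/-- The canonical function is an equivalence. A right inverse `s` is given by the preimages, and
`s(r) · s(ext(refl))⁻¹` defines a left inverse: at `r = ext(p)` it is equal to `p` by induction on `p`.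
The values `biinvEquivVal`, `pathCompVal`, … are used since the type of algebras is not in `U`. -/
def extAlgEquivEntry : Entry :=
  let ua := par 0
  .lemma [univalence] algUnivalence
    (lam univ fun A => lam (arrow A univ) fun B => lam (idIsAlgEquiv A B) fun ι =>
      lam (alg A B) fun C => lam (alg A B) fun D =>
        let I (C D : HEx) : HEx := id (alg A B) C D
        let ext (C D p : HEx) : HEx := (extAlg A B ι C D).app p
        let fam (C D r : HEx) : HEx → HEx := fun p => id (algEquiv A B C D) (ext C D p) r
        let sec (C D r : HEx) : HEx := fst (I C D) (algPreimage ua A B ι C D r)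
        let c (C : HEx) : HEx := sec C C (ext C C (refl C))
        let ret (C D r : HEx) : HEx :=
          pathCompVal (alg A B) C C D (sec C D r) (pathInvVal (alg A B) C C (c C))
        biinvEquivVal (I C D) (algEquiv A B C D) (extAlg A B ι C D) (ret C D) (sec C D)
          (fun p => J (fun C D p => id (I C D) (ret C D (ext C D p)) p)
            (fun C => compInvVal (alg A B) C C (c C)) C D p)
          (fun r => snd (I C D) (fam C D r) (algPreimage ua A B ι C D r)))

/-- The constants number 38 to 45. -/
def equivLemmas : List Entry := [idAlgEquivPropEntry, idAlgEquivEntry, algEquivFunEntry,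
  idHomContrEntry, idPreimageEntry, equivPreimagesEntry, algPreimageEntry, extAlgEquivEntry]

end HEx

end TTH

namespace TTH

open Tm Jdg HEx

/-! ### Inhabitants from the table of constants -/

/-- The definitions of `H` that occur in the theorem, followed by the lemmas of its proof. -/
def table : List Entry := definitions ++ pathLemmas ++ unitLemmas ++ equivLemmas

theorem entryOk_definitions : ∀ n < 22, entryOk table n = true := by decide +kernel

theorem entryOk_pathLemmas : ∀ n < 8, entryOk table (22 + n) = true := by decide +kernel

theorem entryOk_unitLemmas : ∀ n < 8, entryOk table (30 + n) = true := by decide +kernel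

theorem entryOk_equivLemmas : ∀ n < 8, entryOk table (38 + n) = true := by decide +kernel

theorem entryOk_table (n : ℕ) (hn : n < table.length) : entryOk table n = true := by
  have hn : n < 46 := hn
  by_cases h1 : n < 22
  · exact entryOk_definitions n h1
  by_cases h2 : n < 30
  · simpa [show 22 + (n - 22) = n by omega] using entryOk_pathLemmas (n - 22) (by omega)
  by_cases h3 : n < 38
  · simpa [show 30 + (n - 30) = n by omega] using entryOk_unitLemmas (n - 30) (by omega)
  · simpa [show 38 + (n - 38) = n by omega] using entryOk_equivLemmas (n - 38) (by omega)

/-- The value of a constant of the table is a term of `H` of the declared type. -/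
theorem derivable_value {n : ℕ} {en : Entry} (h : table[n]? = some en) :
    Derivable (ctxTm (values table table.length) en.tele.reverse)
      (term (values table table.length n) (en.res.toTm (values table table.length))) := by
  have hn := (List.getElem?_eq_some_iff.1 h).1
  refine (sigOf_valid entryOk_table table.length le_rfl n en ?_).2.1
  have : Nat.blt n table.length = true := by rwa [Nat.blt_eq]
  rw [sigOf, this, cond_true, h]

/-- Syntactic equality, in a form that the kernel evaluates quickly. -/
def Tm.beq : Tm → Tm → Bool
  | .var n, .var n' => Nat.beq n n'
  | .univ, .univ => true
  | .pi A B, .pi A' B' => A.beq A' && B.beq B'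
  | .lam A b, .lam A' b' => A.beq A' && b.beq b'
  | .app f a, .app f' a' => f.beq f' && a.beq a'
  | .sigma A B, .sigma A' B' => A.beq A' && B.beq B'
  | .pair B a b, .pair B' a' b' => B.beq B' && a.beq a' && b.beq b'
  | .split E e c, .split E' e' c' => E.beq E' && e.beq e' && c.beq c'
  | .id A a b, .id A' a' b' => A.beq A' && a.beq a' && b.beq b'
  | .refl a, .refl a' => a.beq a'
  | .J E e a b p, .J E' e' a' b' p' =>
      E.beq E' && e.beq e' && a.beq a' && b.beq b' && p.beq p'
  | .funext f g α, .funext f' g' α' => f.beq f' && g.beq g' && α.beq α'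
  | _, _ => false

theorem Tm.eq_of_beq {t t' : Tm} (h : t.beq t' = true) : t = t' := by
  fun_induction Tm.beq t t' <;> simp_all [Bool.and_eq_true]

/-- Replacing all constants by their values gives the type of the theorem. -/
theorem toTm_idEquivType :
    (HEx.idEquivType 0).toTm (values table table.length) = TTH.idEquivType :=
  Tm.eq_of_beq (by decide +kernel)

theorem toTm_univalence : (HEx.univalence 0).toTm (values table table.length) = TTH.univalence :=
  Tm.eq_of_beq (by decide +kernel)

theorem toTm_algUnivalence :
    (HEx.algUnivalence 1).toTm (values table table.length) = TTH.algUnivalence :=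
  Tm.eq_of_beq (by decide +kernel)

theorem isInhabited_idEquivType : IsInhabited [] TTH.idEquivType := by
  have h := derivable_value (n := 39) (en := idAlgEquivEntry) rfl
  exact ⟨_, toTm_idEquivType ▸ h⟩

/-- The univalence axiom is the only parameter of the last constant. -/
theorem isInhabited_algUnivalence : IsInhabited [TTH.univalence] TTH.algUnivalence := by
  have h : Derivable [(HEx.univalence 0).toTm (values table table.length)]
      (term _ ((HEx.algUnivalence 1).toTm (values table table.length))) :=
    derivable_value (n := 45) (en := extAlgEquivEntry) rfl
  rw [toTm_univalence, toTm_algUnivalence] at h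
  exact ⟨_, h⟩

end TTH

theorem theorem4p12 :
    TTH.IsInhabited [] TTH.idEquivType ∧ TTH.IsInhabited [TTH.univalence] TTH.algUnivalence :=
  ⟨TTH.isInhabited_idEquivType, TTH.isInhabited_algUnivalence⟩
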